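/- Let $d\ge 2$ be an integer, let $\frac4d<\alpha<\frac4{d-1}$ and let $\omega>0$. Write $z=(x,y)\in\mathbb R^d\times\mathbb R$ and \[ \Sigma=\Big\{u\in H^1(\mathbb R^{d+1};\mathbb C):\ \int_{\mathbb R^{d+1}}y^2|u|^2\,dz<\infty\Big\}. \] For $\phi\in\Sigma$ put \[ S_\omega(\phi)=\tfrac12\|\nabla_z\phi\|_{L^2}^2+\tfrac12\|y\phi\|_{L^2}^2+\tfrac{\omega}{2}\|\phi\|_{L^2}^2-\tfrac1{\alpha+2}\|\phi\|_{L^{\alpha+2}}^{\alpha+2}, \qquad Q(\phi)=\|\nabla_x\phi\|_{L^2}^2-\tfrac{\alpha d}{2(\alpha+2)}\|\phi\|_{L^{\alpha+2}}^{\alpha+2}, \] where all norms are over $\mathbb R^{d+1}$. Define \[ m_\omega=\inf\{S_\omega(\phi):\ \phi\in\Sigma\setminus\{0\},\ Q(\phi)=0\}, \] \[ m_{GS}=\inf\{S_\omega(\phi):\ \phi\in\Sigma\setminus\{0\}\ \text{is a weak solution of}\ -\Delta_z\phi+y^2\phi+\omega\phi=|\phi|^\alpha\phi\}, \] and \[ P_\omega^+=\{\phi\in\Sigma\setminus\{0\}:\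 S_\omega(\phi)<m_\omega,\ Q(\phi)\ge0\},\qquad \mathcal K_\omega^+=\{\phi\in\Sigma\setminus\{0\}:\ S_\omega(\phi)<m_{GS},\ Q(\phi)\ge0\}. \] Then $m_\omega=m_{GS}$. Hence $P_\omega^+=\mathcal K_\omega^+$. -/

import Mathlib

open MeasureTheory

noncomputable section

namespace PHNLS

/-- The physical space `ℝ^d × ℝ`, with points `z = (x, y)`; its `volume` is Lebesgue measure.
(The sup norm of the product plays no role: only partial derivatives are used.) -/
abbrev Space (d : ℕ) : Type := EuclideanSpace ℝ (Fin d) × ℝ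

/-- The complex Hilbert space `L²(ℝ^{d+1})`. -/
abbrev L2 (d : ℕ) : Type := Lp ℂ 2 (volume : Measure (Space d))

/-- The unit vector in the direction `x_i`. -/
def dirX {d : ℕ} (i : Fin d) : Space d := (EuclideanSpace.single i 1, 0)

/-- The unit vector in the direction `y`. -/
def dirY (d : ℕ) : Space d := (0, 1)

/-- Test functions: real-valued, smooth and compactly supported on `ℝ^{d+1}`. -/
def IsTest {d : ℕ} (ψ : Space d → ℝ) : Prop := ContDiff ℝ (⊤ : ℕ∞) ψ ∧ HasCompactSupport ψ

/-- `g ∈ L²` is the weak (distributional) derivative of `φ ∈ L²` in the direction `v`. -/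
def HasWeakDeriv {d : ℕ} (φ g : L2 d) (v : Space d) : Prop :=
  ∀ ψ : Space d → ℝ, IsTest ψ →
    ∫ z, fderiv ℝ ψ z v • φ z = - ∫ z, ψ z • g z

open Classical in
/-- The weak derivative `∂_v φ` as an element of `L²` (zero if there is none in `L²`). -/
def weakDeriv {d : ℕ} (v : Space d) (φ : L2 d) : L2 d :=
  if h : ∃ g : L2 d, HasWeakDeriv φ g v then h.choose else 0

/-- Weak derivatives are unique. -/
theorem HasWeakDeriv.unique {d : ℕ} {φ g₁ g₂ : L2 d} {v : Space d}
    (h₁ : HasWeakDeriv φ g₁ v) (h₂ : HasWeakDeriv φ g₂ v) : g₁ = g₂ := by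
  have hloc : ∀ g : L2 d, LocallyIntegrable (fun z => g z) (volume : Measure (Space d)) :=
    fun g => (Lp.memLp g).locallyIntegrable (by norm_num)
  refine Lp.ext ?_
  have key : ∀ᵐ z ∂(volume : Measure (Space d)), g₁ z - g₂ z = 0 := by
    refine ae_eq_zero_of_integral_contDiff_smul_eq_zero ((hloc g₁).sub (hloc g₂)) ?_
    intro ψ hψ hc
    have e : ∫ z, ψ z • g₁ z = ∫ z, ψ z • g₂ z :=
      neg_injective ((h₁ ψ ⟨hψ, hc⟩).symm.trans (h₂ ψ ⟨hψ, hc⟩))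
    have i₁ := (hloc g₁).integrable_smul_left_of_hasCompactSupport hψ.continuous hc
    have i₂ := (hloc g₂).integrable_smul_left_of_hasCompactSupport hψ.continuous hc
    calc ∫ z, ψ z • (g₁ z - g₂ z) = ∫ z, (ψ z • g₁ z - ψ z • g₂ z) := by
          simp only [smul_sub]
      _ = 0 := by rw [integral_sub i₁ i₂, e, sub_self]
  filter_upwards [key] with z hz using sub_eq_zero.mp hz

theorem HasWeakDeriv.weakDeriv_eq {d : ℕ} {φ g : L2 d} {v : Space d}
    (h : HasWeakDeriv φ g v) : weakDeriv v φ = g := by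
  have hex : ∃ g : L2 d, HasWeakDeriv φ g v := ⟨g, h⟩
  rw [weakDeriv, dif_pos hex]
  exact hex.choose_spec.unique h

/-- The energy space `Σ = {u ∈ H¹(ℝ^{d+1}) : ∫ y² |u|² dz < ∞}`. -/
def Sigma (d : ℕ) : Set (L2 d) :=
  {φ | (∀ i : Fin d, ∃ g : L2 d, HasWeakDeriv φ g (dirX i)) ∧
    (∃ g : L2 d, HasWeakDeriv φ g (dirY d)) ∧
    Integrable (fun z : Space d => z.2 ^ 2 * ‖φ z‖ ^ 2)}

/-- `‖∇_x φ‖²` in `L²(ℝ^{d+1})`. -/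
def gradXSq {d : ℕ} (φ : L2 d) : ℝ := ∑ i : Fin d, ‖weakDeriv (dirX i) φ‖ ^ 2

/-- `‖∇_z φ‖²` in `L²(ℝ^{d+1})`. -/
def gradSq {d : ℕ} (φ : L2 d) : ℝ := gradXSq φ + ‖weakDeriv (dirY d) φ‖ ^ 2

/-- The mass `M(φ)`. -/
def mass {d : ℕ} (φ : L2 d) : ℝ := ∫ z, ‖φ z‖ ^ 2

/-- The energy `E(φ)`. -/
def energy {d : ℕ} (α : ℝ) (φ : L2 d) : ℝ :=
  1 / 2 * gradSq φ + 1 / 2 * (∫ z, z.2 ^ 2 * ‖φ z‖ ^ 2)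
    - 1 / (α + 2) * ∫ z, ‖φ z‖ ^ (α + 2)

/-- The action `S_ω(φ) = E(φ) + (ω/2) M(φ)`. -/
def action {d : ℕ} (α ω : ℝ) (φ : L2 d) : ℝ := energy α φ + ω / 2 * mass φ

/-- The semivirial functional `Q(φ)`. -/
def semivirial {d : ℕ} (α : ℝ) (φ : L2 d) : ℝ :=
  gradXSq φ - α * d / (2 * (α + 2)) * ∫ z, ‖φ z‖ ^ (α + 2)

/-- `φ` is a weak solution of `-Δ_z φ + y² φ + ω φ = |φ|^α φ`. Real test functions suffice for
this complex-valued identity, which is linear in the test function. -/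
def SolvesElliptic {d : ℕ} (α ω : ℝ) (φ : L2 d) : Prop :=
  ∀ ψ : Space d → ℝ, IsTest ψ →
    (∑ i : Fin d, ∫ z, fderiv ℝ ψ z (dirX i) • weakDeriv (dirX i) φ z)
      + (∫ z, fderiv ℝ ψ z (dirY d) • weakDeriv (dirY d) φ z)
      + (∫ z, (ψ z * (z.2 ^ 2 + ω)) • φ z)
    = ∫ z, (ψ z * ‖φ z‖ ^ α) • φ z

/-- The constraint set `K = {φ ∈ Σ \ {0} : Q(φ) = 0}`. -/
def constraintSet (d : ℕ) (α : ℝ) : Set (L2 d) :=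
  {φ | φ ∈ Sigma d ∧ φ ≠ 0 ∧ semivirial α φ = 0}

/-- The nontrivial solutions in `Σ` of the elliptic equation. -/
def solutionSet (d : ℕ) (α ω : ℝ) : Set (L2 d) :=
  {φ | φ ∈ Sigma d ∧ φ ≠ 0 ∧ SolvesElliptic α ω φ}

/-- `m_ω = inf {S_ω(φ) : φ ∈ K}`; the infimum is taken in the extended reals, so that
no convention for empty or unbounded sets interferes. -/
def mOmega (d : ℕ) (α ω : ℝ) : EReal :=
  ⨅ φ ∈ constraintSet d α, (action α ω φ : EReal)

/-- The ground state level `m_GS`, the infimum of `S_ω` over the nontrivial solutions. -/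
def mGS (d : ℕ) (α ω : ℝ) : EReal :=
  ⨅ φ ∈ solutionSet d α ω, (action α ω φ : EReal)

/-- The set `P_ω⁺`. -/
def PPlus (d : ℕ) (α ω : ℝ) : Set (L2 d) :=
  {φ | φ ∈ Sigma d ∧ φ ≠ 0 ∧ (action α ω φ : EReal) < mOmega d α ω ∧ 0 ≤ semivirial α φ}

/-- The set `𝒦_ω⁺`. -/
def KPlus (d : ℕ) (α ω : ℝ) : Set (L2 d) :=
  {φ | φ ∈ Sigma d ∧ φ ≠ 0 ∧ (action α ω φ : EReal) < mGS d α ω ∧ 0 ≤ semivirial α φ}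

end PHNLS

end

/-! ### Functions of finite energy, their weak gradients and the real L² pairing -/

noncomputable section

namespace PHNLS

open Filter Topology ENNReal

variable {d : ℕ}

/-! Write A = ‖∇_x φ‖², T = ‖∂_y φ‖² + ‖yφ‖² + ω‖φ‖² and N = ∫ |φ|^(α+2). The L²-preserving dilation
l^(d/2) φ(l x, y) turns A, T, N into l² A, T and l^(αd/2) N, and Q is the derivative of S along it
at l = 1. The bound αd > 4 makes the nonlinear power of l the larger one; α < 4/(d-1) makes α + 2
subcritical in dimension d + 1. Eliminating N by means of Q leaves the positive form I = S - 2/(αd)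
Q = (1/2 - 2/(αd)) A + T/2 (`quadFun`). Every φ ≠ 0 has a dilate with Q = 0, and if Q(φ) ≤ 0 the
factor is at most 1, so the action of that dilate is at most I(φ) (`Admissible.le_quadFun`).

The inequality m_ω ≤ m_GS says that solutions satisfy Q = 0. Formally the equation is tested with
the generator (d/2 + x·∇_x)φ, which need not have finite energy. The remedy has two steps. Testing
with W²φ, where W is a bounded truncation of a coordinate x_i, shows x_i ∂_k φ ∈ L²
(`Admissible.memLp_coord_smul_grad`), so dilation by e^t moves φ by O(|t|) in L². The equation is
then tested with the finite increment φ_t - φ, which does lie in the energy space. Its quadratic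
error δ(t) is even in t, and by subcriticality the Taylor remainder of N is at most δ(t)/2 + C t².
Adding the identities at t and -t gives δ = O(t²), and the first-order terms yield Q = 0
(`eq_of_dilation_expansion`, `Admissible.virialFun_eq_zero`).

The inequality m_GS ≤ m_ω says that the infimum over Q = 0 is attained at a solution. On Q = 0 the
action equals I, so minimizing sequences are bounded in the energy space. The Sobolev inequality for
dilates bounds A, hence N, from below (`Admissible.exists_gradX_lower`), and averaging over cutoffs
in x finds translates that keep a fixed part of N in a cylinder (`exists_shift_lower`). The weight
y² gives compactness on cylinders, so the translated sequence has a weak limit v ≠ 0. The quantities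
A, T, N split between v and the remainder (`tendsto_powInt_add_sub` for N). If Q(v) > 0, the
remainder eventually has Q < 0 and I ≥ m_ω, which leaves I(v) ≤ 0, a contradiction. Thus Q(v) ≤ 0
and I(v) ≤ m_ω, and the dilate of v on Q = 0 is a minimizer (`Admissible.exists_minimizer`).

No Lagrange multiplier occurs for a minimizer u: after u + s v is dilated back onto Q = 0, the
action is an explicit function of s with a minimum at 0, and its derivative there is the weak
equation (`Admissible.weakSolution_of_minimizer`). -/

instance : (volume : Measure (Space d)).IsAddHaarMeasure :=
  inferInstanceAs ((volume : Measure (EuclideanSpace ℝ (Fin d))).prod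
    (volume : Measure ℝ)).IsAddHaarMeasure

/-- Separability is what makes weak-* compact balls sequentially compact in `exists_subseq_weak`. -/
instance : SecondCountableTopology (L2 d) :=
  haveI : Fact ((2 : ℝ≥0∞) ≠ ∞) := ⟨by norm_num⟩
  Lp.SecondCountableTopology

/-- The coordinate directions of `ℝ^d × ℝ`: `some i` is `x_i`, `none` is `y`. -/
def dir : Option (Fin d) → Space d
  | some i => dirX i
  | none => dirY d

/-- The weak derivative of functions, without reference to classes in `L²`. -/
def WeakDerivFun (u g : Space d → ℂ) (v : Space d) : Prop :=
  ∀ ψ : Space d → ℝ, IsTest ψ → ∫ z, fderiv ℝ ψ z v • u z = - ∫ z, ψ z • g z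

/-- `u` represents an element of the energy space with weak gradient `G`. -/
structure EnergyFun (u : Space d → ℂ) (G : Option (Fin d) → Space d → ℂ) : Prop where
  memLp : MemLp u 2
  grad_memLp : ∀ k, MemLp (G k) 2
  weight_memLp : MemLp (fun z => z.2 • u z) 2
  weak : ∀ k, WeakDerivFun u (G k) (dir k)

/-- The squared `L²` norm. -/
def normSq (f : Space d → ℂ) : ℝ := ∫ z, ‖f z‖ ^ 2

/-- The real `L²` inner product. -/
def innerRe (f g : Space d → ℂ) : ℝ := ∫ z, inner ℝ (f z) (g z)

theorem normSq_nonneg (f : Space d → ℂ) : 0 ≤ normSq f :=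
  integral_nonneg fun _ => by positivity

theorem integrable_normSq {f : Space d → ℂ} (hf : MemLp f 2) :
    Integrable fun z => ‖f z‖ ^ 2 :=
  (memLp_two_iff_integrable_sq_norm hf.1).1 hf

theorem integrable_innerRe {f g : Space d → ℂ} (hf : MemLp f 2) (hg : MemLp g 2) :
    Integrable fun z => inner ℝ (f z) (g z) := by
  refine Integrable.mono' ((integrable_normSq hf).add (integrable_normSq hg))
    (hf.1.inner hg.1) (Eventually.of_forall fun z => ?_)
  have h1 : ‖inner ℝ (f z) (g z)‖ ≤ ‖f z‖ * ‖g z‖ := norm_inner_le_norm _ _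
  simp only [Pi.add_apply]
  nlinarith [sq_nonneg (‖f z‖ - ‖g z‖), sq_nonneg (‖f z‖), sq_nonneg (‖g z‖)]

theorem innerRe_comm (f g : Space d → ℂ) : innerRe f g = innerRe g f := by
  unfold innerRe
  congr 1 with z
  exact real_inner_comm _ _

theorem innerRe_self (f : Space d → ℂ) : innerRe f f = normSq f := by
  unfold innerRe normSq
  congr 1 with z
  exact real_inner_self_eq_norm_sq _

theorem innerRe_add_left {f g h : Space d → ℂ} (hf : MemLp f 2) (hg : MemLp g 2)
    (hh : MemLp h 2) : innerRe (f + g) h = innerRe f h + innerRe g h := by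
  unfold innerRe
  rw [← integral_add (integrable_innerRe hf hh) (integrable_innerRe hg hh)]
  congr 1 with z
  exact inner_add_left _ _ _

theorem innerRe_sub_left {f g h : Space d → ℂ} (hf : MemLp f 2) (hg : MemLp g 2)
    (hh : MemLp h 2) : innerRe (f - g) h = innerRe f h - innerRe g h := by
  unfold innerRe
  rw [← integral_sub (integrable_innerRe hf hh) (integrable_innerRe hg hh)]
  congr 1 with z
  exact inner_sub_left _ _ _

theorem innerRe_add_right {f g h : Space d → ℂ} (hf : MemLp f 2) (hg : MemLp g 2)
    (hh : MemLp h 2) : innerRe h (f + g) = innerRe h f + innerRe h g := by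
  rw [innerRe_comm, innerRe_add_left hf hg hh, innerRe_comm f, innerRe_comm g]

theorem innerRe_sub_right {f g h : Space d → ℂ} (hf : MemLp f 2) (hg : MemLp g 2)
    (hh : MemLp h 2) : innerRe h (f - g) = innerRe h f - innerRe h g := by
  rw [innerRe_comm, innerRe_sub_left hf hg hh, innerRe_comm f, innerRe_comm g]

theorem innerRe_smul_right (f g : Space d → ℂ) (c : ℝ) :
    innerRe f (c • g) = c * innerRe f g := by
  unfold innerRe
  rw [← integral_const_mul]
  congr 1 with z
  exact real_inner_smul_right _ _ _

theorem normSq_smul (f : Space d → ℂ) (c : ℝ) : normSq (c • f) = c ^ 2 * normSq f := by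
  unfold normSq
  rw [← integral_const_mul]
  congr 1 with z
  simp [mul_pow]

theorem normSq_sub {f g : Space d → ℂ} (hf : MemLp f 2) (hg : MemLp g 2) :
    normSq (f - g) = normSq f + normSq g - 2 * innerRe f g := by
  rw [← innerRe_self, innerRe_sub_left hf hg (hf.sub hg), innerRe_sub_right hf hg hf,
    innerRe_sub_right hf hg hg, innerRe_self, innerRe_self, innerRe_comm g f]
  ring

theorem normSq_add {f g : Space d → ℂ} (hf : MemLp f 2) (hg : MemLp g 2) :
    normSq (f + g) = normSq f + normSq g + 2 * innerRe f g := by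
  rw [← innerRe_self, innerRe_add_left hf hg (hf.add hg), innerRe_add_right hf hg hf,
    innerRe_add_right hf hg hg, innerRe_self, innerRe_self, innerRe_comm g f]
  ring

theorem normSq_add_le {f g : Space d → ℂ} (hf : MemLp f 2) (hg : MemLp g 2) :
    normSq (f + g) ≤ 2 * normSq f + 2 * normSq g := by
  have := normSq_nonneg (f - g)
  rw [normSq_sub hf hg] at this
  rw [normSq_add hf hg]
  linarith

theorem normSq_sub_le {f g : Space d → ℂ} (hf : MemLp f 2) (hg : MemLp g 2) :
    normSq (f - g) ≤ 2 * normSq f + 2 * normSq g := by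
  have := normSq_nonneg (f + g)
  rw [normSq_add hf hg] at this
  rw [normSq_sub hf hg]
  linarith

/-- Cauchy–Schwarz by the discriminant of the nonnegative quadratic c ↦ `normSq (f - c • g)`. -/
theorem sq_innerRe_le {f g : Space d → ℂ} (hf : MemLp f 2) (hg : MemLp g 2) :
    innerRe f g ^ 2 ≤ normSq f * normSq g := by
  have key : ∀ c : ℝ, 0 ≤ normSq g * (c * c) + (-2 * innerRe f g) * c + normSq f := by
    intro c
    have h := normSq_nonneg (f - c • g)
    rw [normSq_sub hf (hg.const_smul c), normSq_smul, innerRe_smul_right] at h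
    linarith
  have := discrim_le_zero key
  unfold discrim at this
  linarith

theorem abs_innerRe_le {f g : Space d → ℂ} (hf : MemLp f 2) (hg : MemLp g 2) :
    |innerRe f g| ≤ √(normSq f) * √(normSq g) := by
  rw [← Real.sqrt_mul (normSq_nonneg f)]
  exact Real.abs_le_sqrt (sq_innerRe_le hf hg)

theorem eLpNorm_sq_eq {f : Space d → ℂ} (hf : MemLp f 2) :
    eLpNorm f 2 volume = ENNReal.ofReal (√(normSq f)) := by
  rw [hf.eLpNorm_eq_integral_rpow_norm (by norm_num) (by norm_num), Real.sqrt_eq_rpow]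
  simp [normSq]

theorem normSq_congr {f g : Space d → ℂ} (h : f =ᵐ[volume] g) : normSq f = normSq g :=
  integral_congr_ae (h.mono fun z hz => by simp [hz])

theorem norm_Lp_sq (φ : L2 d) : ‖φ‖ ^ 2 = normSq φ := by
  have h := eLpNorm_sq_eq (Lp.memLp φ)
  rw [Lp.norm_def, h, ENNReal.toReal_ofReal (Real.sqrt_nonneg _), Real.sq_sqrt (normSq_nonneg _)]

theorem eq_zero_ae_of_normSq_eq_zero {f : Space d → ℂ} (hf : MemLp f 2) (h : normSq f = 0) :
    f =ᵐ[volume] 0 := by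
  have := (integral_eq_zero_iff_of_nonneg (fun z => by positivity) (integrable_normSq hf)).1 h
  filter_upwards [this] with z hz
  simpa using hz

theorem integrable_smul_of_test {ψ : Space d → ℝ} (hψ : Continuous ψ) (hc : HasCompactSupport ψ)
    {u : Space d → ℂ} (hu : MemLp u 2) : Integrable fun z => ψ z • u z :=
  (hu.locallyIntegrable (by norm_num)).integrable_smul_left_of_hasCompactSupport hψ hc

theorem IsTest.fderiv_continuous {ψ : Space d → ℝ} (hψ : IsTest ψ) (v : Space d) :
    Continuous fun z => fderiv ℝ ψ z v :=
  (hψ.1.continuous_fderiv (by simp)).clm_apply continuous_const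

theorem IsTest.fderiv_hasCompactSupport {ψ : Space d → ℝ} (hψ : IsTest ψ) (v : Space d) :
    HasCompactSupport fun z => fderiv ℝ ψ z v :=
  hψ.2.fderiv_apply (𝕜 := ℝ) v

theorem IsTest.differentiable {ψ : Space d → ℝ} (hψ : IsTest ψ) : Differentiable ℝ ψ :=
  hψ.1.differentiable (by simp)

theorem IsTest.mul_contDiff {ψ w : Space d → ℝ} (hψ : IsTest ψ) (hw : ContDiff ℝ (⊤ : ℕ∞) w) :
    IsTest fun z => ψ z * w z :=
  ⟨hψ.1.mul hw, hψ.2.mul_right⟩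

namespace WeakDerivFun

variable {u u' g g' : Space d → ℂ} {v : Space d}

theorem add (h : WeakDerivFun u g v) (h' : WeakDerivFun u' g' v) (hu : MemLp u 2)
    (hu' : MemLp u' 2) (hg : MemLp g 2) (hg' : MemLp g' 2) :
    WeakDerivFun (u + u') (g + g') v := by
  intro ψ hψ
  have c := hψ.fderiv_continuous v
  have s := hψ.fderiv_hasCompactSupport v
  simp only [Pi.add_apply, smul_add]
  rw [integral_add (integrable_smul_of_test c s hu) (integrable_smul_of_test c s hu'),
    integral_add (integrable_smul_of_test hψ.1.continuous hψ.2 hg)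
      (integrable_smul_of_test hψ.1.continuous hψ.2 hg'), h ψ hψ, h' ψ hψ]
  ring

theorem const_smul (h : WeakDerivFun u g v) (c : ℂ) : WeakDerivFun (c • u) (c • g) v := by
  intro ψ hψ
  simp only [Pi.smul_apply, smul_comm _ c]
  rw [integral_smul, integral_smul, h ψ hψ, smul_neg]

theorem dir_smul (h : WeakDerivFun u g v) (c : ℝ) : WeakDerivFun u (c • g) (c • v) := by
  intro ψ hψ
  simp only [Pi.smul_apply, map_smul, smul_assoc, smul_comm _ c]
  rw [integral_smul, integral_smul, h ψ hψ, smul_neg]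

theorem congr (h : WeakDerivFun u g v) (hu : u =ᵐ[volume] u') (hg : g =ᵐ[volume] g') :
    WeakDerivFun u' g' v := by
  intro ψ hψ
  have h1 : ∫ z, fderiv ℝ ψ z v • u z = ∫ z, fderiv ℝ ψ z v • u' z :=
    integral_congr_ae (hu.mono fun z hz => by simp only [hz])
  have h2 : ∫ z, ψ z • g z = ∫ z, ψ z • g' z :=
    integral_congr_ae (hg.mono fun z hz => by simp only [hz])
  rw [← h1, ← h2]
  exact h ψ hψ

/-- The Leibniz rule for the product with a smooth function. -/
theorem mul_smooth (h : WeakDerivFun u g v) (hu : MemLp u 2) (hg : MemLp g 2)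
    {w : Space d → ℝ} (hw : ContDiff ℝ (⊤ : ℕ∞) w) :
    WeakDerivFun (fun z => w z • u z) (fun z => w z • g z + fderiv ℝ w z v • u z) v := by
  intro ψ hψ
  -- The factor `w` is absorbed into the test function; the term of the product rule with the
  -- derivative of `w` moves to the other side.
  have key := h _ (hψ.mul_contDiff hw)
  have hwd : Differentiable ℝ w := hw.differentiable (by simp)
  have hwc : Continuous fun z => fderiv ℝ w z v :=
    (hw.continuous_fderiv (by simp)).clm_apply continuous_const
  have e : ∀ z, fderiv ℝ (fun z => ψ z * w z) z v = ψ z * fderiv ℝ w z v + fderiv ℝ ψ z v * w z := by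
    intro z
    rw [fderiv_fun_mul hψ.differentiable.differentiableAt hwd.differentiableAt]
    simp [mul_comm]
  have hψw : HasCompactSupport fun z => ψ z * fderiv ℝ w z v := hψ.2.mul_right
  have i1 : Integrable fun z => (ψ z * fderiv ℝ w z v) • u z :=
    integrable_smul_of_test (hψ.1.continuous.mul hwc) hψw hu
  have i2 : Integrable fun z => (fderiv ℝ ψ z v * w z) • u z := integrable_smul_of_test ((hψ.fderiv_continuous v).mul hw.continuous)
    ((hψ.fderiv_hasCompactSupport v).mul_right (f' := w)) hu
  have i3 : Integrable fun z => (ψ z * w z) • g z := integrable_smul_of_test (hψ.1.continuous.mul hw.continuous)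
    (hψ.2.mul_right (f' := w)) hg
  simp only [e, add_smul] at key
  rw [integral_add i1 i2] at key
  simp only [smul_add, smul_smul]
  rw [integral_add i3 i1]
  linear_combination key

end WeakDerivFun

namespace EnergyFun

variable {u u' : Space d → ℂ} {G G' : Option (Fin d) → Space d → ℂ}

theorem add (h : EnergyFun u G) (h' : EnergyFun u' G') : EnergyFun (u + u') (G + G') where
  memLp := h.memLp.add h'.memLp
  grad_memLp k := (h.grad_memLp k).add (h'.grad_memLp k)
  weight_memLp := by
    convert h.weight_memLp.add h'.weight_memLp using 1
    ext z
    simp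
  weak k := (h.weak k).add (h'.weak k) h.memLp h'.memLp (h.grad_memLp k) (h'.grad_memLp k)

theorem const_smul (h : EnergyFun u G) (c : ℂ) : EnergyFun (c • u) (c • G) where
  memLp := h.memLp.const_smul c
  grad_memLp k := (h.grad_memLp k).const_smul c
  weight_memLp := by
    convert h.weight_memLp.const_smul c using 1
    ext z
    simp only [Pi.smul_apply]
    exact smul_comm _ _ _
  weak k := (h.weak k).const_smul c

theorem neg (h : EnergyFun u G) : EnergyFun (-u) (-G) := by
  simpa using h.const_smul (-1)

theorem sub (h : EnergyFun u G) (h' : EnergyFun u' G') : EnergyFun (u - u') (G - G') := by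
  simpa [sub_eq_add_neg] using h.add h'.neg

theorem mul_smooth (h : EnergyFun u G) {w : Space d → ℝ} (hw : ContDiff ℝ (⊤ : ℕ∞) w) {C : ℝ}
    (hC : ∀ z, |w z| ≤ C) (hC' : ∀ k z, |fderiv ℝ w z (dir k)| ≤ C) :
    EnergyFun (fun z => w z • u z)
      (fun k z => w z • G k z + fderiv ℝ w z (dir k) • u z) := by
  have hb : ∀ {a : Space d → ℝ} {f : Space d → ℂ}, Continuous a → (∀ z, |a z| ≤ C) →
      MemLp f 2 volume → MemLp (fun z => a z • f z) 2 volume := by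
    intro a f ha hac hf
    refine hf.of_le_mul (c := C) (ha.aestronglyMeasurable.smul hf.1)
      (Eventually.of_forall fun z => ?_)
    rw [norm_smul]
    exact mul_le_mul_of_nonneg_right (hac z) (norm_nonneg _)
  have hwc : ∀ v, Continuous fun z => fderiv ℝ w z v := fun v =>
    (hw.continuous_fderiv (by simp)).clm_apply continuous_const
  refine ⟨hb hw.continuous hC h.memLp, fun k => (hb hw.continuous hC (h.grad_memLp k)).add
    (hb (hwc _) (hC' k) h.memLp), ?_, fun k => (h.weak k).mul_smooth h.memLp (h.grad_memLp k) hw⟩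
  convert hb hw.continuous hC h.weight_memLp using 1
  ext z
  exact smul_comm _ _ _

end EnergyFun

/-- Membership in the energy space rules out the default value in `weakDeriv`, and uniqueness
identifies the chosen class with a true derivative. Together with `EnergyFun.toLp_mem_Sigma` this
allows all analysis to be done with functions. -/
theorem energyFun_of_mem_Sigma {φ : L2 d} (h : φ ∈ Sigma d) :
    EnergyFun φ (fun k => weakDeriv (dir k) φ) := by
  obtain ⟨h1, h2, h3⟩ := h
  refine ⟨Lp.memLp φ, fun k => Lp.memLp _, ?_, ?_⟩
  · refine (memLp_two_iff_integrable_sq_norm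
      (continuous_snd.aestronglyMeasurable.smul (Lp.aestronglyMeasurable φ))).2 ?_
    simpa [mul_pow] using h3
  · rintro (_ | i)
    · obtain ⟨g, hg⟩ := h2
      change HasWeakDeriv φ (weakDeriv (dirY d) φ) (dirY d)
      rw [hg.weakDeriv_eq]
      exact hg
    · obtain ⟨g, hg⟩ := h1 i
      change HasWeakDeriv φ (weakDeriv (dirX i) φ) (dirX i)
      rw [hg.weakDeriv_eq]
      exact hg

namespace EnergyFun

variable {u : Space d → ℂ} {G : Option (Fin d) → Space d → ℂ}

theorem hasWeakDeriv_toLp (h : EnergyFun u G) (k : Option (Fin d)) :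
    HasWeakDeriv h.memLp.toLp (h.grad_memLp k).toLp (dir k) :=
  (h.weak k).congr h.memLp.coeFn_toLp.symm (h.grad_memLp k).coeFn_toLp.symm

theorem toLp_mem_Sigma (h : EnergyFun u G) : h.memLp.toLp ∈ Sigma d := by
  refine ⟨fun i => ⟨_, h.hasWeakDeriv_toLp (some i)⟩, ⟨_, h.hasWeakDeriv_toLp none⟩, ?_⟩
  refine (integrable_normSq h.weight_memLp).congr ?_
  filter_upwards [h.memLp.coeFn_toLp] with z hz
  rw [hz]
  simp [mul_pow]

theorem weakDeriv_toLp (h : EnergyFun u G) (k : Option (Fin d)) :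
    weakDeriv (dir k) h.memLp.toLp = (h.grad_memLp k).toLp :=
  (h.hasWeakDeriv_toLp k).weakDeriv_eq

end EnergyFun

/-- `‖∇_x u‖²` in terms of the gradient. -/
def gradX (G : Option (Fin d) → Space d → ℂ) : ℝ := ∑ i : Fin d, normSq (G (some i))

/-- `‖∂_y u‖² + ‖y u‖² + ω ‖u‖²`. -/
def transverse (ω : ℝ) (u : Space d → ℂ) (G : Option (Fin d) → Space d → ℂ) : ℝ :=
  normSq (G none) + normSq (fun z => z.2 • u z) + ω * normSq u

/-- `∫ |u|^p`. -/
def powInt (p : ℝ) (u : Space d → ℂ) : ℝ := ∫ z, ‖u z‖ ^ p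

theorem gradXSq_eq (φ : L2 d) : gradXSq φ = gradX fun k => weakDeriv (dir k) φ := by
  simp only [gradXSq, gradX, norm_Lp_sq]
  rfl

/-- The terms are grouped by their behaviour under dilations in x: each of the three pieces is
multiplied by a power of the factor. -/
theorem action_eq (α ω : ℝ) (φ : L2 d) :
    action α ω φ = 1 / 2 * gradX (fun k => weakDeriv (dir k) φ)
      + 1 / 2 * transverse ω φ (fun k => weakDeriv (dir k) φ)
      - 1 / (α + 2) * powInt (α + 2) φ := by
  have h : normSq (fun z : Space d => z.2 • φ z) = ∫ z : Space d, z.2 ^ 2 * ‖φ z‖ ^ 2 := by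
    simp [normSq, mul_pow]
  unfold action energy gradSq transverse powInt mass
  rw [gradXSq_eq, norm_Lp_sq, h]
  simp only [normSq, dir]
  ring

theorem semivirial_eq (α : ℝ) (φ : L2 d) :
    semivirial α φ = gradX (fun k => weakDeriv (dir k) φ)
      - α * d / (2 * (α + 2)) * powInt (α + 2) φ := by
  rw [semivirial, gradXSq_eq, powInt]

theorem gradX_congr {G G' : Option (Fin d) → Space d → ℂ} (h : ∀ k, G k =ᵐ[volume] G' k) :
    gradX G = gradX G' := by
  unfold gradX
  exact Finset.sum_congr rfl fun i _ => normSq_congr (h _)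

theorem transverse_congr (ω : ℝ) {u u' : Space d → ℂ} {G G' : Option (Fin d) → Space d → ℂ}
    (hu : u =ᵐ[volume] u') (h : ∀ k, G k =ᵐ[volume] G' k) :
    transverse ω u G = transverse ω u' G' := by
  unfold transverse
  rw [normSq_congr (h none), normSq_congr hu, normSq_congr (f := fun z => z.2 • u z) (g := fun z => z.2 • u' z)
    (hu.mono fun z hz => by simp [hz])]

theorem powInt_congr (p : ℝ) {u u' : Space d → ℂ} (hu : u =ᵐ[volume] u') :
    powInt p u = powInt p u' :=
  integral_congr_ae (hu.mono fun z hz => by simp [hz])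

namespace EnergyFun

variable {u : Space d → ℂ} {G : Option (Fin d) → Space d → ℂ}

theorem weakDeriv_toLp_ae (h : EnergyFun u G) (k : Option (Fin d)) :
    weakDeriv (dir k) h.memLp.toLp =ᵐ[volume] G k := by
  rw [h.weakDeriv_toLp]
  exact (h.grad_memLp k).coeFn_toLp

theorem action_toLp (h : EnergyFun u G) (α ω : ℝ) :
    action α ω h.memLp.toLp = 1 / 2 * gradX G + 1 / 2 * transverse ω u G
      - 1 / (α + 2) * powInt (α + 2) u := by
  rw [action_eq, gradX_congr h.weakDeriv_toLp_ae,
    transverse_congr ω h.memLp.coeFn_toLp h.weakDeriv_toLp_ae,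
    powInt_congr _ h.memLp.coeFn_toLp]

theorem semivirial_toLp (h : EnergyFun u G) (α : ℝ) :
    semivirial α h.memLp.toLp = gradX G - α * d / (2 * (α + 2)) * powInt (α + 2) u := by
  rw [semivirial_eq, gradX_congr h.weakDeriv_toLp_ae, powInt_congr _ h.memLp.coeFn_toLp]

end EnergyFun

end PHNLS

end

noncomputable section

namespace PHNLS

open Filter Topology ENNReal

variable {d : ℕ}

/-! ### Translations and dilations in `x` -/

/-- Change of variables with ψ ∘ T⁻¹ as test function. The Jacobian `c` multiplies both sides, so
its value does not matter. -/
theorem WeakDerivFun.comp_equiv {u g : Space d → ℂ} {v : Space d} (T : Space d ≃L[ℝ] Space d)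
    {c : ℝ≥0∞} (hT : Measure.map T volume = c • (volume : Measure (Space d)))
    (h : WeakDerivFun u g (T v)) : WeakDerivFun (fun z => u (T z)) (fun z => g (T z)) v := by
  intro ψ hψ
  have hme : MeasurableEmbedding T := T.toHomeomorph.measurableEmbedding
  have hψ' : IsTest fun z => ψ (T.symm z) :=
    ⟨hψ.1.comp T.symm.contDiff, hψ.2.comp_homeomorph T.symm.toHomeomorph⟩
  have hd : ∀ z, fderiv ℝ (fun z => ψ (T.symm z)) z (T v) = fderiv ℝ ψ (T.symm z) v := by
    intro z
    have : HasFDerivAt (fun z => ψ (T.symm z))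
        ((fderiv ℝ ψ (T.symm z)).comp (T.symm : Space d →L[ℝ] Space d)) z :=
      (hψ.differentiable _).hasFDerivAt.comp z T.symm.hasFDerivAt
    rw [this.fderiv]
    simp
  have key := h _ hψ'
  simp only [hd] at key
  have e1 := hme.integral_map (μ := volume) (fun z => fderiv ℝ ψ (T.symm z) v • u z)
  have e2 := hme.integral_map (μ := volume) (fun z => ψ (T.symm z) • g z)
  simp only [ContinuousLinearEquiv.symm_apply_apply, hT, integral_smul_measure] at e1 e2
  rw [← e1, ← e2, key, smul_neg]

/-- The dilation `(x, y) ↦ (l x, y)` as a linear equivalence. -/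
def dilateEquiv {l : ℝ} (hl : l ≠ 0) : Space d ≃L[ℝ] Space d :=
  (ContinuousLinearEquiv.smulLeft (Units.mk0 l hl)).prodCongr (ContinuousLinearEquiv.refl ℝ ℝ)

@[simp]
theorem dilateEquiv_apply {l : ℝ} (hl : l ≠ 0) (z : Space d) :
    dilateEquiv hl z = (l • z.1, z.2) := rfl

theorem map_dilateEquiv {l : ℝ} (hl : 0 < l) :
    Measure.map (dilateEquiv hl.ne') (volume : Measure (Space d))
      = ENNReal.ofReal ((l ^ d)⁻¹) • volume := by
  have h1 := Measure.map_addHaar_smul (volume : Measure (EuclideanSpace ℝ (Fin d))) hl.ne'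
  rw [finrank_euclideanSpace_fin, abs_of_pos (by positivity)] at h1
  have h2 := Measure.map_prod_map (volume : Measure (EuclideanSpace ℝ (Fin d)))
    (volume : Measure ℝ) (f := fun x => l • x) (g := id) (by fun_prop) measurable_id
  rw [h1, Measure.map_id, Measure.prod_smul_left] at h2
  exact h2.symm

theorem integral_comp_dilate {E : Type*} [NormedAddCommGroup E] [NormedSpace ℝ E]
    {l : ℝ} (hl : 0 < l) (f : Space d → E) :
    ∫ z : Space d, f (l • z.1, z.2) = (l ^ d)⁻¹ • ∫ z, f z := by
  have := (dilateEquiv hl.ne').toHomeomorph.measurableEmbedding.integral_map (μ := volume) f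
  simp only [ContinuousLinearEquiv.coe_toHomeomorph, dilateEquiv_apply] at this
  rw [map_dilateEquiv hl, integral_smul_measure, ENNReal.toReal_ofReal (by positivity)] at this
  exact this.symm

theorem memLp_comp_dilate {f : Space d → ℂ} {p : ℝ≥0∞} (hf : MemLp f p) {l : ℝ} (hl : 0 < l) :
    MemLp (fun z : Space d => f (l • z.1, z.2)) p := by
  have hme := (dilateEquiv (d := d) hl.ne').toHomeomorph.measurableEmbedding
  have : MemLp f p (Measure.map (dilateEquiv hl.ne') (volume : Measure (Space d))) := by
    rw [map_dilateEquiv hl]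
    exact hf.smul_measure ENNReal.ofReal_ne_top
  exact hme.memLp_map_measure_iff.1 this

/-- The `L²`-normalised dilation `l^{d/2} f(l x, y)`. -/
def dilate (l : ℝ) (f : Space d → ℂ) : Space d → ℂ :=
  fun z => (l ^ ((d : ℝ) / 2)) • f (l • z.1, z.2)

/-- The gradient of a dilated function. -/
def dilateGrad (l : ℝ) (G : Option (Fin d) → Space d → ℂ) : Option (Fin d) → Space d → ℂ
  | some i => l • dilate l (G (some i))
  | none => dilate l (G none)

theorem memLp_dilate {f : Space d → ℂ} {p : ℝ≥0∞} (hf : MemLp f p) {l : ℝ} (hl : 0 < l) :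
    MemLp (dilate l f) p :=
  (memLp_comp_dilate hf hl).const_smul (l ^ ((d : ℝ) / 2))

theorem dilate_one (f : Space d → ℂ) : dilate 1 f = f := by
  ext z
  simp [dilate]

theorem dilate_dilate {l m : ℝ} (hl : 0 < l) (hm : 0 < m) (f : Space d → ℂ) :
    dilate l (dilate m f) = dilate (m * l) f := by
  ext z
  simp only [dilate, smul_smul]
  rw [Real.mul_rpow hm.le hl.le, mul_comm]

theorem rpow_half_sq {l : ℝ} (hl : 0 < l) : (l ^ ((d : ℝ) / 2)) ^ 2 = l ^ d := by
  rw [← Real.rpow_natCast, ← Real.rpow_mul hl.le, ← Real.rpow_natCast]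
  congr 1
  push_cast
  ring

theorem innerRe_dilate {l : ℝ} (hl : 0 < l) (f g : Space d → ℂ) :
    innerRe (dilate l f) (dilate l g) = innerRe f g := by
  have := integral_comp_dilate (d := d) hl fun z => inner ℝ (f z) (g z)
  simp only [innerRe, dilate, real_inner_smul_left, real_inner_smul_right, ← mul_assoc, ← sq]
  rw [rpow_half_sq hl, integral_const_mul, this]
  have := (pow_pos hl d).ne'
  simp [this]

theorem normSq_dilate {l : ℝ} (hl : 0 < l) (f : Space d → ℂ) :
    normSq (dilate l f) = normSq f := by
  rw [← innerRe_self, ← innerRe_self, innerRe_dilate hl]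

/-- The normalisation contributes l^(dp/2), the change of the d variables x contributes l^(-d). -/
theorem powInt_dilate {l : ℝ} (hl : 0 < l) (p : ℝ) (f : Space d → ℂ) :
    powInt p (dilate l f) = l ^ ((d : ℝ) * (p / 2 - 1)) * powInt p f := by
  have h := integral_comp_dilate (d := d) hl fun z => ‖f z‖ ^ p
  have hp : 0 < l ^ ((d : ℝ) / 2) := Real.rpow_pos_of_pos hl _
  simp only [powInt, dilate, norm_smul, Real.norm_of_nonneg hp.le]
  simp only [Real.mul_rpow hp.le (norm_nonneg _)]
  rw [integral_const_mul, h, smul_eq_mul, ← mul_assoc]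
  congr 1
  rw [← Real.rpow_mul hl.le, ← Real.rpow_natCast, ← Real.rpow_neg hl.le, ← Real.rpow_add hl]
  congr 1
  ring

theorem dilate_weight (l : ℝ) (u : Space d → ℂ) :
    dilate l (fun z => z.2 • u z) = fun z => z.2 • dilate l u z := by
  ext z
  simp only [dilate]
  exact smul_comm _ _ _

theorem EnergyFun.dilate {u : Space d → ℂ} {G : Option (Fin d) → Space d → ℂ}
    (h : EnergyFun u G) {l : ℝ} (hl : 0 < l) : EnergyFun (dilate l u) (dilateGrad l G) := by
  refine ⟨memLp_dilate h.memLp hl, ?_, ?_, ?_⟩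
  · rintro (_ | i)
    · exact memLp_dilate (h.grad_memLp none) hl
    · exact (memLp_dilate (h.grad_memLp (some i)) hl).const_smul l
  · rw [← dilate_weight]
    exact memLp_dilate h.weight_memLp hl
  · have hc : ∀ {f g : Space d → ℂ} {v : Space d}, WeakDerivFun f g (dilateEquiv hl.ne' v) →
        WeakDerivFun (PHNLS.dilate l f) (PHNLS.dilate l g) v := by
      intro f g v hfg
      have := (hfg.comp_equiv _ (map_dilateEquiv hl)).const_smul ((l ^ ((d : ℝ) / 2) : ℝ) : ℂ)
      convert this using 1 <;>
      · ext z
        simp [PHNLS.dilate]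
    rintro (_ | i)
    · apply hc
      have : dilateEquiv hl.ne' (dir none) = (dir none : Space d) := by
        simp [dir, dirY]
      rw [this]
      exact h.weak none
    -- The dilation multiplies the directions x_i by `l` and fixes the direction y, hence the factor
    -- `l` in these components only.
    · have e : dilateGrad l G (some i) = PHNLS.dilate l (l • G (some i)) := by
        ext z
        simp only [dilateGrad, PHNLS.dilate, Pi.smul_apply]
        exact smul_comm _ _ _
      rw [e]
      apply hc
      have : dilateEquiv hl.ne' (dir (some i)) = l • (dir (some i) : Space d) := by
        simp [dir, dirX]
      rw [this]
      exact (h.weak (some i)).dir_smul l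

theorem gradX_dilateGrad {l : ℝ} (hl : 0 < l) (G : Option (Fin d) → Space d → ℂ) :
    gradX (dilateGrad l G) = l ^ 2 * gradX G := by
  simp only [gradX, dilateGrad, normSq_smul, normSq_dilate hl, Finset.mul_sum]

theorem transverse_dilate {l : ℝ} (hl : 0 < l) (ω : ℝ) (u : Space d → ℂ)
    (G : Option (Fin d) → Space d → ℂ) :
    transverse ω (dilate l u) (dilateGrad l G) = transverse ω u G := by
  simp only [transverse, dilateGrad, ← dilate_weight, normSq_dilate hl]

/-- The translation of `f` in `x` by `a`. -/
def shift (a : EuclideanSpace ℝ (Fin d)) (f : Space d → ℂ) : Space d → ℂ :=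
  fun z => f (z + (a, 0))

theorem memLp_comp_add {f : Space d → ℂ} {p : ℝ≥0∞} (hf : MemLp f p) (w : Space d) :
    MemLp (fun z => f (z + w)) p :=
  hf.comp_measurePreserving (measurePreserving_add_right volume w)

theorem memLp_shift {f : Space d → ℂ} {p : ℝ≥0∞} (hf : MemLp f p)
    (a : EuclideanSpace ℝ (Fin d)) : MemLp (shift a f) p :=
  memLp_comp_add hf _

theorem WeakDerivFun.comp_add {u g : Space d → ℂ} {v : Space d} (h : WeakDerivFun u g v)
    (w : Space d) : WeakDerivFun (fun z => u (z + w)) (fun z => g (z + w)) v := by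
  intro ψ hψ
  have hψ' : IsTest fun z => ψ (z - w) :=
    ⟨hψ.1.comp (contDiff_id.sub contDiff_const), hψ.2.comp_homeomorph (Homeomorph.subRight w)⟩
  have key := h _ hψ'
  have hd : ∀ z, fderiv ℝ (fun z => ψ (z - w)) z = fderiv ℝ ψ (z - w) := fun z =>
    fderiv_comp_sub w
  simp only [hd] at key
  have e1 := integral_add_right_eq_self (μ := volume) (fun z => fderiv ℝ ψ (z - w) v • u z) w
  have e2 := integral_add_right_eq_self (μ := volume) (fun z => ψ (z - w) • g z) w
  simp only [add_sub_cancel_right] at e1 e2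
  rw [e1, e2, key]

theorem EnergyFun.shift {u : Space d → ℂ} {G : Option (Fin d) → Space d → ℂ}
    (h : EnergyFun u G) (a : EuclideanSpace ℝ (Fin d)) :
    EnergyFun (shift a u) (fun k => shift a (G k)) where
  memLp := memLp_shift h.memLp a
  grad_memLp k := memLp_shift (h.grad_memLp k) a
  weight_memLp := by
    convert memLp_shift h.weight_memLp a using 1
    ext z
    simp [PHNLS.shift]
  weak k := (h.weak k).comp_add _

theorem integral_shift (a : EuclideanSpace ℝ (Fin d)) (f : Space d → ℝ) :
    ∫ z, f (z + (a, 0)) = ∫ z, f z :=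
  integral_add_right_eq_self f _

theorem normSq_shift (a : EuclideanSpace ℝ (Fin d)) (f : Space d → ℂ) :
    normSq (shift a f) = normSq f :=
  integral_shift a fun z => ‖f z‖ ^ 2

theorem powInt_shift (a : EuclideanSpace ℝ (Fin d)) (p : ℝ) (f : Space d → ℂ) :
    powInt p (shift a f) = powInt p f :=
  integral_shift a fun z => ‖f z‖ ^ p

theorem gradX_shift (a : EuclideanSpace ℝ (Fin d)) (G : Option (Fin d) → Space d → ℂ) :
    gradX (fun k => shift a (G k)) = gradX G := by
  simp only [gradX, normSq_shift]

theorem transverse_shift (a : EuclideanSpace ℝ (Fin d)) (ω : ℝ) (u : Space d → ℂ)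
    (G : Option (Fin d) → Space d → ℂ) :
    transverse ω (shift a u) (fun k => shift a (G k)) = transverse ω u G := by
  have : (fun z : Space d => z.2 • shift a u z) = shift a fun z => z.2 • u z := by
    ext z
    simp [shift]
  simp only [transverse, this, normSq_shift]

end PHNLS

end

noncomputable section

namespace PHNLS

open Filter Topology ENNReal

variable {d : ℕ}

/-! ### Mollification -/

/-- The convolution of `u` with a normalised bump function. -/
def mollify (ρ : ContDiffBump (0 : Space d)) (u : Space d → ℂ) : Space d → ℂ :=
  convolution (ρ.normed volume) u (ContinuousLinearMap.lsmul ℝ ℝ) volume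

variable {ρ : ContDiffBump (0 : Space d)}

theorem mollify_apply (ρ : ContDiffBump (0 : Space d)) (u : Space d → ℂ) (z : Space d) :
    mollify ρ u z = ∫ w, ρ.normed volume w • u (z - w) := rfl

theorem mollify_apply_swap (ρ : ContDiffBump (0 : Space d)) (u : Space d → ℂ) (z : Space d) :
    mollify ρ u z = ∫ w, ρ.normed volume (z - w) • u w :=
  convolution_lsmul_swap

theorem contDiff_mollify (ρ : ContDiffBump (0 : Space d)) {u : Space d → ℂ} (hu : MemLp u 2) :
    ContDiff ℝ (⊤ : ℕ∞) (mollify ρ u) :=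
  ρ.hasCompactSupport_normed.contDiff_convolution_left _ ρ.contDiff_normed
    (hu.locallyIntegrable (by norm_num))

theorem isTest_normed_sub (ρ : ContDiffBump (0 : Space d)) (z : Space d) :
    IsTest fun w => ρ.normed volume (z - w) :=
  ⟨ρ.contDiff_normed.comp (contDiff_const.sub contDiff_id),
    ρ.hasCompactSupport_normed.comp_homeomorph (Homeomorph.subLeft z)⟩

/-- The derivative falls on the kernel, and w ↦ ρ(z - w) is itself a test function for the weak
derivative. The sign from the reflection cancels the sign from the integration by parts. -/
theorem fderiv_mollify (ρ : ContDiffBump (0 : Space d)) {u g : Space d → ℂ} {v : Space d}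
    (hu : MemLp u 2) (h : WeakDerivFun u g v) (z : Space d) :
    fderiv ℝ (mollify ρ u) z v = mollify ρ g z := by
  have hloc : LocallyIntegrable u volume := hu.locallyIntegrable (by norm_num)
  have hd := ρ.hasCompactSupport_normed.hasFDerivAt_convolution_left
    (ContinuousLinearMap.lsmul ℝ ℝ : ℝ →L[ℝ] ℂ →L[ℝ] ℂ) (μ := volume)
    (ρ.contDiff_normed (μ := volume) (n := 1)) hloc z
  have hex : ConvolutionExistsAt (fderiv ℝ (ρ.normed volume)) u z
      (ContinuousLinearMap.precompL (Space d)
        (ContinuousLinearMap.lsmul ℝ ℝ : ℝ →L[ℝ] ℂ →L[ℝ] ℂ)) volume :=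
    (ρ.hasCompactSupport_normed.fderiv (𝕜 := ℝ)).convolutionExists_left _
      ((ρ.contDiff_normed (n := 1)).continuous_fderiv (by simp)) hloc z
  have e1 : fderiv ℝ (mollify ρ u) z v = ∫ w, fderiv ℝ (ρ.normed volume) w v • u (z - w) := by
    unfold mollify
    rw [hd.fderiv, convolution_def, ContinuousLinearMap.integral_apply hex]
    rfl
  have e2 : ∫ w, fderiv ℝ (ρ.normed volume) w v • u (z - w)
      = ∫ w, fderiv ℝ (ρ.normed volume) (z - w) v • u w := by
    rw [← integral_sub_left_eq_self _ volume z]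
    simp
  have e3 : ∀ w, fderiv ℝ (fun w => ρ.normed volume (z - w)) w v
      = - fderiv ℝ (ρ.normed volume) (z - w) v := by
    intro w
    have h0 : HasFDerivAt (fun w : Space d => z - w) (-ContinuousLinearMap.id ℝ (Space d)) w :=
      (hasFDerivAt_id w).const_sub z
    have h1 : HasFDerivAt (ρ.normed volume) (fderiv ℝ (ρ.normed volume) (z - w)) (z - w) :=
      ((ρ.contDiff_normed (n := 1)).differentiable (by simp) _).hasFDerivAt
    have h2 : HasFDerivAt (fun w => ρ.normed volume (z - w)) _ w := h1.comp w h0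
    rw [h2.fderiv]
    simp
  have key := h _ (isTest_normed_sub ρ z)
  simp only [e3, neg_smul, integral_neg, neg_inj] at key
  rw [e1, e2, key, mollify_apply_swap]

/-- Jensen's inequality and Tonelli: mollification moves a function in `L²` no more than the
translations over which it averages. -/
theorem eLpNorm_mollify_sub_le (ρ : ContDiffBump (0 : Space d)) {u : Space d → ℂ}
    (hu : MemLp u 2) {C : ℝ≥0∞}
    (hC : ∀ w : Space d, ‖w‖ ≤ ρ.rOut → eLpNorm (fun z => u (z - w) - u z) 2 volume ≤ C) :
    eLpNorm (mollify ρ u - u) 2 volume ≤ C := by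
  set r : Space d → ℝ≥0∞ := fun w => ENNReal.ofReal (ρ.normed volume w) with hr
  have hrm : Measurable r := ρ.continuous_normed.measurable.ennreal_ofReal
  have hr1 : ∫⁻ w, r w = 1 := by
    rw [hr, ← ofReal_integral_eq_lintegral_ofReal ρ.integrable_normed
      (Eventually.of_forall ρ.nonneg_normed), ρ.integral_normed, ENNReal.ofReal_one]
  -- reduce to a strongly measurable representative
  set u' := hu.1.mk u with hu'
  have hum : StronglyMeasurable u' := hu.1.stronglyMeasurable_mk
  have hae : u =ᵐ[volume] u' := hu.1.ae_eq_mk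
  have haesub : ∀ w, (fun z => u (z - w)) =ᵐ[volume] fun z => u' (z - w) := fun w =>
    (measurePreserving_sub_right volume w).quasiMeasurePreserving.ae_eq_comp hae
  have hu2 : MemLp u' 2 := hu.ae_eq hae
  have hmoll : mollify ρ u = mollify ρ u' := by
    ext z
    rw [mollify_apply_swap, mollify_apply_swap]
    exact integral_congr_ae (hae.mono fun w hw => by simp only [hw])
  have h1 : ∀ z, ‖mollify ρ u' z - u' z‖ₑ ^ 2 ≤ ∫⁻ w, r w * ‖u' (z - w) - u' z‖ₑ ^ 2 := by
    intro z
    have hi : Integrable fun w => ρ.normed volume w • u' (z - w) :=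
      ρ.hasCompactSupport_normed.convolutionExists_left
        (ContinuousLinearMap.lsmul ℝ ℝ : ℝ →L[ℝ] ℂ →L[ℝ] ℂ) ρ.continuous_normed
        (hu2.locallyIntegrable (by norm_num)) z
    have e : mollify ρ u' z - u' z = ∫ w, ρ.normed volume w • (u' (z - w) - u' z) := by
      simp only [smul_sub]
      rw [integral_sub hi (ρ.integrable_normed.smul_const _), integral_smul_const,
        ρ.integral_normed, one_smul, mollify_apply]
    have hm : Measurable fun w => ‖u' (z - w) - u' z‖ₑ :=
      ((hum.measurable.comp (measurable_const.sub measurable_id)).sub measurable_const).enorm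
    have h2 : ‖mollify ρ u' z - u' z‖ₑ ≤ ∫⁻ w, r w * ‖u' (z - w) - u' z‖ₑ := by
      rw [e]
      refine (enorm_integral_le_lintegral_enorm _).trans_eq ?_
      congr 1 with w
      rw [enorm_smul, Real.enorm_eq_ofReal (ρ.nonneg_normed w)]
    -- Jensen's inequality as Cauchy–Schwarz: `r` is split into two square roots, and one of the
    -- factors has total mass 1.
    have h3 := ENNReal.lintegral_mul_le_Lp_mul_Lq (volume : Measure (Space d))
      (Real.HolderConjugate.two_two) (f := fun w => r w ^ (1 / 2 : ℝ))
      (g := fun w => r w ^ (1 / 2 : ℝ) * ‖u' (z - w) - u' z‖ₑ)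
      (hrm.pow_const _).aemeasurable ((hrm.pow_const _).mul hm).aemeasurable
    have e1 : ∀ w, ((fun w => r w ^ (1 / 2 : ℝ)) *
        fun w => r w ^ (1 / 2 : ℝ) * ‖u' (z - w) - u' z‖ₑ) w = r w * ‖u' (z - w) - u' z‖ₑ := by
      intro w
      simp only [Pi.mul_apply]
      rw [← mul_assoc, ← ENNReal.rpow_add_of_nonneg _ _ (by norm_num) (by norm_num)]
      norm_num
    have e2 : ∀ w, (r w ^ (1 / 2 : ℝ)) ^ (2 : ℝ) = r w := by
      intro w
      rw [← ENNReal.rpow_mul]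
      norm_num
    simp only [e1, e2, ENNReal.mul_rpow_of_nonneg _ _ (zero_le_two (α := ℝ)), hr1,
      ENNReal.one_rpow, one_mul] at h3
    calc ‖mollify ρ u' z - u' z‖ₑ ^ 2
        ≤ ((∫⁻ w, r w * ‖u' (z - w) - u' z‖ₑ ^ (2 : ℝ)) ^ (1 / 2 : ℝ)) ^ 2 := by
          gcongr
          exact h2.trans h3
      _ = _ := by
          rw [← ENNReal.rpow_natCast, ← ENNReal.rpow_mul]
          norm_num
  have hC' : ∀ w : Space d, ‖w‖ ≤ ρ.rOut → ∫⁻ z, ‖u' (z - w) - u' z‖ₑ ^ 2 ≤ C ^ 2 := by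
    intro w hw
    have h := hC w hw
    have hsub : (fun z => u (z - w) - u z) =ᵐ[volume] fun z => u' (z - w) - u' z :=
      (haesub w).sub hae
    rw [eLpNorm_congr_ae hsub] at h
    rw [eLpNorm_eq_lintegral_rpow_enorm_toReal (by norm_num) (by norm_num)] at h
    have := pow_le_pow_left' h 2
    rw [← ENNReal.rpow_natCast, ← ENNReal.rpow_mul] at this
    norm_num at this
    exact this
  have h4 : ∫⁻ z, ‖mollify ρ u' z - u' z‖ₑ ^ 2 ≤ C ^ 2 := by
    have hm2 : Measurable fun q : Space d × Space d => ‖u' (q.1 - q.2) - u' q.1‖ₑ ^ 2 :=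
      (((hum.measurable.comp (measurable_fst.sub measurable_snd)).sub
        (hum.measurable.comp measurable_fst)).enorm).pow_const 2
    have hm3 : Measurable fun q : Space d × Space d => r q.2 * ‖u' (q.1 - q.2) - u' q.1‖ₑ ^ 2 :=
      Measurable.mul (hrm.comp measurable_snd) hm2
    calc ∫⁻ z, ‖mollify ρ u' z - u' z‖ₑ ^ 2
        ≤ ∫⁻ z, ∫⁻ w, r w * ‖u' (z - w) - u' z‖ₑ ^ 2 := lintegral_mono h1
      _ = ∫⁻ w, ∫⁻ z, r w * ‖u' (z - w) - u' z‖ₑ ^ 2 :=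
          by
          have ha : AEMeasurable
              (Function.uncurry fun z w : Space d => r w * ‖u' (z - w) - u' z‖ₑ ^ 2)
              ((volume : Measure (Space d)).prod volume) := hm3.aemeasurable
          exact lintegral_lintegral_swap ha
      _ ≤ ∫⁻ w, r w * C ^ 2 := by
          refine lintegral_mono fun w => ?_
          have hmw : Measurable fun z => ‖u' (z - w) - u' z‖ₑ ^ 2 :=
            (((hum.measurable.comp (measurable_id.sub measurable_const)).sub
              hum.measurable).enorm).pow_const 2
          rw [lintegral_const_mul _ hmw]
          -- Larger shifts carry no mass of the kernel, so the assumed bound is needed only within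
          -- the outer radius.
          by_cases hw : ‖w‖ ≤ ρ.rOut
          · gcongr
            exact hC' w hw
          · have : ρ.normed volume w = 0 := by
              rw [← Function.notMem_support, ρ.support_normed_eq]
              simp only [Metric.mem_ball, dist_zero_right]
              exact fun h => hw h.le
            have h0 : r w = 0 := by rw [hr]; simp only [this, ENNReal.ofReal_zero]
            rw [h0, zero_mul, zero_mul]
      _ = C ^ 2 := by rw [lintegral_mul_const _ hrm, hr1, one_mul]
  rw [hmoll, eLpNorm_congr_ae ((EventuallyEq.refl _ (mollify ρ u')).sub hae),
    eLpNorm_eq_lintegral_rpow_enorm_toReal (by norm_num) (by norm_num)]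
  have := ENNReal.rpow_le_rpow h4 (z := 1 / 2) (by norm_num)
  rw [← ENNReal.rpow_natCast C, ← ENNReal.rpow_mul] at this
  norm_num at this ⊢
  exact this

end PHNLS

end

noncomputable section

namespace PHNLS

open Filter Topology ENNReal

variable {d : ℕ}

/-! ### Density of smooth compactly supported functions -/

/-- The squared norm of the energy space. -/
def energySq (u : Space d → ℂ) (G : Option (Fin d) → Space d → ℂ) : ℝ :=
  normSq u + normSq (fun z => z.2 • u z) + ∑ k, normSq (G k)

theorem energySq_nonneg (u : Space d → ℂ) (G : Option (Fin d) → Space d → ℂ) :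
    0 ≤ energySq u G :=
  add_nonneg (add_nonneg (normSq_nonneg _) (normSq_nonneg _))
    (Finset.sum_nonneg fun _ _ => normSq_nonneg _)

theorem energySq_add_le {u u' : Space d → ℂ} {G G' : Option (Fin d) → Space d → ℂ}
    (h : EnergyFun u G) (h' : EnergyFun u' G') :
    energySq (u + u') (G + G') ≤ 2 * energySq u G + 2 * energySq u' G' := by
  have e : (fun z : Space d => z.2 • (u + u') z)
      = (fun z => z.2 • u z) + fun z => z.2 • u' z := by
    ext z
    simp only [Pi.add_apply, smul_add]
  have h1 := normSq_add_le h.memLp h'.memLp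
  have h2 := normSq_add_le h.weight_memLp h'.weight_memLp
  have h3 : ∑ k, normSq ((G + G') k) ≤ ∑ k, (2 * normSq (G k) + 2 * normSq (G' k)) :=
    Finset.sum_le_sum fun k _ => normSq_add_le (h.grad_memLp k) (h'.grad_memLp k)
  rw [Finset.sum_add_distrib, ← Finset.mul_sum, ← Finset.mul_sum] at h3
  unfold energySq
  rw [e]
  linarith

theorem tendsto_normSq_smul {f : Space d → ℂ} (hf : MemLp f 2) {a : ℕ → Space d → ℝ}
    (ha : ∀ n, Continuous (a n)) {C : ℝ} (hC : ∀ n z, |a n z| ≤ C)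
    (h0 : ∀ z, Tendsto (fun n => a n z) atTop (𝓝 0)) :
    Tendsto (fun n => normSq fun z => a n z • f z) atTop (𝓝 0) := by
  have h := tendsto_integral_of_dominated_convergence (μ := volume)
    (F := fun n z => ‖a n z • f z‖ ^ 2) (f := fun _ => (0 : ℝ)) (fun z => C ^ 2 * ‖f z‖ ^ 2)
    (fun n => (((ha n).aestronglyMeasurable.smul hf.1).norm.pow 2))
    ((integrable_normSq hf).const_mul _)
    (fun n => Eventually.of_forall fun z => by
      rw [norm_smul, mul_pow, Real.norm_of_nonneg (by positivity), Real.norm_eq_abs]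
      have := hC n z
      gcongr)
    (Eventually.of_forall fun z => by
      have : Tendsto (fun n => ‖a n z • f z‖ ^ 2) atTop (𝓝 (‖(0 : ℝ) • f z‖ ^ 2)) :=
        ((h0 z).smul_const _).norm.pow 2
      simpa using this)
  simpa [normSq] using h

/-- Translations are strongly continuous in `L²`. -/
theorem tendsto_eLpNorm_translate {u : Space d → ℂ} (hu : MemLp u 2) :
    Tendsto (fun w : Space d => eLpNorm (fun z => u (z - w) - u z) 2 volume) (𝓝 0) (𝓝 0) := by
  have hmp : ∀ w : Space d, MeasurePreserving (fun z : Space d => z - w) volume volume :=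
    fun w => measurePreserving_sub_right volume w
  -- Currying makes the translations a continuous family in the compact-open topology, which is the
  -- hypothesis for continuity of composition in L².
  let F : C(Space d, C(Space d, Space d)) :=
    ContinuousMap.curry ⟨fun q : Space d × Space d => q.2 - q.1, by fun_prop⟩
  have hF : ∀ w, MeasurePreserving (F w) volume volume := hmp
  have hc : Continuous fun w => Lp.compMeasurePreserving (F w) (hF w) hu.toLp :=
    Continuous.compMeasurePreservingLp continuous_const F.continuous hF (by norm_num)
  have h1 := (hc.tendsto 0)
  rw [tendsto_iff_edist_tendsto_0] at h1
  refine h1.congr fun w => ?_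
  rw [Lp.edist_def]
  refine eLpNorm_congr_ae ?_
  have e1 : ∀ w, Lp.compMeasurePreserving (F w) (hF w) hu.toLp =ᵐ[volume]
      fun z => u (z - w) := by
    intro w
    refine (Lp.coeFn_compMeasurePreserving _ _).trans ?_
    exact (hF w).quasiMeasurePreserving.ae_eq_comp hu.coeFn_toLp
  filter_upwards [e1 w, e1 0] with z h2 h3
  rw [sub_zero] at h3
  rw [Pi.sub_apply, h2, h3]

/-- A sequence of bump functions shrinking to the origin. -/
def bumpSeq (n : ℕ) : ContDiffBump (0 : Space d) where
  rIn := 1 / (2 * (n + 1))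
  rOut := 1 / (n + 1)
  rIn_pos := by positivity
  rIn_lt_rOut := by
    apply one_div_lt_one_div_of_lt <;> linarith [Nat.cast_nonneg (α := ℝ) n]

theorem bumpSeq_rOut (n : ℕ) : (bumpSeq n : ContDiffBump (0 : Space d)).rOut = 1 / ((n : ℝ) + 1) :=
  rfl

/-- The trivial bound 2‖u‖ for the difference of u and a translate, fed into
`eLpNorm_mollify_sub_le`, replaces Young's inequality. -/
theorem memLp_mollify_sub {u : Space d → ℂ} (hu : MemLp u 2) (ρ : ContDiffBump (0 : Space d)) :
    MemLp (mollify ρ u - u) 2 := by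
  refine ⟨(contDiff_mollify ρ hu).continuous.aestronglyMeasurable.sub hu.1, ?_⟩
  refine (eLpNorm_mollify_sub_le ρ hu (C := 2 * eLpNorm u 2 volume) fun w _ => ?_).trans_lt
    (ENNReal.mul_lt_top (by norm_num) hu.2)
  have hmp := measurePreserving_sub_right (volume : Measure (Space d)) w
  have e : eLpNorm (fun z => u (z - w)) 2 volume = eLpNorm u 2 volume :=
    eLpNorm_comp_measurePreserving hu.1 hmp
  refine (eLpNorm_sub_le (hu.comp_measurePreserving hmp).1 hu.1 (by norm_num)).trans ?_
  rw [two_mul]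
  exact add_le_add e.le le_rfl

theorem memLp_mollify {u : Space d → ℂ} (hu : MemLp u 2) (ρ : ContDiffBump (0 : Space d)) :
    MemLp (mollify ρ u) 2 := by
  simpa using (memLp_mollify_sub hu ρ).add hu

theorem tendsto_normSq_of_eLpNorm {f : ℕ → Space d → ℂ} (hf : ∀ n, MemLp (f n) 2)
    (h : Tendsto (fun n => eLpNorm (f n) 2 volume) atTop (𝓝 0)) :
    Tendsto (fun n => normSq (f n)) atTop (𝓝 0) := by
  have h1 := ((ENNReal.tendsto_toReal ENNReal.zero_ne_top).comp h).pow 2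
  simp only [ENNReal.toReal_zero, ne_eq, OfNat.ofNat_ne_zero, not_false_eq_true, zero_pow] at h1
  refine h1.congr fun n => ?_
  simp only [Function.comp_apply]
  rw [eLpNorm_sq_eq (hf n), ENNReal.toReal_ofReal (Real.sqrt_nonneg _),
    Real.sq_sqrt (normSq_nonneg _)]

theorem tendsto_normSq_mollify_sub {u : Space d → ℂ} (hu : MemLp u 2) :
    Tendsto (fun n => normSq (mollify (bumpSeq n) u - u)) atTop (𝓝 0) := by
  refine tendsto_normSq_of_eLpNorm (fun n => memLp_mollify_sub hu _) ?_
  rw [ENNReal.tendsto_nhds_zero]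
  intro ε hε
  have h := (ENNReal.tendsto_nhds_zero.1 (tendsto_eLpNorm_translate hu)) ε hε
  rw [Metric.eventually_nhds_iff] at h
  obtain ⟨δ, hδ, hδ'⟩ := h
  have h1 : ∀ᶠ n : ℕ in atTop, 1 / ((n : ℝ) + 1) < δ :=
    tendsto_one_div_add_atTop_nhds_zero_nat.eventually_lt_const hδ
  filter_upwards [h1] with n hn
  refine eLpNorm_mollify_sub_le _ hu fun w hw => hδ' ?_
  rw [dist_zero_right]
  rw [bumpSeq_rOut] at hw
  linarith

theorem energyFun_of_contDiff {g : Space d → ℂ} (hg : ContDiff ℝ (⊤ : ℕ∞) g)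
    (hc : HasCompactSupport g) : EnergyFun g fun k z => fderiv ℝ g z (dir k) := by
  have hd : ∀ v, Continuous fun z => fderiv ℝ g z v := fun v =>
    (hg.continuous_fderiv (by simp)).clm_apply continuous_const
  have hdc : ∀ v, HasCompactSupport fun z => fderiv ℝ g z v := fun v => hc.fderiv_apply (𝕜 := ℝ) v
  refine ⟨hg.continuous.memLp_of_hasCompactSupport hc,
    fun k => (hd _).memLp_of_hasCompactSupport (hdc _),
    (continuous_snd.smul hg.continuous).memLp_of_hasCompactSupport
      (hc.smul_left (f := fun z : Space d => z.2)), ?_⟩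
  intro k ψ hψ
  have i1 : Integrable fun z => fderiv ℝ ψ z (dir k) • g z :=
    ((hψ.fderiv_continuous _).smul hg.continuous).integrable_of_hasCompactSupport
      (hc.smul_left (f := fun z => fderiv ℝ ψ z (dir k)))
  have i2 : Integrable fun z => ψ z • fderiv ℝ g z (dir k) :=
    (hψ.1.continuous.smul (hd _)).integrable_of_hasCompactSupport ((hdc _).smul_left (f := ψ))
  have i3 : Integrable fun z => ψ z • g z :=
    (hψ.1.continuous.smul hg.continuous).integrable_of_hasCompactSupport (hc.smul_left (f := ψ))
  have := integral_smul_fderiv_eq_neg_fderiv_smul_of_integrable i1 i2 i3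
    (fun z _ => hψ.differentiable z) (fun z _ => hg.differentiable (by simp) z)
  rw [this, neg_neg]

/-- A fixed smooth cutoff, equal to one on the unit ball. -/
def cutoff : ContDiffBump (0 : Space d) := ⟨1, 2, one_pos, one_lt_two⟩

/-- The bound is taken at least 1 so that a single constant serves the cutoff and its derivatives in
`EnergyFun.mul_smooth`. -/
theorem exists_bound_fderiv_cutoff :
    ∃ C : ℝ, 1 ≤ C ∧ ∀ k (z : Space d), |fderiv ℝ (cutoff : Space d → ℝ) z (dir k)| ≤ C := by
  have h : ∀ k : Option (Fin d), ∃ C : ℝ, ∀ z : Space d,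
      ‖fderiv ℝ (cutoff : Space d → ℝ) z (dir k)‖ ≤ C := by
    intro k
    have hc : Continuous fun z => fderiv ℝ (cutoff : Space d → ℝ) z (dir k) :=
      ((cutoff.contDiff (n := 1)).continuous_fderiv (by simp)).clm_apply continuous_const
    exact hc.bounded_above_of_compact_support
      (cutoff.hasCompactSupport.fderiv_apply (𝕜 := ℝ) (dir k))
  choose C hC using h
  refine ⟨1 + ∑ k, |C k|, by
    linarith [Finset.sum_nonneg fun k (_ : k ∈ Finset.univ) => abs_nonneg (C k)], fun k z => ?_⟩
  have := Finset.single_le_sum (f := fun k => |C k|) (fun k _ => abs_nonneg (C k))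
    (Finset.mem_univ k)
  have h1 := hC k z
  rw [Real.norm_eq_abs] at h1
  have h2 := le_abs_self (C k)
  linarith

/-- The cutoff at scale `n + 1`. -/
def cutoffSeq (n : ℕ) : Space d → ℝ := fun z => cutoff (((n : ℝ) + 1)⁻¹ • z)

theorem contDiff_cutoffSeq (n : ℕ) : ContDiff ℝ (⊤ : ℕ∞) (cutoffSeq n : Space d → ℝ) :=
  cutoff.contDiff.comp (contDiff_const_smul _)

theorem fderiv_cutoffSeq (n : ℕ) (z v : Space d) :
    fderiv ℝ (cutoffSeq n) z v
      = ((n : ℝ) + 1)⁻¹ * fderiv ℝ (cutoff : Space d → ℝ) (((n : ℝ) + 1)⁻¹ • z) v := by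
  have h1 : HasFDerivAt (fun z : Space d => ((n : ℝ) + 1)⁻¹ • z)
      (((n : ℝ) + 1)⁻¹ • ContinuousLinearMap.id ℝ (Space d)) z :=
    (hasFDerivAt_id z).const_smul ((n : ℝ) + 1)⁻¹
  have h2 : HasFDerivAt (cutoff : Space d → ℝ) _ (((n : ℝ) + 1)⁻¹ • z) :=
    ((cutoff.contDiff (n := 1)).differentiable (by simp) _).hasFDerivAt
  have h3 : HasFDerivAt (cutoffSeq n) _ z := h2.comp z h1
  rw [h3.fderiv]
  simp

theorem abs_cutoffSeq_le (n : ℕ) (z : Space d) : |cutoffSeq n z| ≤ 1 := by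
  rw [cutoffSeq, abs_of_nonneg cutoff.nonneg]
  exact cutoff.le_one

theorem cutoffSeq_eq_zero {n : ℕ} {z : Space d} (h : 2 * ((n : ℝ) + 1) ≤ ‖z‖) :
    cutoffSeq n z = 0 := by
  refine cutoff.zero_of_le_dist ?_
  have : (0 : ℝ) < n + 1 := by positivity
  change (2 : ℝ) ≤ _
  rw [dist_zero_right, norm_smul, Real.norm_of_nonneg (by positivity), inv_mul_eq_div,
    le_div_iff₀ this]
  exact h

theorem tendsto_cutoffSeq (z : Space d) : Tendsto (fun n => cutoffSeq n z) atTop (𝓝 1) := by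
  refine tendsto_const_nhds.congr' ?_
  filter_upwards [eventually_ge_atTop ⌈‖z‖⌉₊] with n hn
  symm
  refine cutoff.one_of_mem_closedBall ?_
  have h0 : (0 : ℝ) < n + 1 := by positivity
  have h1 : ‖z‖ ≤ n := (Nat.le_ceil _).trans (by exact_mod_cast hn)
  rw [mem_closedBall_zero_iff, norm_smul, Real.norm_of_nonneg (by positivity), inv_mul_eq_div]
  change _ ≤ (1 : ℝ)
  rw [div_le_one h0]
  linarith

theorem EnergyFun.mul_cutoffSeq {u : Space d → ℂ} {G : Option (Fin d) → Space d → ℂ}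
    (h : EnergyFun u G) (n : ℕ) :
    EnergyFun (fun z => cutoffSeq n z • u z)
      (fun k z => cutoffSeq n z • G k z + fderiv ℝ (cutoffSeq n) z (dir k) • u z) := by
  obtain ⟨C, hC1, hC⟩ := exists_bound_fderiv_cutoff (d := d)
  refine h.mul_smooth (contDiff_cutoffSeq n) (C := C)
    (fun z => (abs_cutoffSeq_le n z).trans hC1) fun k z => ?_
  rw [fderiv_cutoffSeq, abs_mul, abs_of_pos (by positivity)]
  have h1 : ((n : ℝ) + 1)⁻¹ ≤ 1 := inv_le_one_of_one_le₀ (by linarith [Nat.cast_nonneg (α := ℝ) n])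
  have := hC k (((n : ℝ) + 1)⁻¹ • z)
  nlinarith [abs_nonneg (fderiv ℝ (cutoff : Space d → ℝ) (((n : ℝ) + 1)⁻¹ • z) (dir k))]

/-- The errors are 1 - χ_n times a fixed L² function, and u times the gradient of χ_n, which is
O(1/n). Both vanish by dominated convergence. -/
theorem EnergyFun.tendsto_cutoffSeq {u : Space d → ℂ} {G : Option (Fin d) → Space d → ℂ}
    (h : EnergyFun u G) :
    Tendsto (fun n => energySq (u - fun z => cutoffSeq n z • u z)
      (G - fun k z => cutoffSeq n z • G k z + fderiv ℝ (cutoffSeq n) z (dir k) • u z))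
      atTop (𝓝 0) := by
  obtain ⟨C, hC1, hC⟩ := exists_bound_fderiv_cutoff (d := d)
  have h1 : ∀ f : Space d → ℂ, MemLp f 2 volume →
      Tendsto (fun n => normSq fun z => (1 - cutoffSeq n z) • f z) atTop (𝓝 0) := by
    intro f hf
    refine tendsto_normSq_smul hf
      (fun n => continuous_const.sub (contDiff_cutoffSeq n).continuous) (C := 2)
      (fun n z => ?_) fun z => ?_
    · have := abs_le.1 (abs_cutoffSeq_le n z)
      rw [abs_le]
      constructor <;> linarith
    · simpa using (PHNLS.tendsto_cutoffSeq z).const_sub 1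
  have hn : Tendsto (fun n : ℕ => ((n : ℝ) + 1)⁻¹) atTop (𝓝 0) := by
    simpa using tendsto_one_div_add_atTop_nhds_zero_nat (𝕜 := ℝ)
  have h2 : ∀ k, Tendsto (fun n => normSq fun z => fderiv ℝ (cutoffSeq n) z (dir k) • u z)
      atTop (𝓝 0) := by
    intro k
    refine tendsto_normSq_smul h.memLp (fun n => ((contDiff_cutoffSeq n).continuous_fderiv
      (by simp)).clm_apply continuous_const) (C := C) (fun n z => ?_) fun z => ?_
    · rw [fderiv_cutoffSeq, abs_mul, abs_of_pos (by positivity)]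
      have h1 : ((n : ℝ) + 1)⁻¹ ≤ 1 :=
        inv_le_one_of_one_le₀ (by linarith [Nat.cast_nonneg (α := ℝ) n])
      have := hC k (((n : ℝ) + 1)⁻¹ • z)
      nlinarith [abs_nonneg (fderiv ℝ (cutoff : Space d → ℝ) (((n : ℝ) + 1)⁻¹ • z) (dir k))]
    · refine squeeze_zero_norm (a := fun n : ℕ => ((n : ℝ) + 1)⁻¹ * C) (fun n => ?_) ?_
      · rw [fderiv_cutoffSeq, Real.norm_eq_abs, abs_mul, abs_of_pos (by positivity)]
        exact mul_le_mul_of_nonneg_left (hC _ _) (by positivity)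
      · simpa using hn.mul_const C
  have hm : ∀ n (f : Space d → ℂ), MemLp f 2 volume →
      MemLp (fun z => (1 - cutoffSeq n z) • f z) 2 volume := by
    intro n f hf
    refine hf.of_le_mul (c := 2) ((continuous_const.sub
      (contDiff_cutoffSeq n).continuous).aestronglyMeasurable.smul hf.1)
      (Eventually.of_forall fun z => ?_)
    rw [norm_smul]
    refine mul_le_mul_of_nonneg_right ?_ (norm_nonneg _)
    have := abs_le.1 (abs_cutoffSeq_le n z)
    rw [Real.norm_eq_abs, abs_le]
    constructor <;> linarith
  have h3 : ∀ k, Tendsto (fun n => normSq (G k - fun z => cutoffSeq n z • G k z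
      + fderiv ℝ (cutoffSeq n) z (dir k) • u z)) atTop (𝓝 0) := by
    intro k
    have hlim := ((h1 _ (h.grad_memLp k)).const_mul 2).add ((h2 k).const_mul 2)
    simp only [mul_zero, add_zero] at hlim
    refine squeeze_zero (fun n => normSq_nonneg _) (fun n => ?_) hlim
    have hmem : MemLp (fun z => fderiv ℝ (cutoffSeq n) z (dir k) • u z) 2 volume := by
      have ha := ((h.mul_cutoffSeq n).grad_memLp k).sub (h.grad_memLp k)
      have hb := ha.add (hm n _ (h.grad_memLp k))
      refine hb.ae_eq (Eventually.of_forall fun z => ?_)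
      simp only [Pi.add_apply, Pi.sub_apply, sub_smul, one_smul]
      ring
    refine le_trans (le_of_eq ?_) (normSq_sub_le (hm n _ (h.grad_memLp k)) hmem)
    congr 1
    ext z
    simp only [Pi.sub_apply, sub_smul, one_smul]
    ring
  have hsum := ((h1 _ h.memLp).add (h1 _ h.weight_memLp)).add
    (tendsto_finsetSum Finset.univ fun k _ => h3 k)
  simp only [add_zero, Finset.sum_const_zero] at hsum
  refine hsum.congr fun n => ?_
  unfold energySq
  congr 2
  · congr 1
    ext z
    simp only [Pi.sub_apply, sub_smul, one_smul]
  · congr 1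
    ext z
    simp only [Pi.sub_apply, sub_smul, one_smul, smul_sub]
    rw [smul_comm]

/-- Bounded support is needed for the weight, which does not commute with convolution: the kernels
have radius at most 1, so everything happens where |y| ≤ |R| + 1 and plain L² convergence suffices.
-/
theorem EnergyFun.tendsto_mollify {u : Space d → ℂ} {G : Option (Fin d) → Space d → ℂ}
    (h : EnergyFun u G) {R : ℝ} (hR : ∀ z, R ≤ ‖z‖ → u z = 0) :
    Tendsto (fun n => energySq (mollify (bumpSeq n) u - u)
      (fun k => mollify (bumpSeq n) (G k) - G k)) atTop (𝓝 0) := by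
  have h1 := tendsto_normSq_mollify_sub h.memLp
  have h2 : Tendsto (fun n => normSq fun z => z.2 • (mollify (bumpSeq n) u - u) z)
      atTop (𝓝 0) := by
    have hlim := h1.const_mul ((|R| + 1) ^ 2)
    rw [mul_zero] at hlim
    refine squeeze_zero (fun n => normSq_nonneg _) (fun n => ?_) hlim
    rw [normSq, normSq, ← integral_const_mul]
    refine integral_mono_of_nonneg (Eventually.of_forall fun z => by positivity)
      ((integrable_normSq (memLp_mollify_sub h.memLp _)).const_mul _)
      (Eventually.of_forall fun z => ?_)
    by_cases hz : |R| + 1 ≤ ‖z‖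
    · have e1 : u z = 0 := hR z (by linarith [le_abs_self R])
      have e2 : mollify (bumpSeq n) u z = 0 := by
        rw [mollify_apply, ← integral_zero (Space d) ℂ]
        congr 1 with w
        by_cases hw : ‖w‖ < 1 / ((n : ℝ) + 1)
        · have hn : 1 / ((n : ℝ) + 1) ≤ 1 := by
            rw [div_le_one (by positivity)]
            linarith [Nat.cast_nonneg (α := ℝ) n]
          rw [hR (z - w), smul_zero]
          have := norm_sub_norm_le z w
          linarith [le_abs_self R]
        · have : (bumpSeq n : ContDiffBump (0 : Space d)).normed volume w = 0 := by
            rw [← Function.notMem_support, ContDiffBump.support_normed_eq, mem_ball_zero_iff]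
            exact hw
          rw [this, zero_smul]
      simp [e1, e2]
    · simp only [norm_smul, mul_pow]
      have : ‖z.2‖ ≤ |R| + 1 := (norm_snd_le z).trans (not_le.1 hz).le
      gcongr
  have hsum := (h1.add h2).add
    (tendsto_finsetSum Finset.univ fun k _ => tendsto_normSq_mollify_sub (h.grad_memLp k))
  simp only [add_zero, Finset.sum_const_zero] at hsum
  exact hsum

/-- Smooth compactly supported functions are dense in the energy space. -/
theorem EnergyFun.exists_smooth_approx {u : Space d → ℂ} {G : Option (Fin d) → Space d → ℂ}
    (h : EnergyFun u G) {ε : ℝ} (hε : 0 < ε) :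
    ∃ g : Space d → ℂ, ContDiff ℝ (⊤ : ℕ∞) g ∧ HasCompactSupport g ∧
      energySq (g - u) ((fun k z => fderiv ℝ g z (dir k)) - G) < ε := by
  -- Truncation and mollification may each cost ε/4, because `energySq_add_le` doubles both errors.
  obtain ⟨n, hn⟩ := (h.tendsto_cutoffSeq.eventually_lt_const (show 0 < ε / 4 by positivity)).exists
  set v : Space d → ℂ := fun z => cutoffSeq n z • u z with hv
  set V : Option (Fin d) → Space d → ℂ :=
    fun k z => cutoffSeq n z • G k z + fderiv ℝ (cutoffSeq n) z (dir k) • u z with hV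
  have hvV : EnergyFun v V := h.mul_cutoffSeq n
  have hR : ∀ z, 2 * ((n : ℝ) + 1) ≤ ‖z‖ → v z = 0 := fun z hz => by
    simp [hv, cutoffSeq_eq_zero hz]
  obtain ⟨m, hm⟩ := ((hvV.tendsto_mollify hR).eventually_lt_const
    (show 0 < ε / 4 by positivity)).exists
  have hsm := contDiff_mollify (bumpSeq m) hvV.memLp
  have hvc : HasCompactSupport v := by
    refine HasCompactSupport.of_support_subset_isCompact
      (isCompact_closedBall (0 : Space d) (2 * ((n : ℝ) + 1))) fun z hz => ?_
    rw [mem_closedBall_zero_iff]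
    by_contra hlt
    exact hz (hR z (not_le.1 hlt).le)
  have hcs : HasCompactSupport (mollify (bumpSeq m) v) :=
    ContDiffBump.hasCompactSupport_normed _ |>.convolution _ hvc
  refine ⟨mollify (bumpSeq m) v, hsm, hcs, ?_⟩
  have hE := energyFun_of_contDiff hsm hcs
  have e1 : mollify (bumpSeq m) v - u = (mollify (bumpSeq m) v - v) + -(u - v) := by
    ext z
    simp
  have e2 : (fun k z => fderiv ℝ (mollify (bumpSeq m) v) z (dir k)) - G
      = ((fun k z => fderiv ℝ (mollify (bumpSeq m) v) z (dir k)) - V) + -(G - V) := by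
    ext k z
    simp
  have e3 : ((fun k z => fderiv ℝ (mollify (bumpSeq m) v) z (dir k)) - V)
      = fun k => mollify (bumpSeq m) (V k) - V k := by
    ext k z
    simp [fderiv_mollify _ hvV.memLp (hvV.weak k)]
  have e4 : energySq (-(u - v)) (-(G - V)) = energySq (u - v) (G - V) := by
    simp only [energySq, normSq, Pi.neg_apply, smul_neg, norm_neg]
  rw [e1, e2]
  refine (energySq_add_le (hE.sub hvV) (h.sub hvV).neg).trans_lt ?_
  rw [e3, e4]
  linarith

end PHNLS

end

noncomputable section

namespace PHNLS

open Filter Topology ENNReal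

variable {d : ℕ}

/-! ### The Sobolev inequality -/

theorem finrank_space : Module.finrank ℝ (Space d) = d + 1 := by
  simp [Space, Module.finrank_prod]

theorem space_eq_sum (z : Space d) :
    z = (∑ i : Fin d, z.1 i • (dir (some i) : Space d)) + z.2 • dir none := by
  refine Prod.ext ?_ ?_
  · ext j
    simp [dir, dirX, dirY, Prod.fst_sum, Pi.single_apply]
  · simp [dir, dirX, dirY, Prod.snd_sum]

/-- Coordinates are bounded by the norm, also for the sup norm of the product. This trades the
operator norm in the Sobolev inequality for partial derivatives. -/
theorem norm_clm_le_sum (L : Space d →L[ℝ] ℂ) : ‖L‖ ≤ ∑ k, ‖L (dir k)‖ := by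
  refine L.opNorm_le_bound (Finset.sum_nonneg fun _ _ => norm_nonneg _) fun z => ?_
  conv_lhs => rw [space_eq_sum z]
  rw [map_add, map_sum, Fintype.sum_option, add_mul, add_comm]
  refine (norm_add_le _ _).trans (add_le_add ?_ ?_)
  · rw [map_smul, norm_smul, mul_comm]
    exact mul_le_mul_of_nonneg_left (norm_snd_le z) (norm_nonneg _)
  · rw [Finset.sum_mul]
    refine (norm_sum_le _ _).trans (Finset.sum_le_sum fun i _ => ?_)
    rw [map_smul, norm_smul, mul_comm]
    exact mul_le_mul_of_nonneg_left ((PiLp.norm_apply_le z.1 i).trans (norm_fst_le z))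
      (norm_nonneg _)

/-- The critical Sobolev exponent of `ℝ^{d+1}`. -/
def sobolevExp (d : ℕ) : ℝ := 2 * (d + 1) / (d - 1)

theorem two_lt_sobolevExp (hd : 2 ≤ d) : 2 < sobolevExp d := by
  have : (2 : ℝ) ≤ d := by exact_mod_cast hd
  rw [sobolevExp, lt_div_iff₀ (by linarith)]
  linarith

theorem lt_sobolevExp (hd : 2 ≤ d) {α : ℝ} (hα : α < 4 / ((d : ℝ) - 1)) :
    α + 2 < sobolevExp d := by
  have : (2 : ℝ) ≤ d := by exact_mod_cast hd
  rw [lt_div_iff₀ (by linarith)] at hα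
  rw [sobolevExp, lt_div_iff₀ (by linarith)]
  linarith

/-- Gagliardo–Nirenberg–Sobolev with p = 2 in dimension d + 1: the relation 1/q = 1/2 - 1/(d+1)
gives q = 2(d+1)/(d-1). -/
theorem exists_sobolev_smooth (hd : 2 ≤ d) :
    ∃ C : ℝ≥0∞, C ≠ ∞ ∧ ∀ g : Space d → ℂ, ContDiff ℝ (⊤ : ℕ∞) g → HasCompactSupport g →
      eLpNorm g (ENNReal.ofReal (sobolevExp d)) volume
        ≤ C * ∑ k, eLpNorm (fun z => fderiv ℝ g z (dir k)) 2 volume := by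
  have hd' : (2 : ℝ) ≤ d := by exact_mod_cast hd
  have hpos : 0 < sobolevExp d := by linarith [two_lt_sobolevExp hd]
  set q : NNReal := (sobolevExp d).toNNReal with hq
  have hqr : (q : ℝ) = sobolevExp d := Real.coe_toNNReal _ hpos.le
  refine ⟨SNormLESNormFDerivOfEqConst ℂ (volume : Measure (Space d)) ((2 : NNReal) : ℝ),
    ENNReal.coe_ne_top, fun g hg hc => ?_⟩
  have h := eLpNorm_le_eLpNorm_fderiv_of_eq (volume : Measure (Space d))
    (hg.of_le (by exact_mod_cast le_top) : ContDiff ℝ 1 g) hc (p := 2) (p' := q) one_le_two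
    (by rw [finrank_space]; omega) (by
      rw [finrank_space, hqr, sobolevExp]
      push_cast
      have h1 : (d : ℝ) - 1 ≠ 0 := by linarith
      have h2 : (d : ℝ) + 1 ≠ 0 := by linarith
      field_simp
      ring)
  refine h.trans ?_
  gcongr
  have hd : ∀ v, Continuous fun z => fderiv ℝ g z v := fun v =>
    (hg.continuous_fderiv (by simp)).clm_apply continuous_const
  have e : (fun z => ∑ k : Option (Fin d), ‖fderiv ℝ g z (dir k)‖)
      = ∑ k : Option (Fin d), fun z => ‖fderiv ℝ g z (dir k)‖ := by
    ext z
    simp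
  calc eLpNorm (fderiv ℝ g) ((2 : NNReal) : ℝ≥0∞) volume
      ≤ eLpNorm (fun z => ∑ k : Option (Fin d), ‖fderiv ℝ g z (dir k)‖) 2 volume :=
        eLpNorm_mono_real fun z => norm_clm_le_sum _
    _ ≤ ∑ k, eLpNorm (fun z => ‖fderiv ℝ g z (dir k)‖) 2 volume := by
        rw [e]
        exact eLpNorm_sum_le (fun k _ => (hd _).norm.aestronglyMeasurable) (by norm_num)
    _ = _ := by simp only [eLpNorm_norm]

theorem EnergyFun.exists_smooth_seq {u : Space d → ℂ} {G : Option (Fin d) → Space d → ℂ}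
    (h : EnergyFun u G) :
    ∃ g : ℕ → Space d → ℂ, (∀ n, ContDiff ℝ (⊤ : ℕ∞) (g n)) ∧ (∀ n, HasCompactSupport (g n)) ∧
      Tendsto (fun n => energySq (g n - u) ((fun k z => fderiv ℝ (g n) z (dir k)) - G))
        atTop (𝓝 0) := by
  choose g h1 h2 h3 using fun n : ℕ => h.exists_smooth_approx (ε := 1 / ((n : ℝ) + 1))
    (by positivity)
  exact ⟨g, h1, h2, squeeze_zero (fun n => energySq_nonneg _ _) (fun n => (h3 n).le)
    tendsto_one_div_add_atTop_nhds_zero_nat⟩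

theorem normSq_le_energySq (u : Space d → ℂ) (G : Option (Fin d) → Space d → ℂ) :
    normSq u ≤ energySq u G := by
  unfold energySq
  linarith [normSq_nonneg fun z : Space d => z.2 • u z,
    Finset.sum_nonneg fun k (_ : k ∈ Finset.univ) => normSq_nonneg (G k)]

theorem normSq_weight_le_energySq (u : Space d → ℂ) (G : Option (Fin d) → Space d → ℂ) :
    normSq (fun z => z.2 • u z) ≤ energySq u G := by
  unfold energySq
  linarith [normSq_nonneg u,
    Finset.sum_nonneg fun k (_ : k ∈ Finset.univ) => normSq_nonneg (G k)]

theorem normSq_grad_le_energySq (u : Space d → ℂ) (G : Option (Fin d) → Space d → ℂ)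
    (k : Option (Fin d)) : normSq (G k) ≤ energySq u G := by
  have := Finset.single_le_sum (f := fun k => normSq (G k)) (fun k _ => normSq_nonneg (G k))
    (Finset.mem_univ k)
  unfold energySq
  linarith [normSq_nonneg u, normSq_nonneg fun z : Space d => z.2 • u z]

theorem tendsto_eLpNorm_of_normSq {f : ℕ → Space d → ℂ} (hf : ∀ n, MemLp (f n) 2)
    (h : Tendsto (fun n => normSq (f n)) atTop (𝓝 0)) :
    Tendsto (fun n => eLpNorm (f n) 2 volume) atTop (𝓝 0) := by
  have h1 := ENNReal.tendsto_ofReal h.sqrt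
  simp only [Real.sqrt_zero, ENNReal.ofReal_zero] at h1
  exact h1.congr fun n => (eLpNorm_sq_eq (hf n)).symm

/-- Density: the approximating gradients converge in L², and Fatou's lemma along an almost
everywhere convergent subsequence treats the critical norm, for which no convergence is known yet.
-/
theorem exists_sobolev_eLpNorm (hd : 2 ≤ d) :
    ∃ C : ℝ≥0∞, C ≠ ∞ ∧ ∀ (u : Space d → ℂ) (G : Option (Fin d) → Space d → ℂ), EnergyFun u G →
      eLpNorm u (ENNReal.ofReal (sobolevExp d)) volume ≤ C * ∑ k, eLpNorm (G k) 2 volume := by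
  obtain ⟨C, hC, hS⟩ := exists_sobolev_smooth hd
  refine ⟨C, hC, fun u G h => ?_⟩
  obtain ⟨g, hg, hgc, hlim⟩ := h.exists_smooth_seq
  have hE : ∀ n, EnergyFun (g n) _ := fun n => energyFun_of_contDiff (hg n) (hgc n)
  have h1 : Tendsto (fun n => eLpNorm (g n - u) 2 volume) atTop (𝓝 0) :=
    tendsto_eLpNorm_of_normSq (fun n => (hE n).memLp.sub h.memLp)
      (squeeze_zero (fun n => normSq_nonneg _) (fun n => normSq_le_energySq _ _) hlim)
  have h2 : ∀ k, Tendsto (fun n => eLpNorm ((fun z => fderiv ℝ (g n) z (dir k)) - G k) 2 volume)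
      atTop (𝓝 0) := fun k =>
    tendsto_eLpNorm_of_normSq (fun n => ((hE n).grad_memLp k).sub (h.grad_memLp k))
      (squeeze_zero (fun n => normSq_nonneg _) (fun n => normSq_grad_le_energySq (g n - u)
        ((fun k z => fderiv ℝ (g n) z (dir k)) - G) k) hlim)
  obtain ⟨ns, hns, hae⟩ := (tendstoInMeasure_of_tendsto_eLpNorm (by norm_num)
    (fun n => (hE n).memLp.1) h.memLp.1 h1).exists_seq_tendsto_ae
  have hF := Lp.eLpNorm_lim_le_liminf_eLpNorm (p := ENNReal.ofReal (sobolevExp d))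
    (fun n => (hE (ns n)).memLp.1) u hae
  refine hF.trans ?_
  have h3 : Tendsto (fun n => C * ∑ k, (eLpNorm (G k) 2 volume
      + eLpNorm ((fun z => fderiv ℝ (g (ns n)) z (dir k)) - G k) 2 volume)) atTop
      (𝓝 (C * ∑ k, (eLpNorm (G k) 2 volume + 0))) := by
    refine ENNReal.Tendsto.const_mul (tendsto_finsetSum _ fun k _ => ?_) (Or.inr hC)
    exact tendsto_const_nhds.add ((h2 k).comp hns.tendsto_atTop)
  simp only [add_zero] at h3
  rw [← h3.liminf_eq]
  refine liminf_le_liminf (Eventually.of_forall fun n => ?_)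
  refine (hS _ (hg _) (hgc _)).trans ?_
  gcongr with k
  have e : (fun z => fderiv ℝ (g (ns n)) z (dir k))
      = G k + ((fun z => fderiv ℝ (g (ns n)) z (dir k)) - G k) := by simp
  conv_lhs => rw [e]
  exact eLpNorm_add_le (h.grad_memLp k).1 (((hE _).grad_memLp k).sub (h.grad_memLp k)).1
    (by norm_num)

/-- The squared `H¹` norm. -/
def h1Sq (u : Space d → ℂ) (G : Option (Fin d) → Space d → ℂ) : ℝ :=
  normSq u + ∑ k, normSq (G k)

theorem h1Sq_nonneg (u : Space d → ℂ) (G : Option (Fin d) → Space d → ℂ) : 0 ≤ h1Sq u G :=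
  add_nonneg (normSq_nonneg _) (Finset.sum_nonneg fun _ _ => normSq_nonneg _)

theorem normSq_le_h1Sq (u : Space d → ℂ) (G : Option (Fin d) → Space d → ℂ) :
    normSq u ≤ h1Sq u G :=
  le_add_of_nonneg_right (Finset.sum_nonneg fun _ _ => normSq_nonneg _)

/-- The Sobolev inequality for the critical exponent. -/
theorem exists_sobolev (hd : 2 ≤ d) :
    ∃ C : ℝ, 0 < C ∧ ∀ (u : Space d → ℂ) (G : Option (Fin d) → Space d → ℂ), EnergyFun u G →
      Integrable (fun z => ‖u z‖ ^ sobolevExp d) ∧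
      powInt (sobolevExp d) u ≤ C * h1Sq u G ^ (sobolevExp d / 2) := by
  obtain ⟨C, hC, hS⟩ := exists_sobolev_eLpNorm hd
  have hq : 2 < sobolevExp d := two_lt_sobolevExp hd
  have hq0 : 0 < sobolevExp d := by linarith
  set q := sobolevExp d with hqdef
  -- There are d + 1 partial derivatives; the summand 1 only makes the constant positive.
  refine ⟨(C.toReal * (d + 1)) ^ q + 1, by positivity, fun u G h => ?_⟩
  have h1 := hS u G h
  have h2 : C * ∑ k, eLpNorm (G k) 2 volume
      ≤ ENNReal.ofReal (C.toReal * (d + 1) * √(h1Sq u G)) := by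
    have : ∑ k, eLpNorm (G k) 2 volume ≤ ∑ _k : Option (Fin d), ENNReal.ofReal √(h1Sq u G) := by
      refine Finset.sum_le_sum fun k _ => ?_
      rw [eLpNorm_sq_eq (h.grad_memLp k)]
      refine ENNReal.ofReal_le_ofReal (Real.sqrt_le_sqrt ?_)
      have := Finset.single_le_sum (f := fun k => normSq (G k)) (fun k _ => normSq_nonneg (G k))
        (Finset.mem_univ k)
      unfold h1Sq
      linarith [normSq_nonneg u]
    rw [Finset.sum_const, Finset.card_univ, Fintype.card_option, Fintype.card_fin,
      nsmul_eq_mul] at this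
    rw [mul_assoc, ENNReal.ofReal_mul ENNReal.toReal_nonneg, ENNReal.ofReal_toReal hC,
      ENNReal.ofReal_mul (by positivity)]
    refine mul_le_mul_right (this.trans_eq ?_) _
    congr 1
    rw [show ((d : ℝ) + 1) = ((d + 1 : ℕ) : ℝ) by push_cast; ring, ENNReal.ofReal_natCast]
  have hmem : MemLp u (ENNReal.ofReal q) volume :=
    ⟨h.memLp.1, (h1.trans h2).trans_lt ENNReal.ofReal_lt_top⟩
  have hne0 : ENNReal.ofReal q ≠ 0 := by simpa using hq0
  have hInt : Integrable fun z => ‖u z‖ ^ q := by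
    have := hmem.integrable_norm_rpow hne0 ENNReal.ofReal_ne_top
    rwa [ENNReal.toReal_ofReal hq0.le] at this
  refine ⟨hInt, ?_⟩
  have h3 := h1.trans h2
  have hnn : 0 ≤ powInt q u := integral_nonneg fun z => by positivity
  rw [hmem.eLpNorm_eq_integral_rpow_norm hne0 ENNReal.ofReal_ne_top,
    ENNReal.toReal_ofReal hq0.le, ENNReal.ofReal_le_ofReal_iff (by positivity)] at h3
  have h4 := Real.rpow_le_rpow (by positivity) h3 hq0.le
  rw [← Real.rpow_mul (by positivity), inv_mul_cancel₀ hq0.ne', Real.rpow_one,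
    Real.mul_rpow (by positivity) (by positivity), Real.sqrt_eq_rpow,
    ← Real.rpow_mul (h1Sq_nonneg u G)] at h4
  have h5 : 0 ≤ h1Sq u G ^ (q / 2) := Real.rpow_nonneg (h1Sq_nonneg u G) _
  have e : 1 / 2 * q = q / 2 := by ring
  rw [e] at h4
  unfold powInt
  linarith

theorem exists_rpow_le {a p b : ℝ} (ha : 0 < a) (hap : a < p) (hpb : p < b) {ε : ℝ}
    (hε : 0 < ε) : ∃ C : ℝ, 0 < C ∧ ∀ s : ℝ, 0 ≤ s → s ^ p ≤ ε * s ^ b + C * s ^ a := by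
  -- Chosen so that T^(p-b) = ε: beyond T the power b wins with constant ε, below T the power a wins
  -- with constant T^(p-a).
  set T : ℝ := ε ^ (-(1 / (b - p))) with hT
  have hTpos : 0 < T := Real.rpow_pos_of_pos hε _
  refine ⟨T ^ (p - a), Real.rpow_pos_of_pos hTpos _, fun s hs => ?_⟩
  rcases hs.eq_or_lt with rfl | hs0
  · rw [Real.zero_rpow (by linarith), Real.zero_rpow (by linarith), Real.zero_rpow (by linarith)]
    simp
  rcases le_total s T with h | h
  · have h1 : s ^ p = s ^ (p - a) * s ^ a := by
      rw [← Real.rpow_add hs0]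
      ring_nf
    have h2 : s ^ (p - a) ≤ T ^ (p - a) := Real.rpow_le_rpow hs h (by linarith)
    have h3 : 0 ≤ ε * s ^ b := by positivity
    have h4 : 0 ≤ s ^ a := by positivity
    rw [h1]
    nlinarith
  · have h1 : s ^ p = s ^ (-(b - p)) * s ^ b := by
      rw [← Real.rpow_add hs0]
      ring_nf
    have h2 : s ^ (-(b - p)) ≤ T ^ (-(b - p)) :=
      Real.rpow_le_rpow_of_nonpos hTpos h (by linarith)
    have h3 : T ^ (-(b - p)) = ε := by
      rw [hT, ← Real.rpow_mul hε.le]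
      have : b - p ≠ 0 := by linarith
      rw [show -(1 / (b - p)) * -(b - p) = 1 by field_simp, Real.rpow_one]
    have h4 : 0 ≤ T ^ (p - a) * s ^ a := by positivity
    have h5 : 0 ≤ s ^ b := by positivity
    rw [h1]
    rw [h3] at h2
    nlinarith

theorem rpow_le_add {p b s : ℝ} (hs : 0 ≤ s) (hp : 2 < p) (hpb : p < b) :
    s ^ p ≤ s ^ 2 + s ^ b := by
  rcases hs.eq_or_lt with rfl | hs0
  · rw [Real.zero_rpow (by linarith), Real.zero_rpow (by linarith)]
    simp
  rcases le_total s 1 with h | h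
  · have := Real.rpow_le_rpow_of_exponent_ge hs0 h hp.le
    have h2 : 0 ≤ s ^ b := by positivity
    rw [Real.rpow_two] at this
    linarith
  · have := Real.rpow_le_rpow_of_exponent_le h hpb.le
    have h2 : 0 ≤ s ^ 2 := by positivity
    linarith

/-! ### Subcritical Sobolev inequalities with a small constant in front of the H¹ norm -/

section Subcritical

variable {α : ℝ}

theorem EnergyFun.integrable_rpow (hd : 2 ≤ d) (hα0 : 0 < α) (hα : α < 4 / ((d : ℝ) - 1))
    {u : Space d → ℂ} {G : Option (Fin d) → Space d → ℂ} (h : EnergyFun u G) :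
    Integrable fun z => ‖u z‖ ^ (α + 2) := by
  obtain ⟨C, -, hS⟩ := exists_sobolev hd
  refine Integrable.mono' ((integrable_normSq h.memLp).add (hS u G h).1)
    (h.memLp.1.norm.aemeasurable.pow_const _).aestronglyMeasurable
    (Eventually.of_forall fun z => ?_)
  rw [Real.norm_of_nonneg (by positivity)]
  exact rpow_le_add (norm_nonneg _) (by linarith) (lt_sobolevExp hd hα)

theorem powInt_nonneg (p : ℝ) (u : Space d → ℂ) : 0 ≤ powInt p u :=
  integral_nonneg fun z => by positivity

/-- Interpolation: the subcritical norm is controlled by a small multiple of the critical one. -/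
theorem exists_powInt_le (hd : 2 ≤ d) (hα0 : 0 < α) (hα : α < 4 / ((d : ℝ) - 1)) {ε : ℝ}
    (hε : 0 < ε) :
    ∃ C : ℝ, 0 < C ∧ ∀ (u : Space d → ℂ) (G : Option (Fin d) → Space d → ℂ), EnergyFun u G →
      powInt (α + 2) u ≤ ε * h1Sq u G ^ (sobolevExp d / 2) + C * normSq u := by
  obtain ⟨C, hC, hS⟩ := exists_sobolev hd
  obtain ⟨D, hD, hD'⟩ := exists_rpow_le (a := 2) (p := α + 2) (b := sobolevExp d) two_pos
    (by linarith) (lt_sobolevExp hd hα) (ε := ε / C) (by positivity)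
  refine ⟨D, hD, fun u G h => ?_⟩
  obtain ⟨hi, hb⟩ := hS u G h
  have h1 : powInt (α + 2) u ≤ ε / C * powInt (sobolevExp d) u + D * normSq u := by
    unfold powInt normSq
    rw [← integral_const_mul, ← integral_const_mul,
      ← integral_add (hi.const_mul _) ((integrable_normSq h.memLp).const_mul _)]
    refine integral_mono (h.integrable_rpow hd hα0 hα)
      ((hi.const_mul _).add ((integrable_normSq h.memLp).const_mul _)) fun z => ?_
    have := hD' ‖u z‖ (norm_nonneg _)
    rwa [Real.rpow_two] at this
  have h2 : ε / C * powInt (sobolevExp d) u ≤ ε * h1Sq u G ^ (sobolevExp d / 2) := by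
    have := mul_le_mul_of_nonneg_left hb (show 0 ≤ ε / C by positivity)
    rwa [← mul_assoc, div_mul_cancel₀ _ hC.ne'] at this
  linarith

theorem powInt_smul (p : ℝ) (c : ℝ) (u : Space d → ℂ) :
    powInt p ((c : ℂ) • u) = |c| ^ p * powInt p u := by
  unfold powInt
  rw [← integral_const_mul]
  congr 1 with z
  simp only [Pi.smul_apply, norm_smul, Complex.norm_real, Real.norm_eq_abs]
  exact Real.mul_rpow (abs_nonneg _) (norm_nonneg _)

theorem normSq_csmul (f : Space d → ℂ) (c : ℝ) : normSq ((c : ℂ) • f) = c ^ 2 * normSq f := by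
  rw [← normSq_smul]
  congr 1

theorem h1Sq_csmul (c : ℝ) (u : Space d → ℂ) (G : Option (Fin d) → Space d → ℂ) :
    h1Sq ((c : ℂ) • u) ((c : ℂ) • G) = c ^ 2 * h1Sq u G := by
  simp only [h1Sq, Pi.smul_apply, normSq_csmul, mul_add, Finset.mul_sum]

theorem EnergyFun.powInt_eq_zero {u : Space d → ℂ} {G : Option (Fin d) → Space d → ℂ}
    (h : EnergyFun u G) {p : ℝ} (hp : p ≠ 0) (h0 : normSq u = 0) : powInt p u = 0 := by
  have := eq_zero_ae_of_normSq_eq_zero h.memLp h0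
  rw [powInt_congr p this, powInt]
  simp [Real.zero_rpow hp]

/-- The subcritical Sobolev inequality, with an arbitrarily small constant in front of the
gradient. -/
theorem exists_powInt_le_rpow (hd : 2 ≤ d) (hα0 : 0 < α) (hα : α < 4 / ((d : ℝ) - 1)) {ε : ℝ}
    (hε : 0 < ε) :
    ∃ C : ℝ, 0 < C ∧ ∀ (u : Space d → ℂ) (G : Option (Fin d) → Space d → ℂ), EnergyFun u G →
      powInt (α + 2) u
        ≤ ε * h1Sq u G ^ ((α + 2) / 2) + C * normSq u ^ ((α + 2) / 2) := by
  obtain ⟨D, hD, hD'⟩ := exists_powInt_le hd hα0 hα (ε := ε / 2) (by positivity)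
  -- Threshold for the ratio of mass to H¹ norm: below it the mass term is at most ε/2 times the H¹
  -- term, above it the H¹ norm is itself bounded by the mass.
  set κ : ℝ := ε / (2 * D) with hκ
  have hκ0 : 0 < κ := by positivity
  set K : ℝ := (ε / 2 + D) * κ ^ (-((α + 2) / 2)) with hK
  refine ⟨K, by positivity, fun u G h => ?_⟩
  rcases (h1Sq_nonneg u G).eq_or_lt with h0 | hpos
  · have hm : normSq u = 0 := le_antisymm (by linarith [normSq_le_h1Sq u G]) (normSq_nonneg u)
    rw [h.powInt_eq_zero (by linarith) hm]
    have := normSq_nonneg u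
    have := h1Sq_nonneg u G
    positivity
  set s := h1Sq u G with hs
  set m := normSq u with hm
  have hm0 : 0 ≤ m := normSq_nonneg u
  have hms : m ≤ s := normSq_le_h1Sq u G
  -- The inhomogeneous inequality, applied to u normalised in H¹ and scaled back, becomes
  -- homogeneous of degree α + 2.
  have hh := hD' _ _ (h.const_smul (((√s)⁻¹ : ℝ) : ℂ))
  rw [powInt_smul, normSq_csmul, h1Sq_csmul, ← hs, ← hm, inv_pow, Real.sq_sqrt hpos.le,
    inv_mul_cancel₀ hpos.ne', Real.one_rpow, mul_one, abs_of_pos (by positivity),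
    Real.inv_rpow (by positivity), Real.sqrt_eq_rpow, ← Real.rpow_mul hpos.le] at hh
  have e : 1 / 2 * (α + 2) = (α + 2) / 2 := by ring
  rw [e] at hh
  have hsp : 0 < s ^ ((α + 2) / 2) := Real.rpow_pos_of_pos hpos _
  have key : powInt (α + 2) u ≤ (ε / 2 + D * (s⁻¹ * m)) * s ^ ((α + 2) / 2) := by
    rw [inv_mul_eq_div, div_le_iff₀ hsp] at hh
    exact hh
  have hmp : 0 ≤ m ^ ((α + 2) / 2) := Real.rpow_nonneg hm0 _
  rcases le_total m (κ * s) with hle | hle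
  · have h1 : s⁻¹ * m ≤ κ := by
      rw [inv_mul_eq_div, div_le_iff₀ hpos]
      exact hle
    have h2 : D * (s⁻¹ * m) ≤ ε / 2 := by
      calc D * (s⁻¹ * m) ≤ D * κ := by gcongr
        _ = ε / 2 := by rw [hκ]; field_simp
    have h3 : 0 ≤ K * m ^ ((α + 2) / 2) := by positivity
    nlinarith
  · have h1 : s⁻¹ * m ≤ 1 := by
      rw [inv_mul_eq_div, div_le_one hpos]
      exact hms
    have h2 : s ^ ((α + 2) / 2) ≤ κ ^ (-((α + 2) / 2)) * m ^ ((α + 2) / 2) := by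
      rw [Real.rpow_neg hκ0.le, inv_mul_eq_div, le_div_iff₀ (by positivity), mul_comm,
        ← Real.mul_rpow hκ0.le hpos.le]
      exact Real.rpow_le_rpow (by positivity) hle (by linarith)
    have h3 : (ε / 2 + D * (s⁻¹ * m)) ≤ ε / 2 + D := by nlinarith
    have h4 : (ε / 2 + D) * s ^ ((α + 2) / 2) ≤ K * m ^ ((α + 2) / 2) := by
      rw [hK, mul_assoc]
      gcongr
    have h5 : (ε / 2 + D * (s⁻¹ * m)) * s ^ ((α + 2) / 2) ≤ (ε / 2 + D) * s ^ ((α + 2) / 2) := by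
      gcongr
    have h6 : 0 ≤ ε * s ^ ((α + 2) / 2) := by positivity
    linarith

/-- The subcritical Sobolev inequality. -/
theorem exists_sobolev_subcritical (hd : 2 ≤ d) (hα0 : 0 < α) (hα : α < 4 / ((d : ℝ) - 1)) :
    ∃ C : ℝ, 0 < C ∧ ∀ (u : Space d → ℂ) (G : Option (Fin d) → Space d → ℂ), EnergyFun u G →
      powInt (α + 2) u ≤ C * h1Sq u G ^ ((α + 2) / 2) := by
  obtain ⟨C, hC, h⟩ := exists_powInt_le_rpow hd hα0 hα one_pos
  refine ⟨1 + C, by positivity, fun u G hu => (h u G hu).trans ?_⟩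
  have := Real.rpow_le_rpow (normSq_nonneg u) (normSq_le_h1Sq u G)
    (show 0 ≤ (α + 2) / 2 by linarith)
  nlinarith

/-- The squared subcritical norm is bounded by a small multiple of the squared `H¹` norm and a
large multiple of the squared `L²` norm. -/
theorem exists_powInt_rpow_le (hd : 2 ≤ d) (hα0 : 0 < α) (hα : α < 4 / ((d : ℝ) - 1)) {ε : ℝ}
    (hε : 0 < ε) :
    ∃ C : ℝ, 0 < C ∧ ∀ (u : Space d → ℂ) (G : Option (Fin d) → Space d → ℂ), EnergyFun u G →
      powInt (α + 2) u ^ (2 / (α + 2)) ≤ ε * h1Sq u G + C * normSq u := by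
  have hp : 0 < α + 2 := by linarith
  obtain ⟨C, hC, h⟩ := exists_powInt_le_rpow hd hα0 hα (ε := ε ^ ((α + 2) / 2)) (by positivity)
  refine ⟨C ^ (2 / (α + 2)), by positivity, fun u G hu => ?_⟩
  have h1 := Real.rpow_le_rpow (powInt_nonneg _ _) (h u G hu) (show 0 ≤ 2 / (α + 2) by positivity)
  have hs := h1Sq_nonneg u G
  have hm := normSq_nonneg u
  refine h1.trans ((Real.rpow_add_le_add_rpow (by positivity) (by positivity) (by positivity)
    ((div_le_one hp).2 (by linarith))).trans (le_of_eq ?_))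
  have e : (α + 2) / 2 * (2 / (α + 2)) = 1 := by field_simp
  rw [Real.mul_rpow (by positivity) (by positivity), Real.mul_rpow (by positivity) (by positivity),
    ← Real.rpow_mul hε.le, ← Real.rpow_mul hs, ← Real.rpow_mul hm, e]
  simp only [Real.rpow_one]

end Subcritical

end PHNLS

end

noncomputable section

namespace PHNLS

open Filter Topology ENNReal

variable {d : ℕ}

/-! ### Duality with test functions -/

/-- A real function regarded as a complex one. -/
def toC (ψ : Space d → ℝ) : Space d → ℂ := fun z => (ψ z : ℂ)

theorem memLp_toC {ψ : Space d → ℝ} (hψ : Continuous ψ) (hc : HasCompactSupport ψ) :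
    MemLp (toC ψ) 2 :=
  (Complex.continuous_ofReal.comp hψ).memLp_of_hasCompactSupport
    (hc.comp_left Complex.ofReal_zero)

theorem inner_ofReal_left (r : ℝ) (w : ℂ) : inner ℝ (r : ℂ) w = (r • w).re := by
  simp [Complex.inner, mul_comm]

theorem inner_ofReal_mul_I_left (r : ℝ) (w : ℂ) :
    inner ℝ (Complex.I * (r : ℂ)) w = (r • w).im := by
  simp [Complex.inner, mul_comm]

theorem re_integral_smul {ψ : Space d → ℝ} (hψ : Continuous ψ) (hc : HasCompactSupport ψ)
    {u : Space d → ℂ} (hu : MemLp u 2) : (∫ z, ψ z • u z).re = innerRe (toC ψ) u := by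
  have := integral_re (𝕜 := ℂ) (integrable_smul_of_test hψ hc hu)
  simp only [RCLike.re_eq_complex_re] at this
  rw [← this]
  simp only [innerRe, toC, inner_ofReal_left]

theorem im_integral_smul {ψ : Space d → ℝ} (hψ : Continuous ψ) (hc : HasCompactSupport ψ)
    {u : Space d → ℂ} (hu : MemLp u 2) :
    (∫ z, ψ z • u z).im = innerRe (Complex.I • toC ψ) u := by
  have := integral_im (𝕜 := ℂ) (integrable_smul_of_test hψ hc hu)
  simp only [RCLike.im_eq_complex_im] at this
  rw [← this]
  simp only [innerRe, toC, Pi.smul_apply, smul_eq_mul, inner_ofReal_mul_I_left]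

theorem normSq_I_smul (f : Space d → ℂ) : normSq (Complex.I • f) = normSq f := by
  simp [normSq]

/-- Real and imaginary parts are estimated separately, which costs a harmless factor 2. -/
theorem norm_integral_smul_le {ψ : Space d → ℝ} (hψ : Continuous ψ) (hc : HasCompactSupport ψ)
    {u : Space d → ℂ} (hu : MemLp u 2) :
    ‖∫ z, ψ z • u z‖ ≤ 2 * √(normSq (toC ψ)) * √(normSq u) := by
  refine (Complex.norm_le_abs_re_add_abs_im _).trans ?_
  have hm := memLp_toC hψ hc
  rw [re_integral_smul hψ hc hu, im_integral_smul hψ hc hu]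
  have h1 := abs_innerRe_le hm hu
  have h2 := abs_innerRe_le (hm.const_smul Complex.I) hu
  rw [normSq_I_smul] at h2
  linarith

/-- Duality with real test functions only. A smooth complex g pairs with v through its real and
imaginary parts, whence the factor 2; letting g tend to v in L² gives ‖v‖² ≤ 2K‖v‖. -/
theorem normSq_le_of_test {v : Space d → ℂ} (hv : MemLp v 2) {K : ℝ} (hK : 0 ≤ K)
    (h : ∀ ψ, IsTest ψ → ‖∫ z, ψ z • v z‖ ≤ K * √(normSq (toC ψ))) :
    normSq v ≤ (2 * K) ^ 2 := by
  have key : ∀ g : Space d → ℂ, ContDiff ℝ (⊤ : ℕ∞) g → HasCompactSupport g →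
      innerRe g v ≤ 2 * K * √(normSq g) := by
    intro g hg hc
    have hre : IsTest fun z => (g z).re :=
      ⟨Complex.reCLM.contDiff.comp hg, hc.comp_left Complex.zero_re⟩
    have him : IsTest fun z => (g z).im :=
      ⟨Complex.imCLM.contDiff.comp hg, hc.comp_left Complex.zero_im⟩
    have mre := memLp_toC hre.1.continuous hre.2
    have mim := memLp_toC him.1.continuous him.2
    have e : g = (toC fun z => (g z).re) + Complex.I • toC fun z => (g z).im := by
      ext z
      simp only [Pi.add_apply, Pi.smul_apply, toC, smul_eq_mul]
      rw [mul_comm]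
      exact (Complex.re_add_im _).symm
    have hgm : MemLp g 2 := hg.continuous.memLp_of_hasCompactSupport hc
    have b1 : √(normSq (toC fun z => (g z).re)) ≤ √(normSq g) := by
      refine Real.sqrt_le_sqrt (integral_mono (integrable_normSq mre) (integrable_normSq hgm)
        fun z => ?_)
      simp only [toC, Complex.norm_real]
      gcongr
      exact Complex.abs_re_le_norm _
    have b2 : √(normSq (toC fun z => (g z).im)) ≤ √(normSq g) := by
      refine Real.sqrt_le_sqrt (integral_mono (integrable_normSq mim) (integrable_normSq hgm)
        fun z => ?_)
      simp only [toC, Complex.norm_real]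
      gcongr
      exact Complex.abs_im_le_norm _
    have h1 := (Complex.re_le_norm _).trans (h _ hre)
    have h2 := (Complex.im_le_norm _).trans (h _ him)
    rw [re_integral_smul hre.1.continuous hre.2 hv] at h1
    rw [im_integral_smul him.1.continuous him.2 hv] at h2
    rw [e, innerRe_add_left mre (mim.const_smul _) hv, ← e]
    nlinarith
  have h2 : ∀ ε : ℝ, 0 < ε → normSq v ≤ 2 * K * √(normSq v) + ε := by
    have hcont : Tendsto (fun δ : ℝ => 2 * K * (√(normSq v) + δ) + δ * √(normSq v)) (𝓝[>] 0)
        (𝓝 (2 * K * (√(normSq v) + 0) + 0 * √(normSq v))) := by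
      refine Tendsto.mono_left ?_ nhdsWithin_le_nhds
      exact Continuous.tendsto (f := fun δ : ℝ => 2 * K * (√(normSq v) + δ) + δ * √(normSq v))
        (by fun_prop) 0
    rw [add_zero, zero_mul, add_zero] at hcont
    intro ε hε
    obtain ⟨δ, hδ1, hδ⟩ := ((hcont.eventually_lt_const
      (show 2 * K * √(normSq v) < 2 * K * √(normSq v) + ε by linarith)).and
      self_mem_nhdsWithin).exists
    obtain ⟨g, hgc, hg, hgd⟩ := hv.exist_eLpNorm_sub_le (by norm_num) (by norm_num)
      (show 0 < δ from hδ)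
    have hgm : MemLp g 2 := hg.continuous.memLp_of_hasCompactSupport hgc
    rw [eLpNorm_sq_eq (hv.sub hgm), ENNReal.ofReal_le_ofReal_iff (le_of_lt hδ)] at hgd
    have h3 := key g hg hgc
    have h4 := (abs_le.1 (abs_innerRe_le (hv.sub hgm) hv)).2
    rw [innerRe_sub_left hv hgm hv, innerRe_self] at h4
    have h5 : √(normSq g) ≤ √(normSq v) + δ := by
      have h6 := eLpNorm_sub_le hv.1 (hv.sub hgm).1 (p := 2) (by norm_num)
      rw [show v - (v - g) = g by ext z; simp, eLpNorm_sq_eq hgm, eLpNorm_sq_eq hv, eLpNorm_sq_eq (hv.sub hgm),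
        ← ENNReal.ofReal_add (Real.sqrt_nonneg _) (Real.sqrt_nonneg _),
        ENNReal.ofReal_le_ofReal_iff (by positivity)] at h6
      linarith
    have h7 : √(normSq (v - g)) * √(normSq v) ≤ δ * √(normSq v) := by gcongr
    have h8 : 2 * K * √(normSq g) ≤ 2 * K * (√(normSq v) + δ) := by gcongr
    linarith
  have h3 : normSq v ≤ 2 * K * √(normSq v) := le_of_forall_pos_le_add h2
  have h4 := Real.sq_sqrt (normSq_nonneg v)
  have h5 := Real.sqrt_nonneg (normSq v)
  have h6 : √(normSq v) ≤ 2 * K := by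
    by_contra hlt
    push Not at hlt
    nlinarith
  nlinarith

/-- Differentiation under the integral for a smooth family with uniformly compact support. -/
theorem norm_integral_sub_le_of_deriv {u : Space d → ℂ} (hu : MemLp u 2)
    {Ψ Ψ' : ℝ → Space d → ℝ} (hΨ : ∀ s z, HasDerivAt (fun s => Ψ s z) (Ψ' s z) s)
    (hΨc : ∀ s, Continuous (Ψ s)) (hΨ' : Continuous (Function.uncurry Ψ'))
    {K : Set (Space d)} (hK : IsCompact K)
    (hs : ∀ s ∈ Set.Icc (-2 : ℝ) 2, ∀ z ∉ K, Ψ s z = 0 ∧ Ψ' s z = 0) {B : ℝ}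
    (hB : ∀ s ∈ Set.Icc (-1 : ℝ) 1, ‖∫ z, Ψ' s z • u z‖ ≤ B) {t : ℝ}
    (ht : t ∈ Set.Icc (-1 : ℝ) 1) :
    ‖(∫ z, Ψ t z • u z) - ∫ z, Ψ 0 z • u z‖ ≤ B * |t| := by
  obtain ⟨M, hM⟩ := (isCompact_Icc.prod hK).exists_bound_of_continuousOn hΨ'.continuousOn
    (s := Set.Icc (-2 : ℝ) 2 ×ˢ K)
  have hloc : LocallyIntegrable u volume := hu.locallyIntegrable (by norm_num)
  have hΨ's : ∀ s, Continuous (Ψ' s) := fun s => hΨ'.comp (continuous_const.prodMk continuous_id)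
  have hbd : ∀ s ∈ Set.Icc (-2 : ℝ) 2, ∀ z, ‖Ψ' s z • u z‖ ≤ K.indicator (fun z => M * ‖u z‖) z := by
    intro s hs' z
    by_cases hz : z ∈ K
    · rw [Set.indicator_of_mem hz, norm_smul]
      exact mul_le_mul_of_nonneg_right (hM (s, z) ⟨hs', hz⟩) (norm_nonneg _)
    · rw [Set.indicator_of_notMem hz, (hs s hs' z hz).2]
      simp
  have hInt : Integrable (K.indicator fun z => M * ‖u z‖) := by
    rw [integrable_indicator_iff hK.measurableSet]
    exact ((hloc.integrableOn_isCompact hK).norm.const_mul M)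
  have hcs : ∀ s ∈ Set.Icc (-2 : ℝ) 2, HasCompactSupport (Ψ s) := fun s hs' =>
    HasCompactSupport.intro hK fun z hz => (hs s hs' z hz).1
  have hder : ∀ s ∈ Set.Icc (-1 : ℝ) 1,
      HasDerivAt (fun s => ∫ z, Ψ s z • u z) (∫ z, Ψ' s z • u z) s := by
    intro s hs1
    have hs2 : s ∈ Set.Icc (-2 : ℝ) 2 := ⟨by linarith [hs1.1], by linarith [hs1.2]⟩
    -- The domination holds on (-2, 2), a neighbourhood of each point of [-1, 1], so two-sided
    -- derivatives exist also at the endpoints.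
    refine (hasDerivAt_integral_of_dominated_loc_of_deriv_le (s := Set.Ioo (-2) 2)
      (F := fun s z => Ψ s z • u z) (F' := fun s z => Ψ' s z • u z)
      (bound := K.indicator fun z => M * ‖u z‖)
      (Ioo_mem_nhds (by linarith [hs1.1]) (by linarith [hs1.2]))
      (Eventually.of_forall fun s => (hΨc s).aestronglyMeasurable.smul hu.1)
      (integrable_smul_of_test (hΨc s) (hcs s hs2) hu)
      ((hΨ's s).aestronglyMeasurable.smul hu.1)
      (Eventually.of_forall fun z s hs' => hbd s ⟨hs'.1.le, hs'.2.le⟩ z) hInt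
      (Eventually.of_forall fun z s _ => (hΨ s z).smul_const _)).2
  have := Convex.norm_image_sub_le_of_norm_hasDerivWithin_le (𝕜 := ℝ)
    (f := fun s => ∫ z, Ψ s z • u z) (s := Set.Icc (-1 : ℝ) 1)
    (fun s hs => (hder s hs).hasDerivWithinAt) hB (convex_Icc _ _)
    (show (0 : ℝ) ∈ Set.Icc (-1 : ℝ) 1 by constructor <;> norm_num) ht
  simpa using this

theorem normSq_toC_comp_add (ψ : Space d → ℝ) (w : Space d) :
    normSq (toC fun z => ψ (z + w)) = normSq (toC ψ) :=
  integral_add_right_eq_self (μ := volume) (fun z => ‖((ψ z : ℝ) : ℂ)‖ ^ 2) w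

/-- The coordinates of a vector of `ℝ^d × ℝ` with respect to `dir`. -/
def coord (z : Space d) : Option (Fin d) → ℝ
  | some i => z.1 i
  | none => z.2

theorem abs_coord_le (z : Space d) (k : Option (Fin d)) : |coord z k| ≤ ‖z‖ := by
  rcases k with _ | i
  · exact norm_snd_le z
  · exact (PiLp.norm_apply_le z.1 i).trans (norm_fst_le z)

theorem sum_coord_smul_dir (z : Space d) : ∑ k, coord z k • dir k = z := by
  conv_rhs => rw [space_eq_sum z]
  rw [Fintype.sum_option, add_comm]
  rfl

theorem EnergyFun.norm_integral_fderiv_le {u : Space d → ℂ} {G : Option (Fin d) → Space d → ℂ}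
    (h : EnergyFun u G) {ψ : Space d → ℝ} (hψ : IsTest ψ) (w : Space d) :
    ‖∫ z, fderiv ℝ ψ z w • u z‖
      ≤ 2 * ‖w‖ * (∑ k, √(normSq (G k))) * √(normSq (toC ψ)) := by
  have e : ∫ z, fderiv ℝ ψ z w • u z = ∑ k, coord w k • -∫ z, ψ z • G k z := by
    have h1 : ∀ z, fderiv ℝ ψ z w • u z
        = ∑ k, coord w k • fderiv ℝ ψ z (dir k) • u z := by
      intro z
      conv_lhs => rw [← sum_coord_smul_dir w]
      rw [map_sum, Finset.sum_smul]
      refine Finset.sum_congr rfl fun k _ => ?_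
      rw [map_smul, smul_assoc]
    simp only [h1]
    have h2 : ∀ k, Integrable fun z => coord w k • fderiv ℝ ψ z (dir k) • u z := fun k =>
      (integrable_smul_of_test (hψ.fderiv_continuous _)
        (hψ.fderiv_hasCompactSupport _) h.memLp).smul (coord w k)
    rw [integral_finsetSum _ fun k _ => h2 k]
    refine Finset.sum_congr rfl fun k _ => ?_
    rw [integral_smul, h.weak k ψ hψ]
  rw [e, Finset.mul_sum, Finset.sum_mul]
  refine (norm_sum_le _ _).trans (Finset.sum_le_sum fun k _ => ?_)
  rw [norm_smul, norm_neg]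
  have h1 := norm_integral_smul_le hψ.1.continuous hψ.2 (h.grad_memLp k)
  calc ‖coord w k‖ * ‖∫ z, ψ z • G k z‖ ≤ ‖w‖ * (2 * √(normSq (toC ψ)) * √(normSq (G k))) :=
        mul_le_mul (abs_coord_le w k) h1 (norm_nonneg _) (norm_nonneg _)
    _ = _ := by ring

/-- Translations move a function of `H¹` by at most a multiple of the length of the
translation. -/
theorem EnergyFun.normSq_translate_le {u : Space d → ℂ} {G : Option (Fin d) → Space d → ℂ}
    (h : EnergyFun u G) (w : Space d) :
    normSq (fun z => u (z - w) - u z) ≤ (4 * ‖w‖ * ∑ k, √(normSq (G k))) ^ 2 := by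
  have hmem : MemLp (fun z => u (z - w)) 2 volume := by
    simpa [sub_eq_add_neg] using memLp_comp_add h.memLp (-w)
  have hS : 0 ≤ ∑ k, √(normSq (G k)) := Finset.sum_nonneg fun _ _ => Real.sqrt_nonneg _
  have key := normSq_le_of_test (hmem.sub h.memLp) (K := 2 * ‖w‖ * ∑ k, √(normSq (G k)))
    (by positivity) fun ψ hψ => ?_
  · refine le_trans (le_of_eq ?_) (key.trans_eq ?_)
    · rfl
    · ring
  -- The translation is moved to the test function, so only ψ has to be differentiated along the
  -- path s ↦ ψ(· + s w).
  have e1 : ∫ z, ψ z • (((fun z => u (z - w)) - u) z) = (∫ z, ψ (z + w) • u z) - ∫ z, ψ z • u z := by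
    simp only [Pi.sub_apply, smul_sub]
    rw [integral_sub (integrable_smul_of_test hψ.1.continuous hψ.2 hmem)
      (integrable_smul_of_test hψ.1.continuous hψ.2 h.memLp)]
    congr 1
    rw [← integral_add_right_eq_self _ w]
    simp
  have hψs : ∀ s : ℝ, IsTest fun z => ψ (z + s • w) := fun s =>
    ⟨hψ.1.comp (contDiff_id.add contDiff_const), hψ.2.comp_homeomorph (Homeomorph.addRight (s • w))⟩
  have hd : ∀ (s : ℝ) z, fderiv ℝ (fun z => ψ (z + s • w)) z = fderiv ℝ ψ (z + s • w) := fun s z =>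
    fderiv_comp_add_right (s • w)
  set K : Set (Space d) :=
    (fun q : ℝ × Space d => q.2 - q.1 • w) '' (Set.Icc (-2 : ℝ) 2 ×ˢ tsupport ψ) with hKdef
  have hK : IsCompact K := (isCompact_Icc.prod hψ.2).image (by fun_prop)
  have hcontd : Continuous (Function.uncurry fun (s : ℝ) (z : Space d) =>
      fderiv ℝ ψ (z + s • w) w) := by
    have := hψ.fderiv_continuous w
    exact this.comp (f := fun q : ℝ × Space d => q.2 + q.1 • w) (by fun_prop)
  have := norm_integral_sub_le_of_deriv h.memLp (Ψ := fun s z => ψ (z + s • w))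
    (Ψ' := fun s z => fderiv ℝ ψ (z + s • w) w) (fun s z => ?_)
    (fun s => (hψs s).1.continuous) hcontd hK (fun s hs z hz => ?_)
    (B := 2 * ‖w‖ * (∑ k, √(normSq (G k))) * √(normSq (toC ψ))) (fun s _ => ?_)
    (t := 1) (by constructor <;> norm_num)
  · simp only [one_smul, zero_smul, add_zero, abs_one, mul_one] at this
    rw [e1]
    exact this
  · have h1 : HasDerivAt (fun s : ℝ => z + s • w) w s := by
      simpa using ((hasDerivAt_id s).smul_const w).const_add z
    exact (hψ.differentiable _).hasFDerivAt.comp_hasDerivAt s h1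
  · have hz' : z + s • w ∉ tsupport ψ := fun hmem => hz ⟨(s, z + s • w), ⟨hs, hmem⟩, by simp⟩
    refine ⟨image_eq_zero_of_notMem_tsupport hz', ?_⟩
    have := image_eq_zero_of_notMem_tsupport (fun hc => hz' (tsupport_fderiv_subset ℝ hc))
    rw [this]
    rfl
  · have := h.norm_integral_fderiv_le (hψs s) w
    simp only [hd] at this
    rwa [normSq_toC_comp_add] at this

end PHNLS

end

noncomputable section

namespace PHNLS

open Filter Topology ENNReal

variable {d : ℕ}

/-! ### Weak and local compactness -/

/-- Weak convergence in `L²`. -/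
def WeakTendsto (f : ℕ → Space d → ℂ) (g : Space d → ℂ) : Prop :=
  ∀ h : Space d → ℂ, MemLp h 2 → Tendsto (fun n => innerRe h (f n)) atTop (𝓝 (innerRe h g))

/-- Sequential Banach–Alaoglu in the dual, transported by the Riesz isometry. -/
theorem exists_subseq_weak {E : Type*} [NormedAddCommGroup E] [InnerProductSpace ℝ E]
    [CompleteSpace E] [SecondCountableTopology E] {x : ℕ → E} {B : ℝ} (hB : ∀ n, ‖x n‖ ≤ B) :
    ∃ (a : E) (ns : ℕ → ℕ), StrictMono ns ∧
      ∀ y, Tendsto (fun n => inner ℝ (x (ns n)) y) atTop (𝓝 (inner ℝ a y)) := by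
  have hc := WeakDual.isSeqCompact_closedBall ℝ E 0 B
  have hx : ∀ n, StrongDual.toWeakDual (InnerProductSpace.toDual ℝ E (x n)) ∈
      WeakDual.toStrongDual ⁻¹' Metric.closedBall (0 : StrongDual ℝ E) B := by
    intro n
    rw [Set.mem_preimage, mem_closedBall_zero_iff]
    change ‖InnerProductSpace.toDual ℝ E (x n)‖ ≤ B
    rw [LinearIsometryEquiv.norm_map]
    exact hB n
  obtain ⟨l, -, ns, hns, hlim⟩ := hc hx
  refine ⟨(InnerProductSpace.toDual ℝ E).symm (WeakDual.toStrongDual l), ns, hns, fun y => ?_⟩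
  have h1 := ((WeakDual.eval_continuous (𝕜 := ℝ) y).tendsto l).comp hlim
  rw [InnerProductSpace.toDual_symm_apply]
  exact h1

theorem inner_toLp {f g : Space d → ℂ} (hf : MemLp f 2) (hg : MemLp g 2) :
    inner ℝ hf.toLp hg.toLp = innerRe f g := by
  rw [L2.inner_def]
  refine integral_congr_ae ?_
  filter_upwards [hf.coeFn_toLp, hg.coeFn_toLp] with z h1 h2
  rw [h1, h2]

theorem normSq_coe_toLp {f : Space d → ℂ} (hf : MemLp f 2) : ‖hf.toLp‖ ^ 2 = normSq f := by
  rw [← real_inner_self_eq_norm_sq, inner_toLp, innerRe_self]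

/-- The finite family is treated as one vector of the Hilbert sum, so that a single subsequence
serves all components. -/
theorem exists_subseq_weakTendsto {ι : Type*} [Fintype ι] {f : ℕ → ι → Space d → ℂ}
    (hf : ∀ n i, MemLp (f n i) 2) {B : ℝ} (hB : ∀ n i, normSq (f n i) ≤ B) :
    ∃ (g : ι → Space d → ℂ) (ns : ℕ → ℕ), StrictMono ns ∧ (∀ i, MemLp (g i) 2) ∧
      ∀ i, WeakTendsto (fun n => f (ns n) i) (g i) := by
  classical
  let x : ℕ → PiLp 2 (fun _ : ι => L2 d) := fun n => WithLp.toLp 2 fun i => (hf n i).toLp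
  have hx : ∀ n, ‖x n‖ ≤ √(∑ _i : ι, B) := by
    intro n
    rw [PiLp.norm_eq_of_L2]
    refine Real.sqrt_le_sqrt (Finset.sum_le_sum fun i _ => ?_)
    change ‖(hf n i).toLp‖ ^ 2 ≤ B
    rw [normSq_coe_toLp]
    exact hB n i
  obtain ⟨a, ns, hns, hlim⟩ := exists_subseq_weak hx
  refine ⟨fun i => a i, ns, hns, fun i => Lp.memLp (a i), fun i h hh => ?_⟩
  have h1 := hlim (WithLp.toLp 2 (Pi.single i hh.toLp))
  simp only [PiLp.inner_apply] at h1
  have e : ∀ b : PiLp 2 (fun _ : ι => L2 d),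
      ∑ j, inner ℝ (b.ofLp j) ((Pi.single i hh.toLp : ι → L2 d) j) = inner ℝ (b.ofLp i) hh.toLp := by
    intro b
    rw [Finset.sum_eq_single i]
    · simp
    · intro j _ hj
      simp [hj]
    · simp
  simp only [e] at h1
  have e2 : inner ℝ (a.ofLp i) hh.toLp = innerRe h (a i) := by
    have := inner_toLp (Lp.memLp (a i)) hh
    rw [Lp.toLp_coeFn] at this
    rw [this, innerRe_comm]
  rw [e2] at h1
  refine h1.congr fun n => ?_
  rw [innerRe_comm]
  exact inner_toLp (hf (ns n) i) hh

theorem WeakTendsto.integral_smul {f : ℕ → Space d → ℂ} {g : Space d → ℂ} (h : WeakTendsto f g)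
    (hf : ∀ n, MemLp (f n) 2) (hg : MemLp g 2) {ψ : Space d → ℝ} (hψ : Continuous ψ)
    (hc : HasCompactSupport ψ) :
    Tendsto (fun n => ∫ z, ψ z • f n z) atTop (𝓝 (∫ z, ψ z • g z)) := by
  have hm := memLp_toC hψ hc
  have h1 := h _ hm
  have h2 := h _ (hm.const_smul Complex.I)
  have e : ∀ {v : Space d → ℂ}, MemLp v 2 volume →
      ∫ z, ψ z • v z = (innerRe (toC ψ) v : ℂ) + (innerRe (Complex.I • toC ψ) v : ℂ) * Complex.I := by
    intro v hv
    rw [← re_integral_smul hψ hc hv, ← im_integral_smul hψ hc hv]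
    exact (Complex.re_add_im _).symm
  rw [e hg]
  simp only [fun n => e (hf n)]
  exact ((Complex.continuous_ofReal.tendsto _).comp h1).add
    (((Complex.continuous_ofReal.tendsto _).comp h2).mul_const _)

/-- Bounded sequences of the energy space converge weakly along a subsequence. -/
theorem exists_energyFun_subseq {u : ℕ → Space d → ℂ} {G : ℕ → Option (Fin d) → Space d → ℂ}
    (h : ∀ n, EnergyFun (u n) (G n)) {B : ℝ} (hB : ∀ n, energySq (u n) (G n) ≤ B) :
    ∃ (v : Space d → ℂ) (V : Option (Fin d) → Space d → ℂ) (ns : ℕ → ℕ), StrictMono ns ∧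
      EnergyFun v V ∧ WeakTendsto (fun n => u (ns n)) v ∧
      (∀ k, WeakTendsto (fun n => G (ns n) k) (V k)) ∧
      WeakTendsto (fun n z => z.2 • u (ns n) z) fun z => z.2 • v z := by
  let f : ℕ → Option (Option (Option (Fin d))) → Space d → ℂ := fun n i => match i with
    | none => u n
    | some none => fun z => z.2 • u n z
    | some (some k) => G n k
  obtain ⟨g, ns, hns, hg, hlim⟩ := exists_subseq_weakTendsto (f := f) (B := B)
    (by
      rintro n (_ | _ | k)
      · exact (h n).memLp
      · exact (h n).weight_memLp
      · exact (h n).grad_memLp k)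
    (by
      rintro n (_ | _ | k)
      · exact (normSq_le_energySq _ _).trans (hB n)
      · exact (normSq_weight_le_energySq _ _).trans (hB n)
      · exact (normSq_grad_le_energySq _ _ k).trans (hB n))
  have h0 : WeakTendsto (fun n => u (ns n)) (g none) := hlim none
  have h1 : WeakTendsto (fun n z => z.2 • u (ns n) z) (g (some none)) := hlim (some none)
  have h2 : ∀ k, WeakTendsto (fun n => G (ns n) k) (g (some (some k))) := fun k =>
    hlim (some (some k))
  have hloc : LocallyIntegrable (fun z : Space d => z.2 • g none z) volume := by
    have := (hg none).locallyIntegrable (by norm_num : (1 : ℝ≥0∞) ≤ 2)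
    rw [← locallyIntegrableOn_univ] at this ⊢
    exact this.continuousOn_smul isOpen_univ.isLocallyClosed
      (continuous_snd.continuousOn)
  -- The weak limit of y u_n is identified by test functions: y ψ is again continuous with compact
  -- support, so the weight can be moved onto it.
  have hae : g (some none) =ᵐ[volume] fun z => z.2 • g none z := by
    have hl1 := (hg (some none)).locallyIntegrable (by norm_num : (1 : ℝ≥0∞) ≤ 2)
    have key := ae_eq_zero_of_integral_contDiff_smul_eq_zero (hl1.sub hloc) fun ψ hψ hc => ?_
    · filter_upwards [key] with z hz
      exact sub_eq_zero.1 hz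
    have c1 := h1.integral_smul (fun n => (h (ns n)).weight_memLp) (hg (some none))
      hψ.continuous hc
    have hψ2 : Continuous fun z : Space d => ψ z * z.2 := hψ.continuous.mul continuous_snd
    have c2 := h0.integral_smul (fun n => (h (ns n)).memLp) (hg none) hψ2 hc.mul_right
    simp only [mul_smul] at c2
    have e := tendsto_nhds_unique c1 c2
    simp only [Pi.sub_apply, smul_sub]
    rw [integral_sub (integrable_smul_of_test hψ.continuous hc (hg (some none)))
      (hloc.integrable_smul_left_of_hasCompactSupport hψ.continuous hc), e, sub_self]
  refine ⟨g none, fun k => g (some (some k)), ns, hns, ⟨hg none, fun k => hg _,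
    (hg (some none)).ae_eq hae, fun k ψ hψ => ?_⟩, h0, h2, ?_⟩
  · have c1 := h0.integral_smul (fun n => (h (ns n)).memLp) (hg none)
      (hψ.fderiv_continuous (dir k)) (hψ.fderiv_hasCompactSupport (dir k))
    have c2 := ((h2 k).integral_smul (fun n => (h (ns n)).grad_memLp k) (hg _)
      hψ.1.continuous hψ.2).neg
    refine tendsto_nhds_unique c1 (c2.congr fun n => ?_)
    exact ((h (ns n)).weak k ψ hψ).symm
  · intro w hw
    have e : innerRe w (fun z => z.2 • g none z) = innerRe w (g (some none)) :=
      integral_congr_ae (hae.mono fun z hz => by simp only [hz])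
    rw [e]
    exact h1 w hw

theorem integrableOn_normSq {f : Space d → ℂ} (hf : MemLp f 2) (s : Set (Space d)) :
    IntegrableOn (fun z => ‖f z‖ ^ 2) s :=
  (integrable_normSq hf).integrableOn

theorem setIntegral_normSq_le {f : Space d → ℂ} (hf : MemLp f 2) (s : Set (Space d)) :
    ∫ z in s, ‖f z‖ ^ 2 ≤ normSq f :=
  setIntegral_le_integral (integrable_normSq hf) (Eventually.of_forall fun z => by positivity)

/-- Weakly null bounded sequences of `H¹` tend to zero in `L²` on every ball. -/
theorem tendsto_setIntegral_normSq {a : ℕ → Space d → ℂ} {G : ℕ → Option (Fin d) → Space d → ℂ}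
    (h : ∀ n, EnergyFun (a n) (G n)) {B : ℝ} (hB : ∀ n, h1Sq (a n) (G n) ≤ B)
    (h0 : WeakTendsto a 0) (R : ℝ) :
    Tendsto (fun n => ∫ z in Metric.closedBall (0 : Space d) R, ‖a n z‖ ^ 2) atTop (𝓝 0) := by
  have hB0 : 0 ≤ B := (h1Sq_nonneg _ _).trans (hB 0)
  have hGk : ∀ n k, normSq (G n k) ≤ B := by
    intro n k
    have := Finset.single_le_sum (f := fun k => normSq (G n k)) (fun k _ => normSq_nonneg _)
      (Finset.mem_univ k)
    have h2 := hB n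
    unfold h1Sq at h2
    linarith [normSq_nonneg (a n)]
  have hna : ∀ n, normSq (a n) ≤ B := fun n => (normSq_le_h1Sq _ _).trans (hB n)
  set S : ℝ := ∑ _k : Option (Fin d), √B with hS
  have hS0 : 0 ≤ S := Finset.sum_nonneg fun _ _ => Real.sqrt_nonneg _
  -- uniform approximation by mollification
  have happ : ∀ m n, normSq (mollify (bumpSeq m) (a n) - a n) ≤ (4 * (1 / ((m : ℝ) + 1)) * S) ^ 2 := by
    intro m n
    have hmem : ∀ w, MemLp (fun z => a n (z - w)) 2 volume := fun w => by
      simpa [sub_eq_add_neg] using memLp_comp_add (h n).memLp (-w)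
    have h1 := eLpNorm_mollify_sub_le (bumpSeq m) (h n).memLp
      (C := ENNReal.ofReal (4 * (1 / ((m : ℝ) + 1)) * S)) fun w hw => ?_
    · rw [eLpNorm_sq_eq (memLp_mollify_sub (h n).memLp _),
        ENNReal.ofReal_le_ofReal_iff (by positivity)] at h1
      calc normSq (mollify (bumpSeq m) (a n) - a n)
          = √(normSq (mollify (bumpSeq m) (a n) - a n)) ^ 2 :=
            (Real.sq_sqrt (normSq_nonneg _)).symm
        _ ≤ _ := by gcongr
    · have h2 : eLpNorm (fun z => a n (z - w) - a n z) 2 volume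
          = ENNReal.ofReal √(normSq fun z => a n (z - w) - a n z) :=
        eLpNorm_sq_eq ((hmem w).sub (h n).memLp)
      rw [h2]
      refine ENNReal.ofReal_le_ofReal (Real.sqrt_le_iff.2 ⟨by positivity, ?_⟩)
      refine ((h n).normSq_translate_le w).trans ?_
      rw [bumpSeq_rOut] at hw
      have h3 : ∑ k, √(normSq (G n k)) ≤ S :=
        Finset.sum_le_sum fun k _ => Real.sqrt_le_sqrt (hGk n k)
      have h4 : 0 ≤ ∑ k, √(normSq (G n k)) := Finset.sum_nonneg fun _ _ => Real.sqrt_nonneg _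
      gcongr
  -- the mollified functions converge by dominated convergence
  have hmoll : ∀ m, Tendsto (fun n => ∫ z in Metric.closedBall (0 : Space d) R,
      ‖mollify (bumpSeq m) (a n) z‖ ^ 2) atTop (𝓝 0) := by
    intro m
    have hρ : MemLp (toC ((bumpSeq m : ContDiffBump (0 : Space d)).normed volume)) 2 :=
      memLp_toC (ContDiffBump.continuous_normed _) (ContDiffBump.hasCompactSupport_normed _)
    set M : ℝ := 2 * √(normSq (toC ((bumpSeq m : ContDiffBump (0 : Space d)).normed volume))) * √B
      with hM
    have hpt : ∀ z, Tendsto (fun n => mollify (bumpSeq m) (a n) z) atTop (𝓝 0) := by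
      intro z
      have ht := isTest_normed_sub (bumpSeq m) z
      have := h0.integral_smul (fun n => (h n).memLp) (MemLp.zero' : MemLp (0 : Space d → ℂ) 2 volume)
        ht.1.continuous ht.2
      simp only [Pi.zero_apply, smul_zero, integral_zero] at this
      exact this.congr fun n => (mollify_apply_swap _ _ _).symm
    have hbd : ∀ n z, ‖mollify (bumpSeq m) (a n) z‖ ≤ M := by
      intro n z
      have ht := isTest_normed_sub (bumpSeq m) z
      rw [mollify_apply_swap]
      refine (norm_integral_smul_le ht.1.continuous ht.2 (h n).memLp).trans ?_
      have e : normSq (toC fun w => (bumpSeq m : ContDiffBump (0 : Space d)).normed volume (z - w))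
          = normSq (toC ((bumpSeq m : ContDiffBump (0 : Space d)).normed volume)) :=
        integral_sub_left_eq_self
          (fun w => ‖(((bumpSeq m : ContDiffBump (0 : Space d)).normed volume w : ℝ) : ℂ)‖ ^ 2)
          volume z
      rw [e, hM]
      have := Real.sqrt_le_sqrt (hna n)
      gcongr
    have := tendsto_integral_of_dominated_convergence
      (μ := volume.restrict (Metric.closedBall (0 : Space d) R))
      (F := fun n z => ‖mollify (bumpSeq m) (a n) z‖ ^ 2) (f := fun _ => (0 : ℝ))
      (fun _ => M ^ 2)
      (fun n => ((contDiff_mollify _ (h n).memLp).continuous.norm.pow 2).aestronglyMeasurable)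
      (integrableOn_const measure_closedBall_lt_top.ne)
      (fun n => Eventually.of_forall fun z => by
        rw [Real.norm_of_nonneg (by positivity)]
        have := hbd n z
        gcongr)
      (Eventually.of_forall fun z => by
        have := (hpt z).norm.pow 2
        simpa using this)
    simpa using this
  rw [Metric.tendsto_atTop]
  intro ε hε
  have hlim : Tendsto (fun m : ℕ => (4 * (1 / ((m : ℝ) + 1)) * S) ^ 2) atTop (𝓝 0) := by
    have := ((tendsto_one_div_add_atTop_nhds_zero_nat (𝕜 := ℝ)).const_mul 4).mul_const S |>.pow 2
    simpa using this
  obtain ⟨m, hm⟩ := (hlim.eventually_lt_const (show 0 < ε / 4 by positivity)).exists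
  obtain ⟨N, hN⟩ := ((hmoll m).eventually_lt_const (show 0 < ε / 4 by positivity)).exists_forall_of_atTop
  refine ⟨N, fun n hn => ?_⟩
  have hi1 := integrableOn_normSq (memLp_mollify (h n).memLp (bumpSeq m))
    (Metric.closedBall (0 : Space d) R)
  have hi2 := integrableOn_normSq (memLp_mollify_sub (h n).memLp (bumpSeq m))
    (Metric.closedBall (0 : Space d) R)
  have h1 : ∫ z in Metric.closedBall (0 : Space d) R, ‖a n z‖ ^ 2
      ≤ ∫ z in Metric.closedBall (0 : Space d) R, (2 * ‖mollify (bumpSeq m) (a n) z‖ ^ 2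
        + 2 * ‖(mollify (bumpSeq m) (a n) - a n) z‖ ^ 2) := by
    refine integral_mono (integrableOn_normSq (h n).memLp _)
      ((hi1.const_mul 2).add (hi2.const_mul 2)) fun z => ?_
    simp only [Pi.sub_apply]
    have h3 : ‖a n z‖ ≤ ‖mollify (bumpSeq m) (a n) z‖ + ‖mollify (bumpSeq m) (a n) z - a n z‖ := by
      rw [← norm_sub_rev (a n z)]
      calc ‖a n z‖ = ‖mollify (bumpSeq m) (a n) z + (a n z - mollify (bumpSeq m) (a n) z)‖ := by
            congr 1; ring
        _ ≤ _ := norm_add_le _ _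
    nlinarith [norm_nonneg (a n z), sq_nonneg (‖mollify (bumpSeq m) (a n) z‖
      - ‖mollify (bumpSeq m) (a n) z - a n z‖)]
  rw [integral_add (hi1.const_mul 2) (hi2.const_mul 2), integral_const_mul, integral_const_mul] at h1
  have h2 := (setIntegral_normSq_le (memLp_mollify_sub (h n).memLp (bumpSeq m))
    (Metric.closedBall (0 : Space d) R)).trans (happ m n)
  have h3 := hN n hn
  have h4 : 0 ≤ ∫ z in Metric.closedBall (0 : Space d) R, ‖a n z‖ ^ 2 :=
    integral_nonneg fun z => by positivity
  rw [Real.dist_eq, sub_zero, abs_of_nonneg h4]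
  linarith

end PHNLS

end

noncomputable section

namespace PHNLS

open Filter Topology ENNReal

variable {d : ℕ} {α ω : ℝ}

/-! ### The functionals and their behaviour under dilations -/

/-- The action in terms of representatives. -/
def actionFun (α ω : ℝ) (u : Space d → ℂ) (G : Option (Fin d) → Space d → ℂ) : ℝ :=
  1 / 2 * gradX G + 1 / 2 * transverse ω u G - 1 / (α + 2) * powInt (α + 2) u

/-- The semivirial functional in terms of representatives. -/
def virialFun (α : ℝ) (u : Space d → ℂ) (G : Option (Fin d) → Space d → ℂ) : ℝ :=
  gradX G - α * d / (2 * (α + 2)) * powInt (α + 2) u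

/-- The positive quadratic form `S_ω - 2 / (α d) Q`. -/
def quadFun (α ω : ℝ) (u : Space d → ℂ) (G : Option (Fin d) → Space d → ℂ) : ℝ :=
  (1 / 2 - 2 / (α * d)) * gradX G + 1 / 2 * transverse ω u G

theorem gradX_nonneg (G : Option (Fin d) → Space d → ℂ) : 0 ≤ gradX G :=
  Finset.sum_nonneg fun _ _ => normSq_nonneg _

theorem transverse_nonneg (hω : 0 < ω) (u : Space d → ℂ) (G : Option (Fin d) → Space d → ℂ) :
    0 ≤ transverse ω u G := by
  have := normSq_nonneg (G none)
  have := normSq_nonneg fun z : Space d => z.2 • u z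
  have := normSq_nonneg u
  unfold transverse
  positivity

theorem mul_normSq_le_transverse (u : Space d → ℂ)
    (G : Option (Fin d) → Space d → ℂ) : ω * normSq u ≤ transverse ω u G := by
  have := normSq_nonneg (G none)
  have := normSq_nonneg fun z : Space d => z.2 • u z
  unfold transverse
  linarith

/-- The two ingredients of `quadFun` control the whole energy norm; ω > 0 is what controls the mass.
-/
theorem energySq_le (hω : 0 < ω) (u : Space d → ℂ) (G : Option (Fin d) → Space d → ℂ) :
    energySq u G ≤ gradX G + (1 + ω⁻¹) * transverse ω u G := by
  have h1 := mul_normSq_le_transverse (ω := ω) u G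
  have h2 : normSq u ≤ ω⁻¹ * transverse ω u G := by
    rw [inv_mul_eq_div, le_div_iff₀ hω]
    linarith
  have h3 : energySq u G = normSq u + normSq (fun z : Space d => z.2 • u z)
      + (normSq (G none) + gradX G) := by
    rw [energySq, Fintype.sum_option, gradX]
  have h4 : transverse ω u G = normSq (G none) + normSq (fun z : Space d => z.2 • u z)
      + ω * normSq u := rfl
  have h5 := mul_nonneg hω.le (normSq_nonneg u)
  rw [h3, add_mul, one_mul]
  linarith

theorem h1Sq_le_energySq (u : Space d → ℂ) (G : Option (Fin d) → Space d → ℂ) :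
    h1Sq u G ≤ energySq u G := by
  unfold h1Sq energySq
  linarith [normSq_nonneg fun z : Space d => z.2 • u z]

/-- The admissible range of exponents. -/
structure Admissible (d : ℕ) (α ω : ℝ) : Prop where
  two_le : 2 ≤ d
  lower : 4 / (d : ℝ) < α
  upper : α < 4 / ((d : ℝ) - 1)
  pos : 0 < ω

theorem powInt_add_two_dilate {l : ℝ} (hl : 0 < l) (u : Space d → ℂ) :
    powInt (α + 2) (dilate l u) = l ^ (α * d / 2) * powInt (α + 2) u := by
  rw [powInt_dilate hl]
  congr 2
  ring

/-- The dilation factor that brings `u` onto the constraint `Q = 0`. -/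
def virialScale (α : ℝ) (u : Space d → ℂ) (G : Option (Fin d) → Space d → ℂ) : ℝ :=
  (gradX G / (α * d / (2 * (α + 2)) * powInt (α + 2) u)) ^ (1 / (α * d / 2 - 2))

namespace Admissible

theorem d_pos (ha : Admissible d α ω) : 0 < (d : ℝ) := by
  have := ha.two_le
  exact_mod_cast (by omega : 0 < d)

/-- The lower bound on α in its working form: under dilation the exponent αd/2 of the nonlinear term
exceeds the exponent 2 of the gradient. -/
theorem four_lt (ha : Admissible d α ω) : 4 < α * d := by
  have := ha.lower
  rwa [div_lt_iff₀ ha.d_pos] at this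

theorem α_pos (ha : Admissible d α ω) : 0 < α := lt_trans (div_pos four_pos ha.d_pos) ha.lower

theorem coeff_pos (ha : Admissible d α ω) : 0 < α * d / (2 * (α + 2)) := by
  have := ha.α_pos
  have := ha.d_pos
  positivity

theorem quad_coeff_pos (ha : Admissible d α ω) : 0 < 1 / 2 - 2 / (α * d) := by
  have h := ha.four_lt
  have : 2 / (α * d) < 1 / 2 := by
    rw [div_lt_iff₀ (by linarith)]
    linarith
  linarith

/-- The factor 2/(αd) is the one for which the nonlinear terms of S and Q cancel. -/
theorem quadFun_eq (ha : Admissible d α ω) (u : Space d → ℂ) (G : Option (Fin d) → Space d → ℂ) :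
    quadFun α ω u G = actionFun α ω u G - 2 / (α * d) * virialFun α u G := by
  have := ha.α_pos.ne'
  have := ha.d_pos.ne'
  have : α + 2 ≠ 0 := by linarith [ha.α_pos]
  unfold quadFun actionFun virialFun
  field_simp
  ring

theorem integrable_rpow (ha : Admissible d α ω) {u : Space d → ℂ} {G : Option (Fin d) → Space d → ℂ}
    (h : EnergyFun u G) : Integrable fun z => ‖u z‖ ^ (α + 2) :=
  h.integrable_rpow ha.two_le ha.α_pos ha.upper

theorem powInt_pos (ha : Admissible d α ω) {u : Space d → ℂ} {G : Option (Fin d) → Space d → ℂ}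
    (h : EnergyFun u G) (hu : 0 < normSq u) : 0 < powInt (α + 2) u := by
  refine lt_of_le_of_ne (powInt_nonneg _ _) fun h0 => hu.ne' ?_
  have h1 := (integral_eq_zero_iff_of_nonneg (fun z => by positivity) (ha.integrable_rpow h)).1 h0.symm
  have h2 : u =ᵐ[volume] 0 := by
    filter_upwards [h1] with z hz
    have : ‖u z‖ = 0 := by
      by_contra hne
      have hp : 0 < ‖u z‖ := lt_of_le_of_ne (norm_nonneg _) (Ne.symm hne)
      exact (Real.rpow_pos_of_pos hp (α + 2)).ne' hz
    simpa using this
  rw [normSq_congr h2]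
  simp [normSq]

/-- The Sobolev inequality for all dilates of u at once. The freedom in `l` plays the part of a
Gagliardo–Nirenberg inequality that is sharp in its powers of the x-gradient. -/
theorem exists_powInt_dilate_le (ha : Admissible d α ω) :
    ∃ C : ℝ, 0 < C ∧ ∀ (u : Space d → ℂ) (G : Option (Fin d) → Space d → ℂ), EnergyFun u G →
      ∀ l : ℝ, 0 < l → l ^ (α * d / 2) * powInt (α + 2) u
        ≤ C * (l ^ 2 * gradX G + (1 + ω⁻¹) * transverse ω u G) ^ ((α + 2) / 2) := by
  obtain ⟨C, hC, h⟩ := exists_sobolev_subcritical ha.two_le ha.α_pos ha.upper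
  refine ⟨C, hC, fun u G hu l hl => ?_⟩
  have h1 := h _ _ (hu.dilate hl)
  rw [powInt_add_two_dilate hl] at h1
  refine h1.trans (mul_le_mul_of_nonneg_left (Real.rpow_le_rpow (h1Sq_nonneg _ _) ?_
    (by linarith [ha.α_pos])) hC.le)
  refine (h1Sq_le_energySq _ _).trans ((energySq_le ha.pos _ _).trans (le_of_eq ?_))
  rw [gradX_dilateGrad hl, transverse_dilate hl]

/-- If the x-gradient vanished, the right side of the dilated inequality would not depend on `l`,
while the left side grows without bound. -/
theorem gradX_pos (ha : Admissible d α ω) {u : Space d → ℂ} {G : Option (Fin d) → Space d → ℂ}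
    (h : EnergyFun u G) (hu : 0 < normSq u) : 0 < gradX G := by
  refine lt_of_le_of_ne (gradX_nonneg G) fun h0 => ?_
  obtain ⟨C, hC, hle⟩ := ha.exists_powInt_dilate_le
  have hN := ha.powInt_pos h hu
  have h1 := hle u G h
  rw [← h0] at h1
  set K := C * ((1 + ω⁻¹) * transverse ω u G) ^ ((α + 2) / 2) with hK
  have h2 : ∀ l : ℝ, 0 < l → l ^ (α * d / 2) * powInt (α + 2) u ≤ K := by
    intro l hl
    have := h1 l hl
    simpa [hK] using this
  have hexp : 0 < α * d / 2 := by linarith [ha.four_lt]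
  have ht := ((tendsto_rpow_atTop hexp).atTop_mul_const hN)
  obtain ⟨l, hl1, hl2⟩ := ((ht.eventually_gt_atTop K).and (eventually_gt_atTop 0)).exists
  exact absurd (h2 l hl2) (not_le.2 hl1)

/-- On the set `Q ≤ 0`, the gradient in `x` is bounded below. -/
theorem exists_gradX_lower (ha : Admissible d α ω) (M : ℝ) (hM : 0 < M) :
    ∃ δ : ℝ, 0 < δ ∧ ∀ (u : Space d → ℂ) (G : Option (Fin d) → Space d → ℂ), EnergyFun u G →
      0 < normSq u → transverse ω u G ≤ M → virialFun α u G ≤ 0 → δ ≤ gradX G := by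
  obtain ⟨C, hC, hle⟩ := ha.exists_powInt_dilate_le
  have hc := ha.coeff_pos
  have hω := ha.pos
  set c := α * d / (2 * (α + 2)) with hcdef
  set K := C * ((2 + ω⁻¹) * M) ^ ((α + 2) / 2) * M ^ (-(α * d / 4)) with hK
  have hK0 : 0 < K := by positivity
  have he : 0 < α * d / 4 - 1 := by linarith [ha.four_lt]
  refine ⟨(c * K) ^ (-(1 / (α * d / 4 - 1))), by positivity, fun u G h hu hH hQ => ?_⟩
  have hA := ha.gradX_pos h hu
  set A := gradX G with hAdef
  set N := powInt (α + 2) u with hN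
  have h1 : N ≤ K * A ^ (α * d / 4) := by
    -- With l² = M/A the dilated gradient term equals M, and the inequality becomes N ≤ K A^(αd/4).
    have h2 := hle u G h √(M / A) (by positivity)
    rw [Real.sq_sqrt (by positivity), div_mul_cancel₀ _ hA.ne', Real.sqrt_eq_rpow,
      ← Real.rpow_mul (by positivity), show 1 / 2 * (α * d / 2) = α * d / 4 by ring,
      Real.div_rpow hM.le hA.le] at h2
    have h3 : (M + (1 + ω⁻¹) * transverse ω u G) ^ ((α + 2) / 2)
        ≤ ((2 + ω⁻¹) * M) ^ ((α + 2) / 2) := by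
      refine Real.rpow_le_rpow ?_ ?_ (by linarith [ha.α_pos])
      · have := transverse_nonneg hω u G
        positivity
      · have : (1 + ω⁻¹) * transverse ω u G ≤ (1 + ω⁻¹) * M := by gcongr
        linarith
    have hMp : 0 < M ^ (α * d / 4) := by positivity
    have hAp : 0 < A ^ (α * d / 4) := by positivity
    have h4 := h2.trans (mul_le_mul_of_nonneg_left h3 hC.le)
    rw [div_mul_eq_mul_div, div_le_iff₀ hAp] at h4
    rw [hK, Real.rpow_neg hM.le]
    calc N = (M ^ (α * d / 4) * N) * (M ^ (α * d / 4))⁻¹ := by field_simp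
      _ ≤ (C * ((2 + ω⁻¹) * M) ^ ((α + 2) / 2) * A ^ (α * d / 4)) * (M ^ (α * d / 4))⁻¹ := by
          gcongr
      _ = _ := by ring
  have h2 : A ≤ c * N := by
    unfold virialFun at hQ
    linarith
  -- Q ≤ 0 means A ≤ cN, so A is bounded by a power of itself larger than 1; dividing by A bounds it
  -- below.
  have h3 : A ≤ (c * K) * (A ^ (α * d / 4 - 1) * A) := by
    have e : A ^ (α * d / 4 - 1) * A = A ^ (α * d / 4) := by
      rw [Real.rpow_sub_one hA.ne', div_mul_cancel₀ _ hA.ne']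
    rw [e, mul_assoc]
    exact h2.trans (mul_le_mul_of_nonneg_left h1 hc.le)
  have h4 : (c * K)⁻¹ ≤ A ^ (α * d / 4 - 1) := by
    have h5 : A * 1 ≤ A * ((c * K) * A ^ (α * d / 4 - 1)) := by linarith
    have h6 := le_of_mul_le_mul_left h5 hA
    rw [inv_le_iff_one_le_mul₀ (by positivity)]
    linarith
  have h5 := Real.rpow_le_rpow (by positivity) h4 (show 0 ≤ 1 / (α * d / 4 - 1) by positivity)
  rw [← Real.rpow_mul hA.le, mul_one_div_cancel he.ne', Real.rpow_one,
    Real.inv_rpow (by positivity), ← Real.rpow_neg (by positivity)] at h5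
  exact h5

/-- Along the dilation Q is l² A - c l^(αd/2) N, which vanishes when l^(αd/2 - 2) = A/(cN). If Q ≤ 0
this ratio is at most 1, and so is l because the exponent is positive. -/
theorem virialScale_spec (ha : Admissible d α ω) {u : Space d → ℂ} {G : Option (Fin d) → Space d → ℂ}
    (h : EnergyFun u G) (hu : 0 < normSq u) :
    0 < virialScale α u G ∧
      virialFun α (dilate (virialScale α u G) u) (dilateGrad (virialScale α u G) G) = 0 ∧
      (virialFun α u G ≤ 0 → virialScale α u G ≤ 1) := by
  have hA := ha.gradX_pos h hu
  have hN := ha.powInt_pos h hu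
  have hc := ha.coeff_pos
  have he : 0 < α * d / 2 - 2 := by linarith [ha.four_lt]
  have hl0 : 0 < virialScale α u G := by unfold virialScale; positivity
  refine ⟨hl0, ?_, fun hQ => ?_⟩
  · set l := virialScale α u G with hl
    rw [virialFun, gradX_dilateGrad hl0, powInt_add_two_dilate hl0]
    have h1 : l ^ (α * d / 2) = l ^ (α * d / 2 - 2) * l ^ 2 := by
      rw [← Real.rpow_two, ← Real.rpow_add hl0]
      ring_nf
    have h2 : l ^ (α * d / 2 - 2) = gradX G / (α * d / (2 * (α + 2)) * powInt (α + 2) u) := by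
      rw [hl, virialScale, ← Real.rpow_mul (by positivity), one_div_mul_cancel he.ne', Real.rpow_one]
    rw [h1, h2]
    generalize α * d / (2 * (α + 2)) = c at hc
    field_simp
    ring
  · unfold virialScale
    refine Real.rpow_le_one (by positivity) ?_ (by positivity)
    rw [div_le_one (by positivity)]
    unfold virialFun at hQ
    linarith

theorem quadFun_nonneg (ha : Admissible d α ω) (u : Space d → ℂ) (G : Option (Fin d) → Space d → ℂ) :
    0 ≤ quadFun α ω u G := by
  have h1 := ha.quad_coeff_pos
  have h2 := gradX_nonneg G
  have h3 := transverse_nonneg ha.pos u G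
  unfold quadFun
  positivity

theorem quadFun_pos (ha : Admissible d α ω) {u : Space d → ℂ} (G : Option (Fin d) → Space d → ℂ)
    (hu : 0 < normSq u) : 0 < quadFun α ω u G := by
  have h1 := ha.quad_coeff_pos
  have h2 := gradX_nonneg G
  have h3 := mul_normSq_le_transverse (ω := ω) u G
  have h4 : 0 < ω * normSq u := mul_pos ha.pos hu
  have h5 : 0 ≤ (1 / 2 - 2 / (α * d)) * gradX G := by positivity
  unfold quadFun
  linarith

/-- A lower bound of the action on `Q = 0` bounds the quadratic form on `Q ≤ 0`. -/
theorem le_quadFun (ha : Admissible d α ω) {m : ℝ}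
    (hm : ∀ (u : Space d → ℂ) (G : Option (Fin d) → Space d → ℂ), EnergyFun u G →
      0 < normSq u → virialFun α u G = 0 → m ≤ actionFun α ω u G)
    {u : Space d → ℂ} {G : Option (Fin d) → Space d → ℂ} (h : EnergyFun u G)
    (hu : 0 < normSq u) (hQ : virialFun α u G ≤ 0) :
    ∃ l : ℝ, 0 < l ∧ virialFun α (dilate l u) (dilateGrad l G) = 0 ∧
      m ≤ actionFun α ω (dilate l u) (dilateGrad l G) ∧
      actionFun α ω (dilate l u) (dilateGrad l G) ≤ quadFun α ω u G := by
  obtain ⟨hl, h0, h1⟩ := ha.virialScale_spec h hu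
  refine ⟨_, hl, h0, hm _ _ (h.dilate hl) ((normSq_dilate hl u).symm ▸ hu) h0, ?_⟩
  have e := ha.quadFun_eq (dilate (virialScale α u G) u) (dilateGrad (virialScale α u G) G)
  rw [h0, mul_zero, sub_zero] at e
  rw [← e, quadFun, quadFun, gradX_dilateGrad hl, transverse_dilate hl]
  have hc := ha.quad_coeff_pos
  have hA := gradX_nonneg G
  -- A factor at most 1 can only decrease the x-gradient, and the transverse part does not change.
  have h2 := h1 hQ
  have h3 := pow_le_one₀ (n := 2) hl.le h2
  have h5 := mul_le_of_le_one_left hA h3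
  have h6 := mul_le_mul_of_nonneg_left h5 hc.le
  linarith

end Admissible

end PHNLS

end

noncomputable section

namespace PHNLS

open Filter Topology ENNReal

variable {d : ℕ} {α ω : ℝ}

/-! ### Non-vanishing -/

/-- A fixed smooth cutoff in the variable `x`. -/
def cutoffX : ContDiffBump (0 : EuclideanSpace ℝ (Fin d)) := ⟨1, 2, one_pos, one_lt_two⟩

/-- The cutoff in `x` centred at `a`, as a function on `ℝ^d × ℝ`. -/
def cutoffAt (a : EuclideanSpace ℝ (Fin d)) : Space d → ℝ := fun z => cutoffX (z.1 - a)

theorem contDiff_cutoffAt (a : EuclideanSpace ℝ (Fin d)) :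
    ContDiff ℝ (⊤ : ℕ∞) (cutoffAt a) :=
  cutoffX.contDiff.comp (contDiff_fst.sub contDiff_const)

theorem abs_cutoffAt_le (a : EuclideanSpace ℝ (Fin d)) (z : Space d) : |cutoffAt a z| ≤ 1 := by
  rw [cutoffAt, abs_of_nonneg cutoffX.nonneg]
  exact cutoffX.le_one

theorem fderiv_cutoffAt (a : EuclideanSpace ℝ (Fin d)) (z v : Space d) :
    fderiv ℝ (cutoffAt a) z v
      = fderiv ℝ (cutoffX : EuclideanSpace ℝ (Fin d) → ℝ) (z.1 - a) v.1 := by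
  have h1 : HasFDerivAt (fun z : Space d => z.1 - a)
      (ContinuousLinearMap.fst ℝ (EuclideanSpace ℝ (Fin d)) ℝ) z :=
    hasFDerivAt_fst.sub_const a
  have h2 : HasFDerivAt (cutoffX : EuclideanSpace ℝ (Fin d) → ℝ) _ (z.1 - a) :=
    ((cutoffX.contDiff (n := 1)).differentiable (by simp) _).hasFDerivAt
  have h3 : HasFDerivAt (cutoffAt a) _ z := h2.comp z h1
  rw [h3.fderiv]
  rfl

theorem exists_bound_fderiv_cutoffAt :
    ∃ C : ℝ, 1 ≤ C ∧ ∀ (a : EuclideanSpace ℝ (Fin d)) k (z : Space d),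
      |fderiv ℝ (cutoffAt a) z (dir k)| ≤ C := by
  have h : ∀ k : Option (Fin d), ∃ C : ℝ, ∀ x : EuclideanSpace ℝ (Fin d),
      ‖fderiv ℝ (cutoffX : EuclideanSpace ℝ (Fin d) → ℝ) x (dir k).1‖ ≤ C := by
    intro k
    have hc : Continuous fun x =>
        fderiv ℝ (cutoffX : EuclideanSpace ℝ (Fin d) → ℝ) x (dir k).1 :=
      ((cutoffX.contDiff (n := 1)).continuous_fderiv (by simp)).clm_apply continuous_const
    exact hc.bounded_above_of_compact_support
      (cutoffX.hasCompactSupport.fderiv_apply (𝕜 := ℝ) (dir k).1)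
  choose C hC using h
  refine ⟨1 + ∑ k, |C k|, by
    linarith [Finset.sum_nonneg fun k (_ : k ∈ Finset.univ) => abs_nonneg (C k)], fun a k z => ?_⟩
  have := Finset.single_le_sum (f := fun k => |C k|) (fun k _ => abs_nonneg (C k))
    (Finset.mem_univ k)
  have h1 := hC k (z.1 - a)
  rw [Real.norm_eq_abs] at h1
  have h2 := le_abs_self (C k)
  rw [fderiv_cutoffAt]
  linarith

theorem cutoffAt_eq_zero {a : EuclideanSpace ℝ (Fin d)} {z : Space d} (h : 2 < ‖z.1 - a‖) :
    cutoffAt a z = 0 := by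
  refine cutoffX.zero_of_le_dist ?_
  rw [dist_zero_right]
  exact h.le

theorem fderiv_cutoffAt_eq_zero {a : EuclideanSpace ℝ (Fin d)} {z : Space d}
    (h : 2 < ‖z.1 - a‖) (v : Space d) : fderiv ℝ (cutoffAt a) z v = 0 := by
  rw [fderiv_cutoffAt]
  have h1 : z.1 - a ∉ tsupport (cutoffX : EuclideanSpace ℝ (Fin d) → ℝ) := by
    rw [cutoffX.tsupport_eq, mem_closedBall_zero_iff]
    exact not_le.2 h
  rw [image_eq_zero_of_notMem_tsupport (fun hc => h1 (tsupport_fderiv_subset ℝ hc))]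
  rfl

/-- Tonelli: averaged over all centres, a window sees every point with the same weight. This takes
the place of a covering of ℝ^d by cubes. -/
theorem lintegral_average {g : EuclideanSpace ℝ (Fin d) → ℝ≥0∞} (hg : Measurable g)
    {f : Space d → ℝ≥0∞} (hf : AEMeasurable f volume) :
    ∫⁻ a : EuclideanSpace ℝ (Fin d), ∫⁻ z : Space d, g (z.1 - a) * f z
      = (∫⁻ a, g a) * ∫⁻ z, f z := by
  have hm : AEMeasurable
      (Function.uncurry fun (a : EuclideanSpace ℝ (Fin d)) (z : Space d) => g (z.1 - a) * f z)
      ((volume : Measure (EuclideanSpace ℝ (Fin d))).prod (volume : Measure (Space d))) := by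
    have h1 : Measurable fun q : EuclideanSpace ℝ (Fin d) × Space d => g (q.2.1 - q.1) :=
      hg.comp ((measurable_fst.comp measurable_snd).sub measurable_fst)
    have h2 : AEMeasurable (fun q : EuclideanSpace ℝ (Fin d) × Space d => f q.2)
        ((volume : Measure (EuclideanSpace ℝ (Fin d))).prod (volume : Measure (Space d))) :=
      hf.comp_snd
    exact AEMeasurable.mul h1.aemeasurable h2
  rw [lintegral_lintegral_swap hm, ← lintegral_const_mul'' _ hf]
  congr 1 with z
  have h1 : Measurable fun a : EuclideanSpace ℝ (Fin d) => g (z.1 - a) :=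
    hg.comp (measurable_const.sub measurable_id)
  rw [lintegral_mul_const _ h1, lintegral_sub_left_eq_self]

theorem measure_ball_pos_lt_top :
    0 < (volume (Metric.closedBall (0 : EuclideanSpace ℝ (Fin d)) 2)).toReal :=
  ENNReal.toReal_pos (Metric.measure_closedBall_pos _ _ two_pos).ne' measure_closedBall_lt_top.ne

/-- The squared `H¹` density. -/
def density (u : Space d → ℂ) (G : Option (Fin d) → Space d → ℂ) : Space d → ℝ :=
  fun z => ‖u z‖ ^ 2 + ∑ k, ‖G k z‖ ^ 2

theorem EnergyFun.integrable_density {u : Space d → ℂ} {G : Option (Fin d) → Space d → ℂ}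
    (h : EnergyFun u G) : Integrable (density u G) :=
  (integrable_normSq h.memLp).add
    (integrable_finsetSum _ fun k _ => integrable_normSq (h.grad_memLp k))

theorem EnergyFun.integral_density {u : Space d → ℂ} {G : Option (Fin d) → Space d → ℂ}
    (h : EnergyFun u G) : ∫ z, density u G z = h1Sq u G := by
  unfold density h1Sq normSq
  rw [integral_add (integrable_normSq h.memLp)
      (integrable_finsetSum _ fun k _ => integrable_normSq (h.grad_memLp k)),
    integral_finsetSum _ fun k _ => integrable_normSq (h.grad_memLp k)]

theorem density_nonneg (u : Space d → ℂ) (G : Option (Fin d) → Space d → ℂ) (z : Space d) :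
    0 ≤ density u G z := by
  unfold density
  positivity

/-- The gradient of the product of `u` and a cutoff. -/
def cutoffGrad (a : EuclideanSpace ℝ (Fin d)) (u : Space d → ℂ)
    (G : Option (Fin d) → Space d → ℂ) : Option (Fin d) → Space d → ℂ :=
  fun k z => cutoffAt a z • G k z + fderiv ℝ (cutoffAt a) z (dir k) • u z

theorem exists_cutoffAt_bound :
    ∃ K : ℝ, 0 < K ∧ ∀ (a : EuclideanSpace ℝ (Fin d)) (u : Space d → ℂ)
      (G : Option (Fin d) → Space d → ℂ), EnergyFun u G →
      EnergyFun (fun z => cutoffAt a z • u z) (cutoffGrad a u G) ∧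
      h1Sq (fun z => cutoffAt a z • u z) (cutoffGrad a u G)
        ≤ K * ∫ z in {z : Space d | ‖z.1 - a‖ ≤ 2}, density u G z := by
  obtain ⟨C, hC1, hC⟩ := exists_bound_fderiv_cutoffAt (d := d)
  -- 1 + 2(d+1)C² bounds the coefficient of |u|², and 2 that of the squared gradients.
  refine ⟨1 + 2 * (d + 1) * C ^ 2 + 2, by positivity, fun a u G h => ?_⟩
  have hE : EnergyFun (fun z => cutoffAt a z • u z) (cutoffGrad a u G) :=
    h.mul_smooth (contDiff_cutoffAt a) (fun z => (abs_cutoffAt_le a z).trans hC1) (hC a)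
  refine ⟨hE, ?_⟩
  have hms : MeasurableSet {z : Space d | ‖z.1 - a‖ ≤ 2} :=
    measurableSet_le (by fun_prop) measurable_const
  rw [← hE.integral_density, ← integral_const_mul, ← integral_indicator hms]
  refine integral_mono hE.integrable_density ((h.integrable_density.const_mul _).indicator hms)
    fun z => ?_
  by_cases hz : ‖z.1 - a‖ ≤ 2
  · rw [Set.indicator_of_mem (show z ∈ {z : Space d | ‖z.1 - a‖ ≤ 2} from hz)]
    have h1 : ‖cutoffAt a z • u z‖ ^ 2 ≤ ‖u z‖ ^ 2 := by
      rw [norm_smul]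
      gcongr
      exact mul_le_of_le_one_left (norm_nonneg _) (abs_cutoffAt_le a z)
    have h2 : ∀ k, ‖cutoffGrad a u G k z‖ ^ 2 ≤ 2 * ‖G k z‖ ^ 2 + 2 * C ^ 2 * ‖u z‖ ^ 2 := by
      intro k
      have h3 : ‖cutoffGrad a u G k z‖ ≤ ‖G k z‖ + C * ‖u z‖ := by
        refine (norm_add_le _ _).trans (add_le_add ?_ ?_)
        · rw [norm_smul]
          exact mul_le_of_le_one_left (norm_nonneg _) (abs_cutoffAt_le a z)
        · rw [norm_smul]
          exact mul_le_mul_of_nonneg_right (hC a k z) (norm_nonneg _)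
      calc ‖cutoffGrad a u G k z‖ ^ 2 ≤ (‖G k z‖ + C * ‖u z‖) ^ 2 := by gcongr
        _ ≤ _ := by nlinarith [sq_nonneg (‖G k z‖ - C * ‖u z‖)]
    have h4 : ∑ k, ‖cutoffGrad a u G k z‖ ^ 2
        ≤ 2 * (∑ k, ‖G k z‖ ^ 2) + (d + 1) * (2 * C ^ 2 * ‖u z‖ ^ 2) := by
      refine (Finset.sum_le_sum fun k _ => h2 k).trans_eq ?_
      rw [Finset.sum_add_distrib, ← Finset.mul_sum, Finset.sum_const, Finset.card_univ,
        Fintype.card_option, Fintype.card_fin, nsmul_eq_mul]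
      push_cast
      ring
    have h5 : 0 ≤ ∑ k, ‖G k z‖ ^ 2 := Finset.sum_nonneg fun _ _ => by positivity
    have h6 : 0 ≤ 2 * ((d : ℝ) + 1) * C ^ 2 * ∑ k, ‖G k z‖ ^ 2 := by positivity
    have h7 : 0 ≤ ‖u z‖ ^ 2 := by positivity
    simp only [density] at *
    nlinarith
  · rw [Set.indicator_of_notMem (show z ∉ {z : Space d | ‖z.1 - a‖ ≤ 2} from hz)]
    push Not at hz
    simp [density, cutoffGrad, cutoffAt_eq_zero hz, fderiv_cutoffAt_eq_zero hz]

theorem powInt_cutoffAt_le (ha : Admissible d α ω) {u : Space d → ℂ}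
    {G : Option (Fin d) → Space d → ℂ} (h : EnergyFun u G) (a : EuclideanSpace ℝ (Fin d)) :
    powInt (α + 2) (fun z => cutoffAt a z • u z)
      ≤ ∫ z in {z : Space d | ‖z.1‖ ≤ 2}, ‖shift a u z‖ ^ (α + 2) := by
  have hp : 0 < α + 2 := by linarith [ha.α_pos]
  have hms : MeasurableSet {z : Space d | ‖z.1‖ ≤ 2} :=
    measurableSet_le (by fun_prop) measurable_const
  have hi := (ha.integrable_rpow (h.shift a)).indicator hms
  rw [← powInt_shift a, ← integral_indicator hms]
  refine integral_mono_of_nonneg (Eventually.of_forall fun z => by positivity) hi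
    (Eventually.of_forall fun z => ?_)
  by_cases hz : ‖z.1‖ ≤ 2
  · rw [Set.indicator_of_mem (show z ∈ {z : Space d | ‖z.1‖ ≤ 2} from hz)]
    refine Real.rpow_le_rpow (norm_nonneg _) ?_ hp.le
    simp only [shift, norm_smul]
    exact mul_le_of_le_one_left (norm_nonneg _) (abs_cutoffAt_le a _)
  · rw [Set.indicator_of_notMem (show z ∉ {z : Space d | ‖z.1‖ ≤ 2} from hz)]
    push Not at hz
    have : cutoffAt a (z + (a, 0)) = 0 := cutoffAt_eq_zero (by simpa using hz)
    simp [shift, this, Real.zero_rpow hp.ne']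

/-- A bounded function with `∫ |u|^{α+2}` bounded below has, after a translation, a part of it in
a fixed cylinder. -/
theorem exists_shift_lower (ha : Admissible d α ω) {B n₀ : ℝ} (hB : 0 < B) (hn₀ : 0 < n₀) :
    ∃ c : ℝ, 0 < c ∧ ∀ (u : Space d → ℂ) (G : Option (Fin d) → Space d → ℂ), EnergyFun u G →
      h1Sq u G ≤ B → n₀ ≤ powInt (α + 2) u → ∃ a : EuclideanSpace ℝ (Fin d),
        c ≤ ∫ z in {z : Space d | ‖z.1‖ ≤ 2}, ‖shift a u z‖ ^ (α + 2) := by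
  have hα := ha.α_pos
  have hp : 0 < α + 2 := by linarith
  obtain ⟨K, hK, hcut⟩ := exists_cutoffAt_bound (d := d)
  obtain ⟨C, hC, hS⟩ := exists_sobolev_subcritical ha.two_le ha.α_pos ha.upper
  set g₁ : EuclideanSpace ℝ (Fin d) → ℝ≥0∞ := fun x => ENNReal.ofReal (cutoffX x ^ (α + 2)) with hg₁
  set g₂ : EuclideanSpace ℝ (Fin d) → ℝ≥0∞ :=
    (Metric.closedBall (0 : EuclideanSpace ℝ (Fin d)) 2).indicator 1 with hg₂
  have hc1 : Continuous fun x : EuclideanSpace ℝ (Fin d) => cutoffX x ^ (α + 2) :=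
    cutoffX.continuous.rpow_const fun x => Or.inr hp.le
  have hg₁m : Measurable g₁ := hc1.measurable.ennreal_ofReal
  have hg₂m : Measurable g₂ := measurable_one.indicator Metric.isClosed_closedBall.measurableSet
  have hi1 : Integrable fun x : EuclideanSpace ℝ (Fin d) => cutoffX x ^ (α + 2) :=
    hc1.integrable_of_hasCompactSupport
      (cutoffX.hasCompactSupport.comp_left (g := fun s : ℝ => s ^ (α + 2)) (Real.zero_rpow hp.ne'))
  set κ : ℝ := ∫ x : EuclideanSpace ℝ (Fin d), cutoffX x ^ (α + 2) with hκ
  have hκ0 : 0 < κ := by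
    refine hc1.integral_pos_of_hasCompactSupport_nonneg_nonzero
      (cutoffX.hasCompactSupport.comp_left (g := fun s : ℝ => s ^ (α + 2)) (Real.zero_rpow hp.ne'))
      (fun x => Real.rpow_nonneg cutoffX.nonneg _) (x := 0) ?_
    have : cutoffX (0 : EuclideanSpace ℝ (Fin d)) = 1 :=
      cutoffX.one_of_mem_closedBall (by rw [Metric.mem_closedBall, dist_self]; exact zero_le_one)
    rw [this, Real.one_rpow]
    exact one_ne_zero
  have hI1 : ∫⁻ x, g₁ x = ENNReal.ofReal κ :=
    (ofReal_integral_eq_lintegral_ofReal hi1 (Eventually.of_forall fun x =>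
      Real.rpow_nonneg cutoffX.nonneg _)).symm
  set b : ℝ := (volume (Metric.closedBall (0 : EuclideanSpace ℝ (Fin d)) 2)).toReal with hb
  have hb0 : 0 < b := measure_ball_pos_lt_top
  have hI2 : ∫⁻ x, g₂ x = ENNReal.ofReal b := by
    rw [hg₂, lintegral_indicator_one Metric.isClosed_closedBall.measurableSet, hb,
      ENNReal.ofReal_toReal measure_closedBall_lt_top.ne]
  set ε : ℝ := κ * n₀ / (2 * b * B) with hε
  have hε0 : 0 < ε := by positivity
  refine ⟨ε / K * (ε / K / C) ^ (2 / α), by positivity, fun u G h hhB hN => ?_⟩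
  set f₁ : Space d → ℝ≥0∞ := fun z => ENNReal.ofReal (‖u z‖ ^ (α + 2)) with hf₁
  set f₂ : Space d → ℝ≥0∞ := fun z => ENNReal.ofReal (density u G z) with hf₂
  have hf₁m : AEMeasurable f₁ volume := (ha.integrable_rpow h).1.aemeasurable.ennreal_ofReal
  have hf₂m : AEMeasurable f₂ volume := h.integrable_density.1.aemeasurable.ennreal_ofReal
  have hF1 : ∫⁻ z, f₁ z = ENNReal.ofReal (powInt (α + 2) u) :=
    (ofReal_integral_eq_lintegral_ofReal (ha.integrable_rpow h)
      (Eventually.of_forall fun z => by positivity)).symm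
  have hF2 : ∫⁻ z, f₂ z = ENNReal.ofReal (h1Sq u G) := by
    rw [← h.integral_density]
    exact (ofReal_integral_eq_lintegral_ofReal h.integrable_density
      (Eventually.of_forall (density_nonneg u G))).symm
  -- Otherwise integration over all centres would give κ n₀ ≤ ε b B, while ε is chosen so that ε b B
  -- = κ n₀ / 2.
  have hex : ∃ a : EuclideanSpace ℝ (Fin d), ENNReal.ofReal ε * ∫⁻ z : Space d, g₂ (z.1 - a) * f₂ z
      < ∫⁻ z : Space d, g₁ (z.1 - a) * f₁ z := by
    by_contra hno
    push Not at hno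
    have h1 := lintegral_mono (μ := (volume : Measure (EuclideanSpace ℝ (Fin d)))) hno
    rw [lintegral_const_mul' _ _ ENNReal.ofReal_ne_top, lintegral_average hg₁m hf₁m,
      lintegral_average hg₂m hf₂m, hI1, hI2, hF1, hF2,
      ← ENNReal.ofReal_mul hκ0.le, ← ENNReal.ofReal_mul hb0.le, ← ENNReal.ofReal_mul hε0.le,
      ENNReal.ofReal_le_ofReal_iff (mul_nonneg hε0.le (mul_nonneg hb0.le (h1Sq_nonneg u G)))] at h1
    have h2 : ε * (b * h1Sq u G) ≤ ε * (b * B) := by gcongr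
    have h3 : ε * (b * B) = κ * n₀ / 2 := by
      rw [hε]
      field_simp
    have h4 : κ * n₀ ≤ κ * powInt (α + 2) u := by gcongr
    have h5 : 0 < κ * n₀ := by positivity
    linarith
  obtain ⟨a, hlt⟩ := hex
  refine ⟨a, ?_⟩
  obtain ⟨hE, hle⟩ := hcut a u G h
  set P := powInt (α + 2) (fun z => cutoffAt a z • u z) with hP
  set s := h1Sq (fun z => cutoffAt a z • u z) (cutoffGrad a u G) with hs
  have e1 : ∫⁻ z : Space d, g₁ (z.1 - a) * f₁ z = ENNReal.ofReal P := by
    rw [hP, powInt, ofReal_integral_eq_lintegral_ofReal (ha.integrable_rpow hE)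
      (Eventually.of_forall fun z => by positivity)]
    congr 1 with z
    rw [hg₁, hf₁, ← ENNReal.ofReal_mul (Real.rpow_nonneg cutoffX.nonneg _), norm_smul,
      ← Real.mul_rpow cutoffX.nonneg (norm_nonneg _), cutoffAt,
      Real.norm_of_nonneg cutoffX.nonneg]
  have hms : MeasurableSet {z : Space d | ‖z.1 - a‖ ≤ 2} :=
    measurableSet_le (by fun_prop) measurable_const
  have e2 : ∫⁻ z : Space d, g₂ (z.1 - a) * f₂ z
      = ENNReal.ofReal (∫ z in {z : Space d | ‖z.1 - a‖ ≤ 2}, density u G z) := by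
    rw [ofReal_integral_eq_lintegral_ofReal h.integrable_density.integrableOn
      (Eventually.of_forall (density_nonneg u G)), ← lintegral_indicator hms]
    congr 1 with z
    by_cases hz : ‖z.1 - a‖ ≤ 2
    · rw [Set.indicator_of_mem (show z ∈ {z : Space d | ‖z.1 - a‖ ≤ 2} from hz), hg₂,
        Set.indicator_of_mem (by rwa [mem_closedBall_zero_iff])]
      simp [hf₂]
    · rw [Set.indicator_of_notMem (show z ∉ {z : Space d | ‖z.1 - a‖ ≤ 2} from hz), hg₂,
        Set.indicator_of_notMem (by rwa [mem_closedBall_zero_iff])]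
      simp
  have hPnn : 0 ≤ P := powInt_nonneg _ _
  rw [e1, e2, ← ENNReal.ofReal_mul hε0.le, ENNReal.ofReal_lt_ofReal_iff_of_nonneg
    (mul_nonneg hε0.le (integral_nonneg (density_nonneg u G)))] at hlt
  -- At this centre the local nonlinear term P is at least linear in the local H¹ norm s, whereas
  -- Sobolev makes it at most C s^(1+α/2). Hence s, and with it P, is bounded below.
  have h1 : ε / K * s < P := by
    refine lt_of_le_of_lt ?_ hlt
    rw [div_mul_eq_mul_div, div_le_iff₀ hK]
    have := mul_le_mul_of_nonneg_left hle hε0.le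
    linarith
  have h2 : P ≤ C * s ^ ((α + 2) / 2) := hS _ _ hE
  have hs0 : 0 < s := by
    refine lt_of_le_of_ne (h1Sq_nonneg _ _) fun h0 => ?_
    rw [← h0, Real.zero_rpow (by linarith), mul_zero] at h2
    rw [← h0, mul_zero] at h1
    linarith
  have h3 : ε / K / C < s ^ (α / 2) := by
    have e : s ^ ((α + 2) / 2) = s ^ (α / 2) * s := by
      rw [← Real.rpow_add_one hs0.ne']
      ring_nf
    rw [e] at h2
    have h4 : ε / K * s < C * s ^ (α / 2) * s := by linarith
    have h5 := lt_of_mul_lt_mul_right h4 hs0.le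
    rw [div_lt_iff₀ hC]
    linarith
  have h4 : (ε / K / C) ^ (2 / α) < s := by
    have := Real.rpow_lt_rpow (by positivity) h3 (show 0 < 2 / α by positivity)
    rw [← Real.rpow_mul hs0.le] at this
    have e : α / 2 * (2 / α) = 1 := by field_simp
    rwa [e, Real.rpow_one] at this
  have h5 : ε / K * (ε / K / C) ^ (2 / α) ≤ ε / K * s := by gcongr
  exact (h5.trans h1.le).trans (powInt_cutoffAt_le ha h a)

end PHNLS

end

noncomputable section

namespace PHNLS

open Filter Topology ENNReal

variable {d : ℕ} {α ω : ℝ}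

/-! ### Splitting of the nonlinear term along weakly convergent sequences -/

/-- The cylinder `{|x| ≤ R}`. -/
def cylinder (R : ℝ) : Set (Space d) := {z | ‖z.1‖ ≤ R}

theorem measurableSet_cylinder (R : ℝ) : MeasurableSet (cylinder R : Set (Space d)) :=
  measurableSet_le (by fun_prop) measurable_const

/-- In the energy space, weakly null sequences tend to zero in `L^{α+2}` on cylinders. -/
theorem tendsto_setIntegral_rpow (ha : Admissible d α ω) {a : ℕ → Space d → ℂ}
    {G : ℕ → Option (Fin d) → Space d → ℂ} (h : ∀ n, EnergyFun (a n) (G n)) {B : ℝ}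
    (hB : ∀ n, energySq (a n) (G n) ≤ B) (h0 : WeakTendsto a 0) (R : ℝ) :
    Tendsto (fun n => ∫ z in cylinder R, ‖a n z‖ ^ (α + 2)) atTop (𝓝 0) := by
  have hB0 : 0 ≤ B := (energySq_nonneg _ _).trans (hB 0)
  have hα := ha.α_pos
  obtain ⟨C, hC, hS⟩ := exists_sobolev ha.two_le
  set q := sobolevExp d with hq
  rw [Metric.tendsto_atTop]
  intro ε hε
  set E : ℝ := C * B ^ (q / 2) + 1 with hE
  have hE0 : 0 < E := by positivity
  obtain ⟨D, hD, hD'⟩ := exists_rpow_le (a := 2) (p := α + 2) (b := q) two_pos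
    (by linarith) (lt_sobolevExp ha.two_le ha.upper) (ε := ε / (3 * E)) (by positivity)
  -- For |y| > r the weight bounds the mass by B/r². The rest of the cylinder lies in the sup-norm
  -- ball of radius r, since R ≤ r, where local compactness applies.
  obtain ⟨r, hr0, hrR, hr⟩ : ∃ r : ℝ, 0 < r ∧ R ≤ r ∧ D * (B / r ^ 2) < ε / 3 := by
    have ht : Tendsto (fun r : ℝ => D * (B / r ^ 2)) atTop (𝓝 (D * 0)) :=
      (Tendsto.div_atTop tendsto_const_nhds (tendsto_pow_atTop two_ne_zero)).const_mul D
    rw [mul_zero] at ht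
    obtain ⟨r, h1, h2, h3⟩ := ((ht.eventually_lt_const (show 0 < ε / 3 by positivity)).and
      ((eventually_gt_atTop 0).and (eventually_ge_atTop R))).exists
    exact ⟨r, h2, h3, h1⟩
  have hloc := tendsto_setIntegral_normSq h
    (fun n => (h1Sq_le_energySq _ _).trans (hB n)) h0 r
  have hloc' := hloc.const_mul D
  rw [mul_zero] at hloc'
  obtain ⟨N, hN⟩ := (hloc'.eventually_lt_const
    (show 0 < ε / 3 by positivity)).exists_forall_of_atTop
  refine ⟨N, fun n hn => ?_⟩
  have hnn : 0 ≤ ∫ z in cylinder R, ‖a n z‖ ^ (α + 2) := integral_nonneg fun z => by positivity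
  rw [Real.dist_eq, sub_zero, abs_of_nonneg hnn]
  obtain ⟨hi, hb⟩ := hS _ _ (h n)
  have hball : MeasurableSet (Metric.closedBall (0 : Space d) r) :=
    Metric.isClosed_closedBall.measurableSet
  have i1 := hi.const_mul (ε / (3 * E))
  have i2 := ((integrable_normSq (h n).memLp).indicator hball).const_mul D
  have i3 := (integrable_normSq (h n).weight_memLp).const_mul (D / r ^ 2)
  have key : ∫ z in cylinder R, ‖a n z‖ ^ (α + 2)
      ≤ ∫ z, (ε / (3 * E) * ‖a n z‖ ^ q
        + D * (Metric.closedBall (0 : Space d) r).indicator (fun z => ‖a n z‖ ^ 2) z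
        + D / r ^ 2 * ‖z.2 • a n z‖ ^ 2) := by
    rw [← integral_indicator (measurableSet_cylinder R)]
    refine integral_mono ((ha.integrable_rpow (h n)).indicator (measurableSet_cylinder R))
      ((i1.add i2).add i3) fun z => ?_
    by_cases hz : z ∈ (cylinder R : Set (Space d))
    · rw [Set.indicator_of_mem hz]
      have h1 := hD' ‖a n z‖ (norm_nonneg _)
      rw [Real.rpow_two] at h1
      refine h1.trans ?_
      rw [add_assoc]
      refine add_le_add le_rfl ?_
      by_cases hz2 : |z.2| ≤ r
      · have hmem : z ∈ Metric.closedBall (0 : Space d) r := by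
          rw [mem_closedBall_zero_iff, Prod.norm_def]
          exact max_le (le_trans hz hrR) hz2
        rw [Set.indicator_of_mem hmem]
        have : 0 ≤ D / r ^ 2 * ‖z.2 • a n z‖ ^ 2 := by positivity
        linarith
      · push Not at hz2
        have h2 : 0 ≤ D * (Metric.closedBall (0 : Space d) r).indicator (fun z => ‖a n z‖ ^ 2) z :=
          mul_nonneg hD.le (Set.indicator_nonneg (fun z _ => by positivity) z)
        have h3 : D * ‖a n z‖ ^ 2 ≤ D / r ^ 2 * ‖z.2 • a n z‖ ^ 2 := by
          rw [norm_smul, mul_pow, div_mul_eq_mul_div, le_div_iff₀ (by positivity)]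
          have : r ^ 2 ≤ ‖z.2‖ ^ 2 := by
            rw [Real.norm_eq_abs]
            gcongr
          have h4 : 0 ≤ D * ‖a n z‖ ^ 2 := by positivity
          nlinarith
        linarith
    · rw [Set.indicator_of_notMem hz]
      have h2 : 0 ≤ (Metric.closedBall (0 : Space d) r).indicator (fun z => ‖a n z‖ ^ 2) z :=
        Set.indicator_nonneg (fun z _ => by positivity) z
      positivity
  have i12 : Integrable fun z => ε / (3 * E) * ‖a n z‖ ^ q
      + D * (Metric.closedBall (0 : Space d) r).indicator (fun z => ‖a n z‖ ^ 2) z := i1.add i2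
  rw [integral_add i12 i3, integral_add i1 i2, integral_const_mul, integral_const_mul,
    integral_const_mul, integral_indicator hball] at key
  have h1 : ε / (3 * E) * ∫ z, ‖a n z‖ ^ q ≤ ε / 3 := by
    have h2 : ∫ z, ‖a n z‖ ^ q ≤ E := by
      have h3 : h1Sq (a n) (G n) ^ (q / 2) ≤ B ^ (q / 2) :=
        Real.rpow_le_rpow (h1Sq_nonneg _ _) ((h1Sq_le_energySq _ _).trans (hB n))
          (by linarith [two_lt_sobolevExp ha.two_le])
      have h4 := mul_le_mul_of_nonneg_left h3 hC.le
      have h5 : powInt q (a n) = ∫ z, ‖a n z‖ ^ q := rfl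
      linarith
    calc ε / (3 * E) * ∫ z, ‖a n z‖ ^ q ≤ ε / (3 * E) * E := by gcongr
      _ = ε / 3 := by field_simp
  have h2 : D / r ^ 2 * ∫ z : Space d, ‖z.2 • a n z‖ ^ 2 ≤ D * (B / r ^ 2) := by
    have h3 := (normSq_weight_le_energySq (a n) (G n)).trans (hB n)
    unfold normSq at h3
    calc D / r ^ 2 * ∫ z : Space d, ‖z.2 • a n z‖ ^ 2 ≤ D / r ^ 2 * B := by gcongr
      _ = _ := by ring
  have h3 := hN n hn
  linarith

theorem exists_add_rpow_le {p : ℝ} (hp : 0 < p) {ε : ℝ} (hε : 0 < ε) :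
    ∃ C : ℝ, 0 < C ∧ ∀ x y : ℝ, 0 ≤ x → 0 ≤ y → (x + y) ^ p ≤ (1 + ε) * x ^ p + C * y ^ p := by
  obtain ⟨δ, hδ, hδ1⟩ : ∃ δ : ℝ, 0 < δ ∧ (1 + δ) ^ p ≤ 1 + ε := by
    have hc : Tendsto (fun δ : ℝ => (1 + δ) ^ p) (𝓝[>] 0) (𝓝 ((1 + 0) ^ p)) := by
      refine Tendsto.mono_left ?_ nhdsWithin_le_nhds
      exact ((continuous_const.add continuous_id).tendsto 0).rpow_const (Or.inr hp.le)
    rw [add_zero, Real.one_rpow] at hc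
    obtain ⟨δ, h1, h2⟩ := ((hc.eventually_lt_const (show (1 : ℝ) < 1 + ε by linarith)).and
      self_mem_nhdsWithin).exists
    exact ⟨δ, h2, h1.le⟩
  refine ⟨(1 / δ + 1) ^ p, by positivity, fun x y hx hy => ?_⟩
  rcases le_total y (δ * x) with h | h
  · have h1 : (x + y) ^ p ≤ ((1 + δ) * x) ^ p :=
      Real.rpow_le_rpow (by positivity) (by linarith) hp.le
    rw [Real.mul_rpow (by positivity) hx] at h1
    have h2 : (1 + δ) ^ p * x ^ p ≤ (1 + ε) * x ^ p := by gcongr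
    have h3 : 0 ≤ (1 / δ + 1) ^ p * y ^ p := by positivity
    linarith
  · have h1 : (x + y) ^ p ≤ ((1 / δ + 1) * y) ^ p := by
      refine Real.rpow_le_rpow (by positivity) ?_ hp.le
      have : x ≤ 1 / δ * y := by
        rw [one_div, inv_mul_eq_div, le_div_iff₀ hδ]
        linarith
      linarith
    rw [Real.mul_rpow (by positivity) hy] at h1
    have h3 : 0 ≤ (1 + ε) * x ^ p := by positivity
    linarith

/-- The pointwise Brezis–Lieb inequality. It is asymmetric, and `tendsto_powInt_add_sub` uses it
with both assignments of the roles. -/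
theorem exists_abs_norm_add_rpow_sub_le {p : ℝ} (hp : 0 < p) {ε : ℝ} (hε : 0 < ε) :
    ∃ C : ℝ, 0 < C ∧ ∀ a b : ℂ,
      |‖a + b‖ ^ p - ‖a‖ ^ p - ‖b‖ ^ p| ≤ ε * ‖a‖ ^ p + C * ‖b‖ ^ p := by
  -- This makes δ(1+δ) ≤ ε, which is needed when the term |a + b|^p is estimated once more by |a|^p
  -- and |b|^p.
  set δ : ℝ := min 1 (ε / 2) with hδ
  have hδ0 : 0 < δ := by positivity
  have hδ1 : δ ≤ 1 := min_le_left _ _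
  have hδ2 : δ ≤ ε / 2 := min_le_right _ _
  obtain ⟨C, hC, h⟩ := exists_add_rpow_le hp hδ0
  refine ⟨2 * C + 1, by positivity, fun a b => ?_⟩
  have ha := Real.rpow_nonneg (norm_nonneg a) p
  have hb := Real.rpow_nonneg (norm_nonneg b) p
  have hab := Real.rpow_nonneg (norm_nonneg (a + b)) p
  have h1 : ‖a + b‖ ^ p ≤ (1 + δ) * ‖a‖ ^ p + C * ‖b‖ ^ p :=
    (Real.rpow_le_rpow (norm_nonneg _) (norm_add_le a b) hp.le).trans
      (h _ _ (norm_nonneg _) (norm_nonneg _))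
  have h2 : ‖a‖ ^ p ≤ (1 + δ) * ‖a + b‖ ^ p + C * ‖b‖ ^ p := by
    refine (Real.rpow_le_rpow (norm_nonneg _) ?_ hp.le).trans
      (h _ _ (norm_nonneg _) (norm_nonneg _))
    calc ‖a‖ = ‖(a + b) - b‖ := by simp
      _ ≤ _ := norm_sub_le _ _
  have h3 : δ * ‖a + b‖ ^ p ≤ δ * ((1 + δ) * ‖a‖ ^ p + C * ‖b‖ ^ p) := by gcongr
  have h4 : δ * (1 + δ) * ‖a‖ ^ p ≤ ε * ‖a‖ ^ p := by
    refine mul_le_mul_of_nonneg_right ?_ ha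
    nlinarith
  have h5 : δ * (C * ‖b‖ ^ p) ≤ C * ‖b‖ ^ p := mul_le_of_le_one_left (by positivity) hδ1
  have h6 : δ * ‖a‖ ^ p ≤ ε * ‖a‖ ^ p := mul_le_mul_of_nonneg_right (by linarith) ha
  have h7 : 0 ≤ C * ‖b‖ ^ p := by positivity
  rw [abs_le]
  constructor <;> nlinarith

theorem exists_setIntegral_compl_cylinder_lt {f : Space d → ℝ} (hf : Integrable f) {ε : ℝ}
    (hε : 0 < ε) : ∃ R : ℝ, ∫ z in (cylinder R)ᶜ, f z < ε := by
  have h : Tendsto (fun n : ℕ => ∫ z in (cylinder (n : ℝ) : Set (Space d))ᶜ, f z) atTop (𝓝 0) := by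
    have := tendsto_integral_of_dominated_convergence (μ := (volume : Measure (Space d)))
      (F := fun (n : ℕ) z => (cylinder (n : ℝ) : Set (Space d))ᶜ.indicator f z)
      (f := fun _ => (0 : ℝ)) (fun z => ‖f z‖)
      (fun n => (hf.indicator (measurableSet_cylinder _).compl).1) hf.norm
      (fun n => Eventually.of_forall fun z => norm_indicator_le_norm_self _ _)
      (Eventually.of_forall fun z => by
        refine tendsto_const_nhds.congr' ?_
        filter_upwards [eventually_ge_atTop ⌈‖z.1‖⌉₊] with n hn
        rw [Set.indicator_of_notMem]
        simp only [Set.mem_compl_iff, not_not, cylinder, Set.mem_ofPred_eq]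
        exact (Nat.le_ceil _).trans (by exact_mod_cast hn))
    simp only [integral_zero] at this
    exact this.congr fun n => integral_indicator (measurableSet_cylinder _).compl
  obtain ⟨n, hn⟩ := (h.eventually_lt_const hε).exists
  exact ⟨n, hn⟩

/-- The Brezis–Lieb splitting. -/
theorem tendsto_powInt_add_sub (ha : Admissible d α ω) {a : ℕ → Space d → ℂ}
    {G : ℕ → Option (Fin d) → Space d → ℂ} (h : ∀ n, EnergyFun (a n) (G n)) {B : ℝ}
    (hB : ∀ n, energySq (a n) (G n) ≤ B) (h0 : WeakTendsto a 0) {v : Space d → ℂ}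
    {V : Option (Fin d) → Space d → ℂ} (hv : EnergyFun v V) :
    Tendsto (fun n => powInt (α + 2) (a n + v) - powInt (α + 2) (a n)) atTop
      (𝓝 (powInt (α + 2) v)) := by
  have hp : 0 < α + 2 := by linarith [ha.α_pos]
  have hB0 : 0 ≤ B := (energySq_nonneg _ _).trans (hB 0)
  obtain ⟨S, hS0, hS⟩ := exists_sobolev_subcritical ha.two_le ha.α_pos ha.upper
  set E : ℝ := S * B ^ ((α + 2) / 2) + 1 with hE
  have hE0 : 0 < E := by positivity
  have hN : ∀ n, powInt (α + 2) (a n) ≤ E := by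
    intro n
    have h3 : h1Sq (a n) (G n) ^ ((α + 2) / 2) ≤ B ^ ((α + 2) / 2) :=
      Real.rpow_le_rpow (h1Sq_nonneg _ _) ((h1Sq_le_energySq _ _).trans (hB n)) (by linarith)
    have h4 := mul_le_mul_of_nonneg_left h3 hS0.le
    have h5 := hS _ _ (h n)
    linarith
  set F : ℝ := powInt (α + 2) v + 1 with hF
  have hF0 : 0 < F := by linarith [powInt_nonneg (α + 2) v]
  rw [Metric.tendsto_atTop]
  intro ε hε
  obtain ⟨C, hC, hCb⟩ := exists_abs_norm_add_rpow_sub_le hp (ε := ε / (4 * E)) (by positivity)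
  obtain ⟨D, hD, hDb⟩ := exists_abs_norm_add_rpow_sub_le hp (ε := ε / (4 * F)) (by positivity)
  have iv := ha.integrable_rpow hv
  obtain ⟨R, hR⟩ := exists_setIntegral_compl_cylinder_lt iv (ε := ε / (4 * C)) (by positivity)
  have hloc := (tendsto_setIntegral_rpow ha h hB h0 R).const_mul D
  rw [mul_zero] at hloc
  obtain ⟨N, hNN⟩ := (hloc.eventually_lt_const
    (show 0 < ε / 4 by positivity)).exists_forall_of_atTop
  refine ⟨N, fun n hn => ?_⟩
  have ia := ha.integrable_rpow (h n)
  have iav := ha.integrable_rpow ((h n).add hv)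
  have e1 : powInt (α + 2) (a n + v) - powInt (α + 2) (a n) - powInt (α + 2) v
      = ∫ z, (‖(a n + v) z‖ ^ (α + 2) - ‖a n z‖ ^ (α + 2) - ‖v z‖ ^ (α + 2)) := by
    have i0 : Integrable fun z => ‖(a n + v) z‖ ^ (α + 2) - ‖a n z‖ ^ (α + 2) := iav.sub ia
    rw [integral_sub i0 iv, integral_sub iav ia]
    rfl
  rw [Real.dist_eq, e1]
  have hmc : MeasurableSet (cylinder R : Set (Space d)) := measurableSet_cylinder R
  have i1 := ia.const_mul (ε / (4 * E))
  have i2 := (iv.indicator hmc.compl).const_mul C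
  have i3 := iv.const_mul (ε / (4 * F))
  have i4 := (ia.indicator hmc).const_mul D
  have key : |∫ z, (‖(a n + v) z‖ ^ (α + 2) - ‖a n z‖ ^ (α + 2) - ‖v z‖ ^ (α + 2))|
      ≤ ∫ z, (ε / (4 * E) * ‖a n z‖ ^ (α + 2)
        + C * (cylinder R)ᶜ.indicator (fun z => ‖v z‖ ^ (α + 2)) z
        + ε / (4 * F) * ‖v z‖ ^ (α + 2)
        + D * (cylinder R).indicator (fun z => ‖a n z‖ ^ (α + 2)) z) := by
    refine (abs_integral_le_integral_abs).trans (integral_mono ((iav.sub ia).sub iv).abs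
      (((i1.add i2).add i3).add i4) fun z => ?_)
    have p1 : 0 ≤ ‖a n z‖ ^ (α + 2) := by positivity
    have p2 : 0 ≤ ‖v z‖ ^ (α + 2) := by positivity
    have p3 : 0 ≤ ε / (4 * E) * ‖a n z‖ ^ (α + 2) := by positivity
    have p4 : 0 ≤ ε / (4 * F) * ‖v z‖ ^ (α + 2) := by positivity
    -- Inside the cylinder the large constant goes to a_n, which tends to zero there; outside it
    -- goes to v, whose tail is small by the choice of R.
    by_cases hz : z ∈ (cylinder R : Set (Space d))
    · have hb := hDb (v z) (a n z)
      rw [Set.indicator_of_mem hz, Set.indicator_of_notMem (by simpa using hz)]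
      rw [add_comm (v z), sub_right_comm] at hb
      simp only [Pi.add_apply]
      linarith
    · have hb := hCb (a n z) (v z)
      rw [Set.indicator_of_notMem hz, Set.indicator_of_mem (by simpa using hz)]
      simp only [Pi.add_apply]
      linarith
  have i12 : Integrable fun z => ε / (4 * E) * ‖a n z‖ ^ (α + 2)
      + C * (cylinder R)ᶜ.indicator (fun z => ‖v z‖ ^ (α + 2)) z := i1.add i2
  have i123 : Integrable fun z => ε / (4 * E) * ‖a n z‖ ^ (α + 2)
      + C * (cylinder R)ᶜ.indicator (fun z => ‖v z‖ ^ (α + 2)) z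
      + ε / (4 * F) * ‖v z‖ ^ (α + 2) := i12.add i3
  rw [integral_add i123 i4, integral_add i12 i3, integral_add i1 i2,
    integral_const_mul, integral_const_mul, integral_const_mul, integral_const_mul,
    integral_indicator hmc, integral_indicator hmc.compl] at key
  have b1 : ε / (4 * E) * ∫ z, ‖a n z‖ ^ (α + 2) ≤ ε / 4 := by
    have := hN n
    unfold powInt at this
    calc ε / (4 * E) * ∫ z, ‖a n z‖ ^ (α + 2) ≤ ε / (4 * E) * E := by gcongr
      _ = ε / 4 := by field_simp
  have b2 : ε / (4 * F) * ∫ z, ‖v z‖ ^ (α + 2) ≤ ε / 4 := by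
    have : ∫ z, ‖v z‖ ^ (α + 2) ≤ F := by
      change powInt (α + 2) v ≤ F
      linarith
    calc ε / (4 * F) * ∫ z, ‖v z‖ ^ (α + 2) ≤ ε / (4 * F) * F := by gcongr
      _ = ε / 4 := by field_simp
  have b3 : C * ∫ z in (cylinder R)ᶜ, ‖v z‖ ^ (α + 2) < ε / 4 := by
    calc C * ∫ z in (cylinder R)ᶜ, ‖v z‖ ^ (α + 2) < C * (ε / (4 * C)) := by gcongr
      _ = ε / 4 := by field_simp
  have b4 := hNN n hn
  linarith

theorem WeakTendsto.sub_limit {f : ℕ → Space d → ℂ} {g : Space d → ℂ} (h : WeakTendsto f g)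
    (hf : ∀ n, MemLp (f n) 2) (hg : MemLp g 2) : WeakTendsto (fun n => f n - g) 0 := by
  intro w hw
  have h1 := (h w hw).sub_const (innerRe w g)
  rw [sub_self] at h1
  have e : innerRe w 0 = 0 := by simp [innerRe]
  rw [e]
  exact h1.congr fun n => (innerRe_sub_right (hf n) hg hw).symm

/-- The Hilbert space splitting: the difference equals 2⟨f_n, g⟩ - ‖g‖². -/
theorem WeakTendsto.normSq_sub {f : ℕ → Space d → ℂ} {g : Space d → ℂ} (h : WeakTendsto f g)
    (hf : ∀ n, MemLp (f n) 2) (hg : MemLp g 2) :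
    Tendsto (fun n => normSq (f n) - normSq (f n - g)) atTop (𝓝 (normSq g)) := by
  have h1 := (h g hg).const_mul 2
  rw [innerRe_self] at h1
  have h2 := h1.sub_const (normSq g)
  have e : 2 * normSq g - normSq g = normSq g := by ring
  rw [e] at h2
  refine h2.congr fun n => ?_
  rw [PHNLS.normSq_sub (hf n) hg, innerRe_comm (f n)]
  ring

/-- Existence of a minimiser of the action on the constraint `Q = 0`. -/
theorem Admissible.exists_minimizer (ha : Admissible d α ω) {m : ℝ}
    (hm : ∀ (u : Space d → ℂ) (G : Option (Fin d) → Space d → ℂ), EnergyFun u G →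
      0 < normSq u → virialFun α u G = 0 → m ≤ actionFun α ω u G)
    {φ : ℕ → Space d → ℂ} {Φ : ℕ → Option (Fin d) → Space d → ℂ}
    (hφ : ∀ n, EnergyFun (φ n) (Φ n)) (hφ0 : ∀ n, 0 < normSq (φ n))
    (hQ : ∀ n, virialFun α (φ n) (Φ n) = 0)
    (hlim : Tendsto (fun n => actionFun α ω (φ n) (Φ n)) atTop (𝓝 m)) :
    ∃ (u : Space d → ℂ) (G : Option (Fin d) → Space d → ℂ), EnergyFun u G ∧ 0 < normSq u ∧
      virialFun α u G = 0 ∧ actionFun α ω u G = m := by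
  have hc0 := ha.quad_coeff_pos
  have hω := ha.pos
  -- On Q = 0 the action is the coercive form, so the convergent actions bound the sequence in the
  -- energy norm.
  have hI : ∀ n, quadFun α ω (φ n) (Φ n) = actionFun α ω (φ n) (Φ n) := by
    intro n
    rw [ha.quadFun_eq, hQ n]
    ring
  obtain ⟨M, hM⟩ := hlim.bddAbove_range
  have hM' : ∀ n, quadFun α ω (φ n) (Φ n) ≤ M := fun n => by
    rw [hI]
    exact hM ⟨n, rfl⟩
  have hM0 : 0 ≤ M := (ha.quadFun_nonneg _ _).trans (hM' 0)
  have hH : ∀ n, transverse ω (φ n) (Φ n) ≤ 2 * M + 1 := by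
    intro n
    have h1 := hM' n
    have h2 := mul_nonneg hc0.le (gradX_nonneg (Φ n))
    unfold quadFun at h1
    linarith
  have hA : ∀ n, gradX (Φ n) ≤ M / (1 / 2 - 2 / (α * d)) := by
    intro n
    have h1 := hM' n
    have h2 := transverse_nonneg hω (φ n) (Φ n)
    unfold quadFun at h1
    rw [le_div_iff₀ hc0]
    linarith
  set B : ℝ := M / (1 / 2 - 2 / (α * d)) + (1 + ω⁻¹) * (2 * M + 1) + 1 with hBdef
  have hB0 : 0 < B := by positivity
  have hen : ∀ n, energySq (φ n) (Φ n) ≤ B := by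
    intro n
    have h1 := energySq_le hω (φ n) (Φ n)
    have h2 : (1 + ω⁻¹) * transverse ω (φ n) (Φ n) ≤ (1 + ω⁻¹) * (2 * M + 1) := by
      have := hH n
      gcongr
    linarith [hA n]
  obtain ⟨δ, hδ, hδ'⟩ := ha.exists_gradX_lower (2 * M + 1) (by positivity)
  have hc := ha.coeff_pos
  obtain ⟨c, hcpos, hshift⟩ := exists_shift_lower ha hB0
    (show 0 < δ / (α * d / (2 * (α + 2))) by positivity)
  -- Q = 0 converts the lower bound of the x-gradient into one of the nonlinear term, which excludes
  -- vanishing.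
  have hNl : ∀ n, δ / (α * d / (2 * (α + 2))) ≤ powInt (α + 2) (φ n) := by
    intro n
    have h1 := hδ' _ _ (hφ n) (hφ0 n) (hH n) (hQ n).le
    have h2 := hQ n
    unfold virialFun at h2
    rw [div_le_iff₀ hc]
    linarith
  choose a hshift' using fun n => hshift _ _ (hφ n)
    ((h1Sq_le_energySq _ _).trans (hen n)) (hNl n)
  -- translate and extract a weak limit
  set ψ : ℕ → Space d → ℂ := fun n => shift (a n) (φ n) with hψ
  set Ψ : ℕ → Option (Fin d) → Space d → ℂ := fun n k => shift (a n) (Φ n k) with hΨ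
  have hψE : ∀ n, EnergyFun (ψ n) (Ψ n) := fun n => (hφ n).shift (a n)
  have hψI : ∀ n, quadFun α ω (ψ n) (Ψ n) = actionFun α ω (φ n) (Φ n) := fun n => by
    rw [← hI, quadFun, quadFun, gradX_shift, transverse_shift]
  have hψQ : ∀ n, virialFun α (ψ n) (Ψ n) = 0 := fun n => by
    rw [← hQ n, virialFun, virialFun, gradX_shift, powInt_shift]
  have hψB : ∀ n, energySq (ψ n) (Ψ n) ≤ B := by
    intro n
    have h1 := energySq_le hω (ψ n) (Ψ n)
    rw [gradX_shift, transverse_shift] at h1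
    have h2 : (1 + ω⁻¹) * transverse ω (φ n) (Φ n) ≤ (1 + ω⁻¹) * (2 * M + 1) := by
      have := hH n
      gcongr
    linarith [hA n]
  obtain ⟨v, V, ns, hns, hvE, w0, wk, wy⟩ := exists_energyFun_subseq hψE hψB
  set b : ℕ → Space d → ℂ := fun n => ψ (ns n) - v with hb
  set β : ℕ → Option (Fin d) → Space d → ℂ := fun n => Ψ (ns n) - V with hβ
  have hbE : ∀ n, EnergyFun (b n) (β n) := fun n => (hψE _).sub hvE
  have hb0 : WeakTendsto b 0 := w0.sub_limit (fun n => (hψE _).memLp) hvE.memLp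
  have hbB : ∀ n, energySq (b n) (β n) ≤ 2 * B + 2 * energySq (-v) (-V) := by
    intro n
    have h1 := energySq_add_le (hψE (ns n)) hvE.neg
    rw [← sub_eq_add_neg, ← sub_eq_add_neg] at h1
    have h2 := hψB (ns n)
    change energySq (ψ (ns n) - v) (Ψ (ns n) - V) ≤ _
    linarith
  -- the splittings
  have sA : Tendsto (fun n => gradX (Ψ (ns n)) - gradX (β n)) atTop (𝓝 (gradX V)) := by
    have h1 := tendsto_finsetSum Finset.univ fun (i : Fin d) _ =>
      (wk (some i)).normSq_sub (fun n => (hψE _).grad_memLp _) (hvE.grad_memLp _)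
    refine h1.congr fun n => ?_
    rw [Finset.sum_sub_distrib]
    rfl
  have sH : Tendsto (fun n => transverse ω (ψ (ns n)) (Ψ (ns n)) - transverse ω (b n) (β n))
      atTop (𝓝 (transverse ω v V)) := by
    have h1 := (wk none).normSq_sub (fun n => (hψE _).grad_memLp _) (hvE.grad_memLp _)
    have h2 := wy.normSq_sub (fun n => (hψE _).weight_memLp) hvE.weight_memLp
    have h3 := (w0.normSq_sub (fun n => (hψE _).memLp) hvE.memLp).const_mul ω
    refine ((h1.add h2).add h3).congr fun n => ?_
    have e : (fun z : Space d => z.2 • b n z)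
        = (fun z => z.2 • ψ (ns n) z) - fun z => z.2 • v z := by
      ext z
      simp only [hb, Pi.sub_apply, smul_sub]
    have e2 : β n none = Ψ (ns n) none - V none := rfl
    have e3 : b n = ψ (ns n) - v := rfl
    unfold transverse
    rw [e, e2, e3]
    ring
  have sN : Tendsto (fun n => powInt (α + 2) (ψ (ns n)) - powInt (α + 2) (b n)) atTop
      (𝓝 (powInt (α + 2) v)) := by
    refine (tendsto_powInt_add_sub ha hbE hbB hb0 hvE).congr fun n => ?_
    simp [hb]
  have sI : Tendsto (fun n => quadFun α ω (b n) (β n)) atTop (𝓝 (m - quadFun α ω v V)) := by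
    have h1 : Tendsto (fun n => quadFun α ω (ψ (ns n)) (Ψ (ns n))) atTop (𝓝 m) :=
      (hlim.comp hns.tendsto_atTop).congr fun n => (hψI (ns n)).symm
    have h2 := h1.sub ((sA.const_mul (1 / 2 - 2 / (α * d))).add (sH.const_mul (1 / 2)))
    refine h2.congr fun n => ?_
    unfold quadFun
    ring
  have sQ : Tendsto (fun n => virialFun α (b n) (β n)) atTop (𝓝 (- virialFun α v V)) := by
    have h2 := (sA.sub (sN.const_mul (α * d / (2 * (α + 2))))).neg
    refine h2.congr fun n => ?_
    have := hψQ (ns n)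
    unfold virialFun at this ⊢
    linarith
  -- the limit does not vanish
  have hv0 : 0 < normSq v := by
    refine lt_of_le_of_ne (normSq_nonneg v) fun h0 => ?_
    have hvz := eq_zero_ae_of_normSq_eq_zero hvE.memLp h0.symm
    have hw : WeakTendsto (fun n => ψ (ns n)) 0 := by
      intro g hg
      have e : innerRe g 0 = innerRe g v :=
        integral_congr_ae (hvz.mono fun z hz => by simp only [hz])
      rw [e]
      exact w0 g hg
    have h1 := tendsto_setIntegral_rpow ha (fun n => hψE (ns n)) (fun n => hψB (ns n)) hw 2
    have h2 := ge_of_tendsto' h1 fun n => hshift' (ns n)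
    linarith
  have hvI : quadFun α ω v V ≤ m := by
    have := ge_of_tendsto' sI fun n => ha.quadFun_nonneg _ _
    linarith
  -- If Q(v) > 0, the remainders eventually have Q < 0, so their quadratic form is at least m. The
  -- splitting then leaves at most 0 for the form of v, although v ≠ 0.
  have hvQ : virialFun α v V ≤ 0 := by
    by_contra hpos
    push Not at hpos
    have h1 : ∀ᶠ n in atTop, virialFun α (b n) (β n) < 0 :=
      sQ.eventually_lt_const (by linarith)
    have h2 : ∀ᶠ n in atTop, m ≤ quadFun α ω (b n) (β n) := by
      filter_upwards [h1] with n hn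
      have hbn : 0 < normSq (b n) := by
        refine lt_of_le_of_ne (normSq_nonneg _) fun h0 => ?_
        have h3 := (hbE n).powInt_eq_zero (p := α + 2) (by linarith [ha.α_pos]) h0.symm
        unfold virialFun at hn
        rw [h3] at hn
        linarith [gradX_nonneg (β n)]
      obtain ⟨l, -, -, h4, h5⟩ := ha.le_quadFun hm (hbE n) hbn hn.le
      exact h4.trans h5
    have h3 := ge_of_tendsto sI h2
    have h4 := ha.quadFun_pos V hv0
    linarith
  -- The limit may still have Q < 0. Its dilate on the constraint has action at least m and at most
  -- the quadratic form of v, hence equal to m.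
  obtain ⟨l, hl, h1, h2, h3⟩ := ha.le_quadFun hm hvE hv0 hvQ
  exact ⟨_, _, hvE.dilate hl, (normSq_dilate hl v).symm ▸ hv0, h1,
    le_antisymm (h3.trans hvI) h2⟩

end PHNLS

end

noncomputable section

namespace PHNLS

open Filter Topology ENNReal

variable {d : ℕ} {α ω : ℝ}

/-! ### The first variation of the power term -/

/-- Bernoulli's inequality for a/b with exponent α + 1. The extra factor b makes the bound valid
also for α < 1, where t^α is not Lipschitz at 0. -/
theorem rpow_add_one_sub_le (hα : 0 < α) {a b : ℝ} (ha : 0 ≤ a) (hab : a ≤ b) :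
    (b ^ α - a ^ α) * b ≤ (α + 1) * b ^ α * (b - a) := by
  rcases ha.eq_or_lt with rfl | ha0
  · rw [Real.zero_rpow hα.ne']
    have : 0 ≤ b ^ α * b := by positivity
    nlinarith
  have hb : 0 < b := ha0.trans_le hab
  have h1 := one_add_mul_self_le_rpow_one_add (s := a / b - 1) (p := α + 1)
    (by linarith [div_nonneg ha hb.le]) (by linarith)
  rw [show 1 + (a / b - 1) = a / b by ring, Real.div_rpow ha hb.le, le_div_iff₀ (by positivity),
    Real.rpow_add_one ha0.ne', Real.rpow_add_one hb.ne'] at h1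
  have h2 : (1 + (α + 1) * (a / b - 1)) * (b ^ α * b)
      = b ^ α * b - (α + 1) * b ^ α * (b - a) := by
    field_simp
    ring
  rw [h2] at h1
  have h3 : a ^ α * a ≤ a ^ α * b := by gcongr
  nlinarith

theorem abs_rpow_sub_mul_le (hα : 0 < α) {r s t : ℝ} (hr : 0 ≤ r) (hs : 0 ≤ s)
    (ht : t ∈ Set.uIcc r s) :
    |(t ^ α - r ^ α) * t| ≤ (α + 1) * (r ^ α + s ^ α) * |s - r| := by
  have p1 : 0 ≤ r ^ α := by positivity
  have p2 : 0 ≤ s ^ α := by positivity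
  rcases le_total r s with h | h
  · rw [Set.uIcc_of_le h] at ht
    obtain ⟨h1, h2⟩ := ht
    have h3 := rpow_add_one_sub_le hα hr h1
    have ht0 : 0 ≤ t := hr.trans h1
    have h4 : r ^ α ≤ t ^ α := by gcongr
    have h5 : t ^ α ≤ s ^ α := by gcongr
    rw [abs_of_nonneg (mul_nonneg (by linarith) (by linarith)), abs_of_nonneg (by linarith)]
    refine h3.trans ?_
    gcongr
    · linarith
  · rw [Set.uIcc_of_ge h] at ht
    obtain ⟨h1, h2⟩ := ht
    have ht0 : 0 ≤ t := hs.trans h1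
    have h3 := rpow_add_one_sub_le hα ht0 h2
    have h4 : t ^ α ≤ r ^ α := by gcongr
    rw [abs_of_nonpos (mul_nonpos_of_nonpos_of_nonneg (by linarith) ht0),
      abs_of_nonpos (by linarith)]
    calc -((t ^ α - r ^ α) * t) ≤ (r ^ α - t ^ α) * r := by nlinarith
      _ ≤ (α + 1) * r ^ α * (r - t) := h3
      _ ≤ (α + 1) * (r ^ α + s ^ α) * -(s - r) := by
        gcongr
        · linarith
        · linarith

/-- As a function of s²/2 the power s^(α+2)/(α+2) has the increasing derivative s^α, so it is convex
and lies above its tangents. The mean value theorem in s writes the remainder as (t^α - r^α) t (s -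
r) and gives the quadratic bound. -/
theorem rpow_taylor (hα : 0 < α) {r s : ℝ} (hr : 0 ≤ r) (hs : 0 ≤ s) :
    0 ≤ s ^ (α + 2) / (α + 2) - r ^ (α + 2) / (α + 2) - r ^ α * ((s ^ 2 - r ^ 2) / 2) ∧
    s ^ (α + 2) / (α + 2) - r ^ (α + 2) / (α + 2) - r ^ α * ((s ^ 2 - r ^ 2) / 2)
      ≤ (α + 1) * (r ^ α + s ^ α) * (s - r) ^ 2 := by
  set f : ℝ → ℝ := fun t => t ^ (α + 2) / (α + 2) - r ^ α * (t ^ 2 / 2) with hf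
  have hd : ∀ t, 0 ≤ t → HasDerivAt f ((t ^ α - r ^ α) * t) t := by
    intro t ht
    have h1 := (Real.hasDerivAt_rpow_const (x := t) (p := α + 2)
      (Or.inr (by linarith))).div_const (α + 2)
    have h2 := (((hasDerivAt_pow 2 t).div_const 2).const_mul (r ^ α))
    have h3 := h1.sub h2
    refine h3.congr_deriv ?_
    have : t ^ (α + 2 - 1) = t ^ α * t := by
      rw [show α + 2 - 1 = α + 1 by ring, Real.rpow_add_one' ht (by linarith)]
    rw [this]
    have : α + 2 ≠ 0 := by linarith
    field_simp
    simp
    ring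
  have e : s ^ (α + 2) / (α + 2) - r ^ (α + 2) / (α + 2) - r ^ α * ((s ^ 2 - r ^ 2) / 2)
      = f s - f r := by
    simp only [hf]
    ring
  have key : ∃ t ∈ Set.uIcc r s, f s - f r = (t ^ α - r ^ α) * t * (s - r) := by
    rcases lt_trichotomy r s with h | h | h
    · obtain ⟨t, ht, h1⟩ := exists_hasDerivAt_eq_slope f (fun t => (t ^ α - r ^ α) * t) h
        (fun t ht => (hd t (hr.trans ht.1)).continuousAt.continuousWithinAt)
        (fun t ht => hd t (hr.trans ht.1.le))
      refine ⟨t, Set.Icc_subset_uIcc (Set.Ioo_subset_Icc_self ht), ?_⟩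
      rw [h1, div_mul_cancel₀ _ (by linarith)]
    · exact ⟨r, Set.left_mem_uIcc, by simp [h]⟩
    · obtain ⟨t, ht, h1⟩ := exists_hasDerivAt_eq_slope f (fun t => (t ^ α - r ^ α) * t) h
        (fun t ht => (hd t (hs.trans ht.1)).continuousAt.continuousWithinAt)
        (fun t ht => hd t (hs.trans ht.1.le))
      refine ⟨t, Set.Icc_subset_uIcc' (Set.Ioo_subset_Icc_self ht), ?_⟩
      rw [h1]
      have : r - s ≠ 0 := by linarith
      field_simp
      ring
  obtain ⟨t, ht, h1⟩ := key
  rw [e, h1]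
  constructor
  · rcases le_total r s with h | h
    · rw [Set.uIcc_of_le h] at ht
      have h4 : r ^ α ≤ t ^ α := Real.rpow_le_rpow hr ht.1 hα.le
      exact mul_nonneg (mul_nonneg (by linarith) (hr.trans ht.1)) (by linarith)
    · rw [Set.uIcc_of_ge h] at ht
      have h4 : t ^ α ≤ r ^ α := Real.rpow_le_rpow (hs.trans ht.1) ht.2 hα.le
      exact mul_nonneg_of_nonpos_of_nonpos (mul_nonpos_of_nonpos_of_nonneg (by linarith) (hs.trans ht.1))
        (by linarith)
  · refine (le_abs_self _).trans ?_
    rw [abs_mul, ← sq_abs (s - r), sq, ← mul_assoc]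
    exact mul_le_mul_of_nonneg_right (abs_rpow_sub_mul_le hα hr hs ht) (abs_nonneg _)

/-- The Taylor remainder of `‖·‖ ^ (α + 2)` is nonnegative and quadratic. -/
theorem norm_rpow_taylor (hα : 0 < α) (a b : ℂ) :
    0 ≤ ‖b‖ ^ (α + 2) / (α + 2) - ‖a‖ ^ (α + 2) / (α + 2) - ‖a‖ ^ α * inner ℝ a (b - a) ∧
    ‖b‖ ^ (α + 2) / (α + 2) - ‖a‖ ^ (α + 2) / (α + 2) - ‖a‖ ^ α * inner ℝ a (b - a)
      ≤ (α + 2) * (‖a‖ ^ α + ‖b‖ ^ α) * ‖b - a‖ ^ 2 := by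
  -- Reduces the complex remainder to that of the moduli plus the nonnegative term |a|^α |b - a|² /
  -- 2.
  have e : inner ℝ a (b - a) = (‖b‖ ^ 2 - ‖a‖ ^ 2) / 2 - ‖b - a‖ ^ 2 / 2 := by
    rw [@norm_sub_sq_real ℂ _ _ b a, inner_sub_right, real_inner_self_eq_norm_sq,
      real_inner_comm a b]
    ring
  obtain ⟨h1, h2⟩ := rpow_taylor hα (norm_nonneg a) (norm_nonneg b)
  have p1 : 0 ≤ ‖a‖ ^ α := by positivity
  have p2 : 0 ≤ ‖b‖ ^ α := by positivity
  have p3 : 0 ≤ ‖a‖ ^ α * ‖b - a‖ ^ 2 := by positivity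
  have p4 : 0 ≤ ‖b‖ ^ α * ‖b - a‖ ^ 2 := by positivity
  rw [e]
  constructor
  · linarith
  · have h3 : (‖b‖ - ‖a‖) ^ 2 ≤ ‖b - a‖ ^ 2 := by
      rw [← sq_abs]
      gcongr
      exact abs_norm_sub_norm_le b a
    have h4 : (α + 1) * (‖a‖ ^ α + ‖b‖ ^ α) * (‖b‖ - ‖a‖) ^ 2
        ≤ (α + 1) * (‖a‖ ^ α + ‖b‖ ^ α) * ‖b - a‖ ^ 2 := by gcongr
    linarith

theorem rpow_mul_sq_le (hα : 0 < α) {r s : ℝ} (hr : 0 ≤ r) (hs : 0 ≤ s) :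
    r ^ α * s ^ 2 ≤ r ^ (α + 2) + s ^ (α + 2) := by
  have e : ∀ t : ℝ, 0 ≤ t → t ^ (α + 2) = t ^ α * t ^ 2 := fun t ht => by
    rw [Real.rpow_add' ht (by linarith), Real.rpow_two]
  rw [e r hr, e s hs]
  rcases le_total r s with h | h
  · have : r ^ α * s ^ 2 ≤ s ^ α * s ^ 2 := by gcongr
    have : 0 ≤ r ^ α * r ^ 2 := by positivity
    linarith
  · have : r ^ α * s ^ 2 ≤ r ^ α * r ^ 2 := by gcongr
    have : 0 ≤ s ^ α * s ^ 2 := by positivity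
    linarith

theorem rpow_mul_mul_le (hα : 0 < α) {r s : ℝ} (hr : 0 ≤ r) (hs : 0 ≤ s) :
    r ^ α * (r * s) ≤ r ^ (α + 2) + s ^ (α + 2) := by
  have e : ∀ t : ℝ, 0 ≤ t → t ^ (α + 2) = t ^ α * t ^ 2 := fun t ht => by
    rw [Real.rpow_add' ht (by linarith), Real.rpow_two]
  rw [e r hr, e s hs]
  rcases le_total r s with h | h
  · have : r ^ α * (r * s) ≤ s ^ α * s ^ 2 := by
      rw [sq]
      gcongr
    have : 0 ≤ r ^ α * r ^ 2 := by positivity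
    linarith
  · have : r ^ α * (r * s) ≤ r ^ α * r ^ 2 := by
      rw [sq]
      gcongr
    have : 0 ≤ s ^ α * s ^ 2 := by positivity
    linarith

/-- The nonlinear form `∫ |u|^α ⟪u, v⟫`. -/
def nonlin (α : ℝ) (u v : Space d → ℂ) : ℝ := ∫ z, ‖u z‖ ^ α * inner ℝ (u z) (v z)

/-! ### Hölder bounds and the integrated Taylor remainder of the nonlinear term -/

section Power

variable {f g : Space d → ℂ}

theorem integrable_nonlin (hα : 0 < α) (hf : AEStronglyMeasurable f volume)
    (hg : AEStronglyMeasurable g volume) (hfi : Integrable fun z => ‖f z‖ ^ (α + 2))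
    (hgi : Integrable fun z => ‖g z‖ ^ (α + 2)) :
    Integrable fun z => ‖f z‖ ^ α * inner ℝ (f z) (g z) := by
  refine Integrable.mono' (hfi.add hgi)
    ((hf.norm.aemeasurable.pow_const _).aestronglyMeasurable.mul (hf.inner hg))
    (Eventually.of_forall fun z => ?_)
  rw [norm_mul, Real.norm_of_nonneg (by positivity)]
  refine le_trans ?_ (rpow_mul_mul_le hα (norm_nonneg _) (norm_nonneg _))
  gcongr
  exact norm_inner_le_norm _ _

theorem integrable_rpow_mul_sq (hα : 0 < α) (hf : AEStronglyMeasurable f volume)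
    (hg : AEStronglyMeasurable g volume) (hfi : Integrable fun z => ‖f z‖ ^ (α + 2))
    (hgi : Integrable fun z => ‖g z‖ ^ (α + 2)) :
    Integrable fun z => ‖f z‖ ^ α * ‖g z‖ ^ 2 := by
  refine Integrable.mono' (hfi.add hgi)
    ((hf.norm.aemeasurable.pow_const _).aestronglyMeasurable.mul (hg.norm.pow 2))
    (Eventually.of_forall fun z => ?_)
  rw [Real.norm_of_nonneg (by positivity)]
  exact rpow_mul_sq_le hα (norm_nonneg _) (norm_nonneg _)

theorem memLp_rpow_norm {a b : ℝ} (hb : 0 < b) (hf : AEStronglyMeasurable f volume)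
    (hfi : Integrable fun z => ‖f z‖ ^ (a * b)) :
    MemLp (fun z => ‖f z‖ ^ a) (ENNReal.ofReal b) := by
  refine (integrable_norm_rpow_iff (hf.norm.aemeasurable.pow_const _).aestronglyMeasurable
    (by simpa using hb) ENNReal.ofReal_ne_top).1 ?_
  refine hfi.congr (Eventually.of_forall fun z => ?_)
  simp only
  rw [ENNReal.toReal_ofReal hb.le, Real.norm_of_nonneg (by positivity), ← Real.rpow_mul (norm_nonneg _)]

/-- Hölder's inequality for `|f|^α |g|^2`. -/
theorem integral_rpow_mul_sq_le (hα : 0 < α) (hf : AEStronglyMeasurable f volume)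
    (hg : AEStronglyMeasurable g volume) (hfi : Integrable fun z => ‖f z‖ ^ (α + 2))
    (hgi : Integrable fun z => ‖g z‖ ^ (α + 2)) :
    ∫ z, ‖f z‖ ^ α * ‖g z‖ ^ 2
      ≤ powInt (α + 2) f ^ (α / (α + 2)) * powInt (α + 2) g ^ (2 / (α + 2)) := by
  have hp : 0 < α + 2 := by linarith
  have hpq : ((α + 2) / α).HolderConjugate ((α + 2) / 2) := by
    rw [Real.holderConjugate_iff]
    refine ⟨by rw [lt_div_iff₀ hα]; linarith, ?_⟩
    field_simp
  have e1 : α * ((α + 2) / α) = α + 2 := by field_simp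
  have e2 : (2 : ℝ) * ((α + 2) / 2) = α + 2 := by ring
  have m1 := memLp_rpow_norm (a := α) (b := (α + 2) / α) (by positivity) hf (by rwa [e1])
  have m2 := memLp_rpow_norm (a := 2) (b := (α + 2) / 2) (by positivity) hg (by rwa [e2])
  have key := integral_mul_le_Lp_mul_Lq_of_nonneg hpq
    (Eventually.of_forall fun z => by positivity) (Eventually.of_forall fun z => by positivity) m1 m2
  simp only [← Real.rpow_mul (norm_nonneg _), e1, e2, one_div_div] at key
  simp only [Real.rpow_two] at key
  exact key

/-- Hölder's inequality for the nonlinear form. -/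
theorem abs_nonlin_le (hα : 0 < α) (hf : AEStronglyMeasurable f volume)
    (hg : AEStronglyMeasurable g volume) (hfi : Integrable fun z => ‖f z‖ ^ (α + 2))
    (hgi : Integrable fun z => ‖g z‖ ^ (α + 2)) :
    |nonlin α f g| ≤ powInt (α + 2) f ^ ((α + 1) / (α + 2)) * powInt (α + 2) g ^ (1 / (α + 2)) := by
  have hp : 0 < α + 2 := by linarith
  have hp1 : 0 < α + 1 := by linarith
  have hpq : ((α + 2) / (α + 1)).HolderConjugate (α + 2) := by
    rw [Real.holderConjugate_iff]
    refine ⟨by rw [lt_div_iff₀ hp1]; linarith, ?_⟩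
    field_simp
    ring
  have e1 : (α + 1) * ((α + 2) / (α + 1)) = α + 2 := by field_simp
  have m1 := memLp_rpow_norm (a := α + 1) (b := (α + 2) / (α + 1)) (by positivity) hf (by rwa [e1])
  have m2 := memLp_rpow_norm (a := 1) (b := α + 2) (by positivity) hg (by rwa [one_mul])
  have key := integral_mul_le_Lp_mul_Lq_of_nonneg hpq
    (Eventually.of_forall fun z => by positivity) (Eventually.of_forall fun z => by positivity) m1 m2
  simp only [← Real.rpow_mul (norm_nonneg _), e1, one_div_div, Real.rpow_one] at key
  refine le_trans ?_ key
  refine abs_integral_le_integral_abs.trans ?_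
  refine integral_mono_of_nonneg (Eventually.of_forall fun z => abs_nonneg _) ?_
    (Eventually.of_forall fun z => ?_)
  · refine Integrable.mono' (hfi.add hgi)
      ((hf.norm.aemeasurable.pow_const _).aestronglyMeasurable.mul hg.norm)
      (Eventually.of_forall fun z => ?_)
    rw [Real.norm_of_nonneg (by positivity), Real.rpow_add_one' (norm_nonneg _) hp1.ne', mul_assoc]
    exact rpow_mul_mul_le hα (norm_nonneg _) (norm_nonneg _)
  · simp only
    rw [abs_mul, abs_of_nonneg (by positivity : 0 ≤ ‖f z‖ ^ α),
      Real.rpow_add_one' (norm_nonneg _) hp1.ne', mul_assoc]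
    gcongr
    exact abs_real_inner_le_norm _ _

theorem nonlin_sub_right (hα : 0 < α) (hf : AEStronglyMeasurable f volume)
    {h : Space d → ℂ} (hg : AEStronglyMeasurable g volume) (hh : AEStronglyMeasurable h volume)
    (hfi : Integrable fun z => ‖f z‖ ^ (α + 2)) (hgi : Integrable fun z => ‖g z‖ ^ (α + 2))
    (hhi : Integrable fun z => ‖h z‖ ^ (α + 2)) :
    nonlin α f (g - h) = nonlin α f g - nonlin α f h := by
  unfold nonlin
  rw [← integral_sub (integrable_nonlin hα hf hg hfi hgi) (integrable_nonlin hα hf hh hfi hhi)]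
  congr 1 with z
  rw [Pi.sub_apply, inner_sub_right]
  ring

/-- The Taylor remainder of the power term. -/
theorem powInt_taylor (hα : 0 < α) (hf : AEStronglyMeasurable f volume)
    (hg : AEStronglyMeasurable g volume) (hfi : Integrable fun z => ‖f z‖ ^ (α + 2))
    (hgi : Integrable fun z => ‖g z‖ ^ (α + 2))
    (hsi : Integrable fun z => ‖(g - f) z‖ ^ (α + 2)) :
    0 ≤ powInt (α + 2) g / (α + 2) - powInt (α + 2) f / (α + 2) - nonlin α f (g - f) ∧
    powInt (α + 2) g / (α + 2) - powInt (α + 2) f / (α + 2) - nonlin α f (g - f)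
      ≤ (α + 2) * ((∫ z, ‖f z‖ ^ α * ‖(g - f) z‖ ^ 2) + ∫ z, ‖g z‖ ^ α * ‖(g - f) z‖ ^ 2) := by
  have i1 := hgi.div_const (α + 2)
  have i2 := hfi.div_const (α + 2)
  have i3 := integrable_nonlin hα hf (hg.sub hf) hfi hsi
  have i12 : Integrable fun z => ‖g z‖ ^ (α + 2) / (α + 2) - ‖f z‖ ^ (α + 2) / (α + 2) := i1.sub i2
  have i4 := integrable_rpow_mul_sq hα hf (hg.sub hf) hfi hsi
  have i5 := integrable_rpow_mul_sq hα hg (hg.sub hf) hgi hsi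
  have e : powInt (α + 2) g / (α + 2) - powInt (α + 2) f / (α + 2) - nonlin α f (g - f)
      = ∫ z, (‖g z‖ ^ (α + 2) / (α + 2) - ‖f z‖ ^ (α + 2) / (α + 2)
        - ‖f z‖ ^ α * inner ℝ (f z) ((g - f) z)) := by
    rw [integral_sub i12 i3, integral_sub i1 i2, integral_div, integral_div]
    rfl
  rw [e]
  refine ⟨integral_nonneg fun z => (norm_rpow_taylor hα (f z) (g z)).1, ?_⟩
  rw [← integral_add i4 i5, ← integral_const_mul]
  refine integral_mono (i12.sub i3) ((i4.add i5).const_mul _) fun z => ?_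
  refine ((norm_rpow_taylor hα (f z) (g z)).2).trans (le_of_eq ?_)
  simp only [Pi.sub_apply]
  ring

end Power

end PHNLS

end

noncomputable section

namespace PHNLS

open Filter Topology ENNReal

variable {d : ℕ} {α ω : ℝ}

/-! ### The Euler–Lagrange equation of a minimizer -/

/-- The bilinear form of `gradX`. -/
def formX (G V : Option (Fin d) → Space d → ℂ) : ℝ :=
  ∑ i : Fin d, innerRe (G (some i)) (V (some i))

/-- The bilinear form of `transverse`. -/
def formT (ω : ℝ) (u : Space d → ℂ) (G : Option (Fin d) → Space d → ℂ) (v : Space d → ℂ)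
    (V : Option (Fin d) → Space d → ℂ) : ℝ :=
  innerRe (G none) (V none) + innerRe (fun z => z.2 • u z) (fun z => z.2 • v z) + ω * innerRe u v

/-- The weak equation `-Δu + y²u + ωu = |u|^α u`, tested with the whole energy space. -/
def WeakSolution (α ω : ℝ) (u : Space d → ℂ) (G : Option (Fin d) → Space d → ℂ) : Prop :=
  ∀ v V, EnergyFun v V → formX G V + formT ω u G v V = nonlin α u v

theorem innerRe_csmul_right (f g : Space d → ℂ) (c : ℝ) :
    innerRe f ((c : ℂ) • g) = c * innerRe f g := by
  rw [← innerRe_smul_right]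
  congr 1

theorem normSq_add_csmul {f g : Space d → ℂ} (hf : MemLp f 2) (hg : MemLp g 2) (s : ℝ) :
    normSq (f + (s : ℂ) • g) = normSq f + s * (2 * innerRe f g) + s ^ 2 * normSq g := by
  rw [normSq_add hf (hg.const_smul _), innerRe_csmul_right, normSq_csmul]
  ring

section Variation

variable {u v : Space d → ℂ} {G V : Option (Fin d) → Space d → ℂ}

theorem gradX_add_csmul (h : EnergyFun u G) (h' : EnergyFun v V) (s : ℝ) :
    gradX (G + (s : ℂ) • V) = gradX G + s * (2 * formX G V) + s ^ 2 * gradX V := by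
  simp only [gradX, formX, Pi.add_apply, Pi.smul_apply, Finset.mul_sum, ← Finset.sum_add_distrib]
  exact Finset.sum_congr rfl fun i _ => normSq_add_csmul (h.grad_memLp _) (h'.grad_memLp _) s

theorem weight_add_csmul (u v : Space d → ℂ) (s : ℂ) :
    (fun z : Space d => z.2 • (u + s • v) z)
      = (fun z => z.2 • u z) + s • fun z : Space d => z.2 • v z := by
  ext z
  simp only [Pi.add_apply, Pi.smul_apply, smul_add]
  rw [smul_comm]

theorem transverse_add_csmul (h : EnergyFun u G) (h' : EnergyFun v V) (s : ℝ) :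
    transverse ω (u + (s : ℂ) • v) (G + (s : ℂ) • V)
      = transverse ω u G + s * (2 * formT ω u G v V) + s ^ 2 * transverse ω v V := by
  simp only [transverse, formT, Pi.add_apply, Pi.smul_apply]
  have e := weight_add_csmul u v (s : ℂ)
  simp only [Pi.add_apply, Pi.smul_apply] at e
  rw [e, normSq_add_csmul (h.grad_memLp _) (h'.grad_memLp _),
    normSq_add_csmul h.weight_memLp h'.weight_memLp, normSq_add_csmul h.memLp h'.memLp]
  ring

theorem hasDerivAt_of_quadratic_bound {f : ℝ → ℝ} {c C : ℝ}
    (h : ∀ s : ℝ, |s| ≤ 1 → |f s - f 0 - s * c| ≤ C * s ^ 2) : HasDerivAt f c 0 := by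
  rw [hasDerivAt_iff_isLittleO]
  have h1 : (fun s : ℝ => f s - f 0 - (s - 0) • c) =O[𝓝 0] fun s : ℝ => s ^ 2 := by
    refine Asymptotics.IsBigO.of_bound C ?_
    have : ∀ᶠ s : ℝ in 𝓝 0, |s| ≤ 1 := by
      filter_upwards [Metric.closedBall_mem_nhds (0 : ℝ) one_pos] with s hs
      simpa using hs
    filter_upwards [this] with s hs
    rw [sub_zero, smul_eq_mul, Real.norm_eq_abs, Real.norm_of_nonneg (sq_nonneg s)]
    exact h s hs
  have h2 : (fun s : ℝ => s ^ 2) =o[𝓝 0] fun s : ℝ => s - 0 := by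
    simpa using Asymptotics.isLittleO_pow_id (𝕜 := ℝ) one_lt_two
  exact h1.trans_isLittleO h2

theorem hasDerivAt_quadratic (a b c : ℝ) :
    HasDerivAt (fun s : ℝ => a + s * b + s ^ 2 * c) b 0 :=
  hasDerivAt_of_quadratic_bound (C := |c|) fun s _ => by
    rw [show a + s * b + s ^ 2 * c - (a + 0 * b + 0 ^ 2 * c) - s * b = c * s ^ 2 by ring, abs_mul,
      abs_of_nonneg (sq_nonneg s)]

/-- The integrated Taylor remainder is O(s²), so no differentiation under the integral sign is
needed. -/
theorem Admissible.hasDerivAt_powInt (ha : Admissible d α ω) (h : EnergyFun u G)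
    (h' : EnergyFun v V) :
    HasDerivAt (fun s : ℝ => powInt (α + 2) (u + (s : ℂ) • v)) ((α + 2) * nonlin α u v) 0 := by
  have hα := ha.α_pos
  have hp : 0 < α + 2 := by linarith
  have iu := ha.integrable_rpow h
  have iv := ha.integrable_rpow h'
  refine hasDerivAt_of_quadratic_bound (C := (α + 2) ^ 2 * ((1 + 2 ^ α)
    * (powInt (α + 2) u + powInt (α + 2) v))) fun s hs => ?_
  have hw := h.add (h'.const_smul (s : ℂ))
  have iw := ha.integrable_rpow hw
  have e0 : u + (s : ℂ) • v - u = (s : ℂ) • v := by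
    ext z
    simp
  have isv := ha.integrable_rpow (h'.const_smul (s : ℂ))
  obtain ⟨t1, t2⟩ := powInt_taylor hα h.memLp.1 hw.memLp.1 iu iw (by rw [e0]; exact isv)
  rw [e0] at t1 t2
  have en : nonlin α u ((s : ℂ) • v) = s * nonlin α u v := by
    unfold nonlin
    rw [← integral_const_mul]
    congr 1 with z
    have : inner ℝ (u z) (((s : ℂ) • v) z) = s * inner ℝ (u z) (v z) :=
      real_inner_smul_right (u z) (v z) s
    rw [this]
    ring
  rw [en] at t1 t2
  have e1 : u + ((0 : ℝ) : ℂ) • v = u := by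
    ext z
    simp
  have i1 := integrable_rpow_mul_sq hα h.memLp.1 (h'.const_smul (s : ℂ)).memLp.1 iu isv
  have i2 := integrable_rpow_mul_sq hα hw.memLp.1 (h'.const_smul (s : ℂ)).memLp.1 iw isv
  have key : (∫ z, ‖u z‖ ^ α * ‖((s : ℂ) • v) z‖ ^ 2)
      + ∫ z, ‖(u + (s : ℂ) • v) z‖ ^ α * ‖((s : ℂ) • v) z‖ ^ 2
      ≤ s ^ 2 * ((1 + 2 ^ α) * (powInt (α + 2) u + powInt (α + 2) v)) := by
    have i3 : Integrable fun z => s ^ 2 * ((1 + 2 ^ α) * (‖u z‖ ^ (α + 2) + ‖v z‖ ^ (α + 2))) :=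
      ((iu.add iv).const_mul _).const_mul _
    have e2 : s ^ 2 * ((1 + 2 ^ α) * (powInt (α + 2) u + powInt (α + 2) v))
        = ∫ z, s ^ 2 * ((1 + 2 ^ α) * (‖u z‖ ^ (α + 2) + ‖v z‖ ^ (α + 2))) := by
      rw [integral_const_mul, integral_const_mul, integral_add iu iv]
      rfl
    rw [← integral_add i1 i2, e2]
    refine integral_mono (i1.add i2) i3 fun z => ?_
    simp only [Pi.add_apply, Pi.smul_apply, norm_smul, Complex.norm_real, Real.norm_eq_abs, mul_pow,
      sq_abs]
    -- For |s| ≤ 1 one has |u + s v| ≤ 2m, so every term is at most a multiple of m^(α+2), which is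
    -- at most |u|^(α+2) + |v|^(α+2).
    set m := max ‖u z‖ ‖v z‖ with hm
    have hm0 : 0 ≤ m := (norm_nonneg _).trans (le_max_left _ _)
    have hu : ‖u z‖ ≤ m := le_max_left _ _
    have hv : ‖v z‖ ≤ m := le_max_right _ _
    have hmp : m ^ (α + 2) ≤ ‖u z‖ ^ (α + 2) + ‖v z‖ ^ (α + 2) := by
      have p1 : 0 ≤ ‖u z‖ ^ (α + 2) := by positivity
      have p2 : 0 ≤ ‖v z‖ ^ (α + 2) := by positivity
      rcases max_choice ‖u z‖ ‖v z‖ with h | h <;> rw [hm, h] <;> linarith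
    have hw2 : ‖u z + (s : ℂ) • v z‖ ≤ 2 * m := by
      refine (norm_add_le _ _).trans ?_
      rw [norm_smul, Complex.norm_real, Real.norm_eq_abs]
      have : |s| * ‖v z‖ ≤ 1 * m := by gcongr
      linarith
    have h1 : ‖u z‖ ^ α ≤ m ^ α := by gcongr
    have h2 : ‖u z + (s : ℂ) • v z‖ ^ α ≤ 2 ^ α * m ^ α := by
      rw [← Real.mul_rpow zero_le_two hm0]
      gcongr
    have h3 : ‖v z‖ ^ 2 ≤ m ^ 2 := by gcongr
    have e3 : m ^ (α + 2) = m ^ α * m ^ 2 := by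
      rw [Real.rpow_add' hm0 (by linarith), Real.rpow_two]
    calc ‖u z‖ ^ α * (s ^ 2 * ‖v z‖ ^ 2) + ‖u z + (s : ℂ) • v z‖ ^ α * (s ^ 2 * ‖v z‖ ^ 2)
        ≤ m ^ α * (s ^ 2 * m ^ 2) + (2 ^ α * m ^ α) * (s ^ 2 * m ^ 2) := by gcongr
      _ = s ^ 2 * ((1 + 2 ^ α) * m ^ (α + 2)) := by rw [e3]; ring
      _ ≤ _ := by gcongr
  have t3 := t2.trans (mul_le_mul_of_nonneg_left key hp.le)
  rw [e1]
  have e4 : powInt (α + 2) (u + (s : ℂ) • v) - powInt (α + 2) u - s * ((α + 2) * nonlin α u v)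
      = (α + 2) * (powInt (α + 2) (u + (s : ℂ) • v) / (α + 2) - powInt (α + 2) u / (α + 2)
        - s * nonlin α u v) := by
    field_simp
  rw [e4, abs_of_nonneg (mul_nonneg hp.le t1)]
  calc _ ≤ (α + 2) * ((α + 2) * (s ^ 2 * ((1 + 2 ^ α) * (powInt (α + 2) u + powInt (α + 2) v)))) :=
        mul_le_mul_of_nonneg_left t3 hp.le
    _ = _ := by ring

/-- A minimizer of the action on `Q = 0` is a weak solution. -/
theorem Admissible.weakSolution_of_minimizer (ha : Admissible d α ω)
    (hm : ∀ (w : Space d → ℂ) (W : Option (Fin d) → Space d → ℂ), EnergyFun w W →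
      0 < normSq w → virialFun α w W = 0 → actionFun α ω u G ≤ actionFun α ω w W)
    (h : EnergyFun u G) (hu : 0 < normSq u) (hQ : virialFun α u G = 0) :
    WeakSolution α ω u G := by
  intro v V h'
  have hA0 := ha.gradX_pos h hu
  have hN0 := ha.powInt_pos h hu
  have hc := ha.coeff_pos
  have hq := ha.quad_coeff_pos
  have hp : 0 < α + 2 := by linarith [ha.α_pos]
  have hαd : 0 < α * d := by linarith [ha.four_lt]
  have he : 0 < α * d / 2 - 2 := by linarith [ha.four_lt]
  set c := α * d / (2 * (α + 2)) with hcdef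
  have hAN : gradX G = c * powInt (α + 2) u := by
    unfold virialFun at hQ
    linarith
  set N : ℝ → ℝ := fun s => powInt (α + 2) (u + (s : ℂ) • v) with hN
  set A : ℝ → ℝ := fun s => gradX G + s * (2 * formX G V) + s ^ 2 * gradX V with hA
  set T : ℝ → ℝ := fun s => transverse ω u G + s * (2 * formT ω u G v V)
    + s ^ 2 * transverse ω v V with hT
  have dN : HasDerivAt N ((α + 2) * nonlin α u v) 0 := ha.hasDerivAt_powInt h h'
  have dA : HasDerivAt A (2 * formX G V) 0 := hasDerivAt_quadratic _ _ _
  have dT : HasDerivAt T (2 * formT ω u G v V) 0 := hasDerivAt_quadratic _ _ _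
  have N0 : N 0 = powInt (α + 2) u := by simp [hN]
  have A0 : A 0 = gradX G := by simp [hA]
  have T0 : T 0 = transverse ω u G := by simp [hT]
  set e := 1 / (α * d / 2 - 2) with hedef
  -- The action of u + s v after dilation onto Q = 0, where it equals the quadratic form;
  -- (A/(cN))^(2e) is the square of the dilation factor. Projecting onto the constraint makes a
  -- multiplier unnecessary.
  set M : ℝ → ℝ := fun s => (1 / 2 - 2 / (α * d)) * ((A s / (c * N s)) ^ (2 * e) * A s)
    + 1 / 2 * T s with hM
  have dR : HasDerivAt (fun s => A s / (c * N s))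
      ((2 * formX G V * (c * N 0) - A 0 * (c * ((α + 2) * nonlin α u v))) / (c * N 0) ^ 2) 0 :=
    dA.div (dN.const_mul c) (by rw [N0]; positivity)
  have R0 : A 0 / (c * N 0) = 1 := by
    rw [A0, N0, hAN]
    field_simp
  have dM := (((dR.rpow_const (p := 2 * e) (Or.inl (by rw [R0]; exact one_ne_zero))).mul dA).const_mul
    (1 / 2 - 2 / (α * d))).add (dT.const_mul (1 / 2))
  have hmin : IsLocalMin M 0 := by
    have hpos : ∀ᶠ s : ℝ in 𝓝 0, 0 < normSq (u + (s : ℂ) • v) := by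
      have hcont : Continuous fun s : ℝ => normSq u + s * (2 * innerRe u v) + s ^ 2 * normSq v := by
        fun_prop
      have := hcont.tendsto 0
      simp only [zero_mul, add_zero, ne_eq, OfNat.ofNat_ne_zero, not_false_eq_true, zero_pow] at this
      filter_upwards [this.eventually_const_lt hu] with s hs
      rwa [normSq_add_csmul h.memLp h'.memLp]
    filter_upwards [hpos] with s hs
    have hw := h.add (h'.const_smul (s : ℂ))
    obtain ⟨hl, h0, -⟩ := ha.virialScale_spec hw hs
    set l := virialScale α (u + (s : ℂ) • v) (G + (s : ℂ) • V) with hldef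
    have h1 := hm _ _ (hw.dilate hl) ((normSq_dilate hl _).symm ▸ hs) h0
    have e1 := ha.quadFun_eq (dilate l (u + (s : ℂ) • v)) (dilateGrad l (G + (s : ℂ) • V))
    have e2 := ha.quadFun_eq u G
    rw [h0, mul_zero, sub_zero] at e1
    rw [hQ, mul_zero, sub_zero] at e2
    rw [← e1, ← e2, quadFun, quadFun, gradX_dilateGrad hl, transverse_dilate hl,
      gradX_add_csmul h h', transverse_add_csmul h h'] at h1
    have hA' : A s = gradX (G + (s : ℂ) • V) := (gradX_add_csmul h h' s).symm
    have hAs := ha.gradX_pos hw hs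
    have hNs := ha.powInt_pos hw hs
    have el : l ^ 2 = (A s / (c * N s)) ^ (2 * e) := by
      have e3 : l = (A s / (c * N s)) ^ e := by rw [hldef, virialScale, ← hA']
      have e4 : 0 ≤ A s / (c * N s) := by
        rw [hA']
        exact div_nonneg hAs.le (mul_pos hc hNs).le
      rw [e3, ← Real.rpow_two, ← Real.rpow_mul e4, mul_comm e 2]
    simp only [hM]
    rw [R0, Real.one_rpow, one_mul, A0, T0, ← el]
    exact h1
  have hzero := hmin.hasDerivAt_eq_zero dM
  rw [R0, Real.one_rpow, Real.one_rpow, A0, N0, hAN] at hzero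
  have hcN : c * powInt (α + 2) u ≠ 0 := by positivity
  have hN' := hN0.ne'
  have e5 : (2 * formX G V * (c * powInt (α + 2) u)
      - c * powInt (α + 2) u * (c * ((α + 2) * nonlin α u v))) / (c * powInt (α + 2) u) ^ 2
      * (c * powInt (α + 2) u) = 2 * formX G V - c * ((α + 2) * nonlin α u v) := by
    field_simp
  have e6 : c * (α + 2) = α * d / 2 := by
    rw [hcdef]
    field_simp
  -- With this identity the derivative at 0 collapses: the contribution of the dilation factor
  -- completes the coefficient of `formX` to 1 and that of `nonlin` to -1.
  have e7 : (1 / 2 - 2 / (α * d)) * (2 * e) = 2 / (α * d) := by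
    rw [hedef]
    generalize α * d = k at hαd he
    have : k - 4 ≠ 0 := by linarith
    rw [show k / 2 - 2 = (k - 4) / 2 by ring, show (1 / 2 - 2 / k) = (k - 4) / (2 * k) by
      field_simp
      ring]
    field_simp
  have e8 : 2 / (α * d) * (α * d / 2) = 1 := by
    generalize α * d = k at hαd
    field_simp
  linear_combination hzero + (1 / 2 - 2 / (α * d)) * (-2 * e) * e5
    + (2 * formX G V - c * ((α + 2) * nonlin α u v)) * (-e7) + 2 / (α * d) * nonlin α u v * e6
    + nonlin α u v * e8

end Variation

end PHNLS

end

noncomputable section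

namespace PHNLS

open Filter Topology ENNReal

variable {d : ℕ} {α ω : ℝ}

/-! ### Distributional solutions and the extension of the class of test functions -/

theorem fderiv_toC {ψ : Space d → ℝ} (hψ : Differentiable ℝ ψ) (z v : Space d) :
    fderiv ℝ (toC ψ) z v = (fderiv ℝ ψ z v : ℂ) := by
  have h := Complex.ofRealCLM.hasFDerivAt.comp z (hψ z).hasFDerivAt
  have e : toC ψ = Complex.ofRealCLM ∘ ψ := rfl
  rw [e, h.fderiv]
  rfl

/-- The gradient of a real function, as a complex vector field. -/
def gradC (ψ : Space d → ℝ) : Option (Fin d) → Space d → ℂ :=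
  fun k => toC fun z => fderiv ℝ ψ z (dir k)

theorem IsTest.contDiff_toC {ψ : Space d → ℝ} (hψ : IsTest ψ) : ContDiff ℝ (⊤ : ℕ∞) (toC ψ) :=
  Complex.ofRealCLM.contDiff.comp hψ.1

theorem IsTest.hasCompactSupport_toC {ψ : Space d → ℝ} (hψ : IsTest ψ) :
    HasCompactSupport (toC ψ) := hψ.2.comp_left Complex.ofReal_zero

theorem IsTest.energyFun {ψ : Space d → ℝ} (hψ : IsTest ψ) : EnergyFun (toC ψ) (gradC ψ) := by
  convert energyFun_of_contDiff hψ.contDiff_toC hψ.hasCompactSupport_toC using 1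
  ext k z
  exact (fderiv_toC hψ.differentiable z (dir k)).symm

theorem re_integral_smul_of_integrable {ρ : Space d → ℝ} {f : Space d → ℂ}
    (h : Integrable fun z => ρ z • f z) :
    (∫ z, ρ z • f z).re = ∫ z, inner ℝ (toC ρ z) (f z) := by
  have := integral_re (𝕜 := ℂ) h
  simp only [RCLike.re_eq_complex_re] at this
  rw [← this]
  simp only [toC, inner_ofReal_left]

theorem im_integral_smul_of_integrable {ρ : Space d → ℝ} {f : Space d → ℂ}
    (h : Integrable fun z => ρ z • f z) :
    (∫ z, ρ z • f z).im = ∫ z, inner ℝ ((Complex.I • toC ρ) z) (f z) := by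
  have := integral_im (𝕜 := ℂ) h
  simp only [RCLike.im_eq_complex_im] at this
  rw [← this]
  simp only [toC, Pi.smul_apply, smul_eq_mul, inner_ofReal_mul_I_left]

section Test

variable {u : Space d → ℂ} {G : Option (Fin d) → Space d → ℂ} {ψ : Space d → ℝ}

theorem potential_form (h : EnergyFun u G) {v : Space d → ℂ} {V : Option (Fin d) → Space d → ℂ}
    (hv : EnergyFun v V) (ω : ℝ) :
    ∫ z : Space d, inner ℝ ((z.2 ^ 2 + ω) • v z) (u z)
      = innerRe (fun z => z.2 • u z) (fun z => z.2 • v z) + ω * innerRe u v := by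
  unfold innerRe
  rw [← integral_const_mul, ← integral_add (integrable_innerRe h.weight_memLp hv.weight_memLp)
    ((integrable_innerRe h.memLp hv.memLp).const_mul ω)]
  congr 1 with z
  rw [real_inner_smul_left, real_inner_smul_left, real_inner_smul_right, real_inner_comm]
  ring

/-- The distributional equation splits into its real and imaginary parts. -/
theorem Admissible.test_iff (ha : Admissible d α ω) (h : EnergyFun u G) (hψ : IsTest ψ) :
    ((∑ i : Fin d, ∫ z, fderiv ℝ ψ z (dirX i) • G (some i) z)
      + (∫ z, fderiv ℝ ψ z (dirY d) • G none z)
      + (∫ z, (ψ z * (z.2 ^ 2 + ω)) • u z)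
    = ∫ z, (ψ z * ‖u z‖ ^ α) • u z) ↔
    (formX G (gradC ψ) + formT ω u G (toC ψ) (gradC ψ) = nonlin α u (toC ψ) ∧
      formX G (Complex.I • gradC ψ) + formT ω u G (Complex.I • toC ψ) (Complex.I • gradC ψ)
        = nonlin α u (Complex.I • toC ψ)) := by
  have hα := ha.α_pos
  have hE := hψ.energyFun
  have hEI := hE.const_smul Complex.I
  have c1 : ∀ v, Continuous fun z => fderiv ℝ ψ z v := hψ.fderiv_continuous
  have s1 : ∀ v, HasCompactSupport fun z => fderiv ℝ ψ z v := hψ.fderiv_hasCompactSupport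
  have c2 : Continuous fun z : Space d => ψ z * (z.2 ^ 2 + ω) :=
    hψ.1.continuous.mul (by fun_prop)
  have s2 : HasCompactSupport fun z : Space d => ψ z * (z.2 ^ 2 + ω) := hψ.2.mul_right
  have hi : Integrable fun z => (ψ z * ‖u z‖ ^ α) • u z := by
    have hm := (h.memLp.1.norm.aemeasurable.pow_const α).aestronglyMeasurable
    refine Integrable.mono' ((ha.integrable_rpow h).add (ha.integrable_rpow hE))
      ((hψ.1.continuous.aestronglyMeasurable.mul hm).smul h.memLp.1)
      (Eventually.of_forall fun z => ?_)
    have := rpow_mul_mul_le hα (norm_nonneg (u z)) (norm_nonneg (toC ψ z))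
    rw [norm_smul, norm_mul, Real.norm_of_nonneg (by positivity : 0 ≤ ‖u z‖ ^ α)]
    have e : ‖toC ψ z‖ = ‖ψ z‖ := Complex.norm_real _
    simp only [Pi.add_apply]
    rw [e] at this ⊢
    linarith
  rw [Complex.ext_iff]
  refine and_congr ?_ ?_
  · have e1 : ((∑ i : Fin d, ∫ z, fderiv ℝ ψ z (dirX i) • G (some i) z)
      + (∫ z, fderiv ℝ ψ z (dirY d) • G none z)
      + (∫ z, (ψ z * (z.2 ^ 2 + ω)) • u z)).re
        = formX G (gradC ψ) + formT ω u G (toC ψ) (gradC ψ) := by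
      rw [Complex.add_re, Complex.add_re, Complex.re_sum,
        re_integral_smul (c1 _) (s1 _) (h.grad_memLp none), re_integral_smul c2 s2 h.memLp, formX,
        formT, add_assoc (innerRe (G none) _), ← potential_form h hE, ← add_assoc]
      congr 1
      · congr 1
        · refine Finset.sum_congr rfl fun i _ => ?_
          rw [re_integral_smul (c1 _) (s1 _) (h.grad_memLp (some i)), innerRe_comm]
          rfl
        · rw [innerRe_comm]
          rfl
      · unfold innerRe
        congr 1 with z
        simp [toC, mul_comm]
    have e2 : (∫ z, (ψ z * ‖u z‖ ^ α) • u z).re = nonlin α u (toC ψ) := by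
      rw [re_integral_smul_of_integrable hi, nonlin]
      congr 1 with z
      rw [← real_inner_smul_right, real_inner_comm]
      simp only [toC]
      rw [real_inner_smul_right, Complex.ofReal_mul, mul_comm, ← Complex.real_smul,
        real_inner_smul_right]
    rw [e1, e2]
  · have e1 : ((∑ i : Fin d, ∫ z, fderiv ℝ ψ z (dirX i) • G (some i) z)
      + (∫ z, fderiv ℝ ψ z (dirY d) • G none z)
      + (∫ z, (ψ z * (z.2 ^ 2 + ω)) • u z)).im
        = formX G (Complex.I • gradC ψ)
          + formT ω u G (Complex.I • toC ψ) (Complex.I • gradC ψ) := by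
      rw [Complex.add_im, Complex.add_im, Complex.im_sum,
        im_integral_smul (c1 _) (s1 _) (h.grad_memLp none), im_integral_smul c2 s2 h.memLp, formX,
        formT, add_assoc (innerRe (G none) _), ← potential_form h hEI, ← add_assoc]
      congr 1
      · congr 1
        · refine Finset.sum_congr rfl fun i _ => ?_
          rw [im_integral_smul (c1 _) (s1 _) (h.grad_memLp (some i)), innerRe_comm]
          rfl
        · rw [innerRe_comm]
          rfl
      · unfold innerRe
        congr 1 with z
        congr 1
        simp only [toC, Pi.smul_apply, smul_eq_mul, Complex.real_smul, Complex.ofReal_mul]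
        ring
    have e2 : (∫ z, (ψ z * ‖u z‖ ^ α) • u z).im = nonlin α u (Complex.I • toC ψ) := by
      rw [im_integral_smul_of_integrable hi, nonlin]
      congr 1 with z
      rw [← real_inner_smul_right, real_inner_comm]
      simp only [toC, Pi.smul_apply]
      rw [real_inner_smul_right, Complex.ofReal_mul, mul_comm, ← Complex.real_smul,
        smul_comm Complex.I, real_inner_smul_right]
    rw [e1, e2]

end Test

section Defect

variable {u : Space d → ℂ} {G : Option (Fin d) → Space d → ℂ}

/-- The difference of the two sides of the weak equation. -/
def defect (α ω : ℝ) (u : Space d → ℂ) (G : Option (Fin d) → Space d → ℂ) (v : Space d → ℂ)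
    (V : Option (Fin d) → Space d → ℂ) : ℝ :=
  formX G V + formT ω u G v V - nonlin α u v

theorem Admissible.defect_sub (ha : Admissible d α ω) (h : EnergyFun u G) {v w : Space d → ℂ}
    {V W : Option (Fin d) → Space d → ℂ} (hv : EnergyFun v V) (hw : EnergyFun w W) :
    defect α ω u G (v - w) (V - W) = defect α ω u G v V - defect α ω u G w W := by
  have e : (fun z : Space d => z.2 • (v - w) z)
      = (fun z => z.2 • v z) - fun z : Space d => z.2 • w z := by
    ext z
    simp [mul_sub]
  have e1 : formX G (V - W) = formX G V - formX G W := by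
    simp only [formX, Pi.sub_apply, ← Finset.sum_sub_distrib]
    exact Finset.sum_congr rfl fun i _ =>
      innerRe_sub_right (hv.grad_memLp _) (hw.grad_memLp _) (h.grad_memLp _)
  have e2 : formT ω u G (v - w) (V - W) = formT ω u G v V - formT ω u G w W := by
    rw [formT, e, Pi.sub_apply, innerRe_sub_right (hv.grad_memLp _) (hw.grad_memLp _)
      (h.grad_memLp _), innerRe_sub_right hv.weight_memLp hw.weight_memLp h.weight_memLp,
      innerRe_sub_right hv.memLp hw.memLp h.memLp, formT, formT]
    ring
  rw [defect, e1, e2, nonlin_sub_right ha.α_pos h.memLp.1 hv.memLp.1 hw.memLp.1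
    (ha.integrable_rpow h) (ha.integrable_rpow hv) (ha.integrable_rpow hw), defect, defect]
  ring

/-- Continuity of both sides of the equation in the test function, which lets density extend it to
the whole energy space. -/
theorem Admissible.exists_abs_defect_le (ha : Admissible d α ω) (h : EnergyFun u G) :
    ∃ K : ℝ, ∀ v V, EnergyFun v V → |defect α ω u G v V| ≤ K * √(energySq v V) := by
  obtain ⟨S, hS, hS'⟩ := exists_sobolev_subcritical ha.two_le ha.α_pos ha.upper
  have hα := ha.α_pos
  have hp : 0 < α + 2 := by linarith
  refine ⟨(∑ i : Fin d, √(normSq (G (some i)))) + (√(normSq (G none))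
    + √(normSq fun z : Space d => z.2 • u z) + ω * √(normSq u))
    + powInt (α + 2) u ^ ((α + 1) / (α + 2)) * S ^ (1 / (α + 2)), fun v V hv => ?_⟩
  have b : ∀ {f g : Space d → ℂ}, MemLp f 2 → MemLp g 2 → normSq g ≤ energySq v V →
      |innerRe f g| ≤ √(normSq f) * √(energySq v V) := fun hf hg hle =>
    (abs_innerRe_le hf hg).trans (mul_le_mul_of_nonneg_left (Real.sqrt_le_sqrt hle)
      (Real.sqrt_nonneg _))
  have b1 : |formX G V| ≤ (∑ i : Fin d, √(normSq (G (some i)))) * √(energySq v V) := by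
    rw [Finset.sum_mul]
    exact (Finset.abs_sum_le_sum_abs _ _).trans (Finset.sum_le_sum fun i _ =>
      b (h.grad_memLp _) (hv.grad_memLp _) (normSq_grad_le_energySq v V _))
  have b2 := b (h.grad_memLp none) (hv.grad_memLp none) (normSq_grad_le_energySq v V _)
  have b3 := b h.weight_memLp hv.weight_memLp (normSq_weight_le_energySq v V)
  have b4 := b h.memLp hv.memLp (normSq_le_energySq v V)
  have b5 : |ω * innerRe u v| ≤ ω * (√(normSq u) * √(energySq v V)) := by
    rw [abs_mul, abs_of_pos ha.pos]
    exact mul_le_mul_of_nonneg_left b4 ha.pos.le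
  have b6 := abs_nonlin_le hα h.memLp.1 hv.memLp.1 (ha.integrable_rpow h) (ha.integrable_rpow hv)
  have b7 : powInt (α + 2) v ^ (1 / (α + 2)) ≤ S ^ (1 / (α + 2)) * √(energySq v V) := by
    have h1 := Real.rpow_le_rpow (powInt_nonneg _ _) (hS' v V hv)
      (show 0 ≤ 1 / (α + 2) by positivity)
    rw [Real.mul_rpow hS.le (Real.rpow_nonneg (h1Sq_nonneg _ _) _),
      ← Real.rpow_mul (h1Sq_nonneg _ _),
      show (α + 2) / 2 * (1 / (α + 2)) = 1 / 2 by field_simp, ← Real.sqrt_eq_rpow] at h1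
    refine h1.trans ?_
    gcongr
    exact h1Sq_le_energySq v V
  have b8 := mul_le_mul_of_nonneg_left b7 (Real.rpow_nonneg (powInt_nonneg (α + 2) u)
    ((α + 1) / (α + 2)))
  have t1 := abs_add_le (innerRe (G none) (V none)
    + innerRe (fun z => z.2 • u z) (fun z => z.2 • v z)) (ω * innerRe u v)
  have t2 := abs_add_le (innerRe (G none) (V none))
    (innerRe (fun z => z.2 • u z) (fun z => z.2 • v z))
  have t3 := abs_add_le (formX G V) (formT ω u G v V)
  have t4 := abs_sub (formX G V + formT ω u G v V) (nonlin α u v)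
  have e : formT ω u G v V = innerRe (G none) (V none)
    + innerRe (fun z => z.2 • u z) (fun z => z.2 • v z) + ω * innerRe u v := rfl
  rw [← e] at t1
  unfold defect
  linarith

/-- The weak equation holds for the whole energy space if it holds for test functions. -/
theorem Admissible.weakSolution_of_test (ha : Admissible d α ω) (h : EnergyFun u G)
    (ht : ∀ ψ : Space d → ℝ, IsTest ψ →
      (∑ i : Fin d, ∫ z, fderiv ℝ ψ z (dirX i) • G (some i) z)
        + (∫ z, fderiv ℝ ψ z (dirY d) • G none z)
        + (∫ z, (ψ z * (z.2 ^ 2 + ω)) • u z)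
      = ∫ z, (ψ z * ‖u z‖ ^ α) • u z) :
    WeakSolution α ω u G := by
  have hsm : ∀ g : Space d → ℂ, ContDiff ℝ (⊤ : ℕ∞) g → HasCompactSupport g →
      defect α ω u G g (fun k z => fderiv ℝ g z (dir k)) = 0 := by
    intro g hg hc
    have hre : IsTest fun z => (g z).re :=
      ⟨Complex.reCLM.contDiff.comp hg, hc.comp_left Complex.zero_re⟩
    have him : IsTest fun z => (g z).im :=
      ⟨Complex.imCLM.contDiff.comp hg, hc.comp_left Complex.zero_im⟩
    -- The real pairing with g = Re g + i Im g uses the real part of the equation for Re g and the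
    -- imaginary part of the equation for Im g.
    have h1 := ((ha.test_iff h hre).1 (ht _ hre)).1
    have h2 := ((ha.test_iff h him).1 (ht _ him)).2
    have hgd : Differentiable ℝ g := hg.differentiable (by simp)
    have e1 : g - toC (fun z => (g z).re) = Complex.I • toC fun z => (g z).im := by
      ext z
      simp only [Pi.sub_apply, Pi.smul_apply, toC, smul_eq_mul]
      linear_combination -Complex.re_add_im (g z)
    have e2 : (fun k z => fderiv ℝ g z (dir k)) - gradC (fun z => (g z).re)
        = Complex.I • gradC fun z => (g z).im := by
      ext k z
      have f1 : fderiv ℝ (fun z => (g z).re) z (dir k) = (fderiv ℝ g z (dir k)).re := by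
        have := (Complex.reCLM.hasFDerivAt.comp z (hgd z).hasFDerivAt).fderiv
        exact congrArg (fun L => L (dir k)) this
      have f2 : fderiv ℝ (fun z => (g z).im) z (dir k) = (fderiv ℝ g z (dir k)).im := by
        have := (Complex.imCLM.hasFDerivAt.comp z (hgd z).hasFDerivAt).fderiv
        exact congrArg (fun L => L (dir k)) this
      simp only [Pi.sub_apply, Pi.smul_apply, gradC, toC, smul_eq_mul, f1, f2]
      linear_combination -Complex.re_add_im (fderiv ℝ g z (dir k))
    have h3 := ha.defect_sub h (energyFun_of_contDiff hg hc) hre.energyFun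
    rw [e1, e2] at h3
    unfold defect at h3 ⊢
    linarith
  intro v V hv
  obtain ⟨K, hK⟩ := ha.exists_abs_defect_le h
  obtain ⟨g, hg, hgc, hlim⟩ := hv.exists_smooth_seq
  have h1 : ∀ n, |defect α ω u G v V|
      ≤ K * √(energySq (g n - v) ((fun k z => fderiv ℝ (g n) z (dir k)) - V)) := by
    intro n
    have hE := energyFun_of_contDiff (hg n) (hgc n)
    have h2 := hK _ _ (hE.sub hv)
    rw [ha.defect_sub h hE hv, hsm _ (hg n) (hgc n), zero_sub, abs_neg] at h2
    exact h2
  have h2 := (hlim.sqrt).const_mul K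
  rw [Real.sqrt_zero, mul_zero] at h2
  have h3 := ge_of_tendsto' h2 h1
  have h4 := abs_eq_zero.1 (le_antisymm h3 (abs_nonneg _))
  unfold defect at h4
  linarith

theorem Admissible.weakSolution_of_mem_solutionSet (ha : Admissible d α ω) {φ : L2 d}
    (hφ : φ ∈ solutionSet d α ω) : WeakSolution α ω φ fun k => weakDeriv (dir k) φ :=
  ha.weakSolution_of_test (energyFun_of_mem_Sigma hφ.1) hφ.2.2

theorem innerRe_congr_left {f f' g : Space d → ℂ} (h : f =ᵐ[volume] f') :
    innerRe f g = innerRe f' g :=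
  integral_congr_ae (h.mono fun z hz => by simp [hz])

theorem WeakSolution.congr {u' : Space d → ℂ} {G' : Option (Fin d) → Space d → ℂ}
    (hs : WeakSolution α ω u G) (hu : u =ᵐ[volume] u') (hG : ∀ k, G k =ᵐ[volume] G' k) :
    WeakSolution α ω u' G' := by
  intro v V hv
  have e1 : formX G' V = formX G V :=
    Finset.sum_congr rfl fun i _ => innerRe_congr_left (hG _).symm
  have e2 : formT ω u' G' v V = formT ω u G v V := by
    unfold formT
    rw [innerRe_congr_left (hG none).symm, innerRe_congr_left hu.symm,
      innerRe_congr_left (f := fun z => z.2 • u' z) (f' := fun z => z.2 • u z)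
        (hu.mono fun z hz => by simp [hz])]
  have e3 : nonlin α u' v = nonlin α u v :=
    integral_congr_ae (hu.mono fun z hz => by simp [hz])
  rw [e1, e2, e3]
  exact hs v V hv

theorem Admissible.solvesElliptic_toLp (ha : Admissible d α ω) (h : EnergyFun u G)
    (hs : WeakSolution α ω u G) : SolvesElliptic α ω h.memLp.toLp := by
  intro ψ hψ
  have hE := energyFun_of_mem_Sigma h.toLp_mem_Sigma
  have hs' := hs.congr h.memLp.coeFn_toLp.symm fun k => (h.weakDeriv_toLp_ae k).symm
  exact (ha.test_iff hE hψ).2 ⟨hs' _ _ hψ.energyFun, hs' _ _ (hψ.energyFun.const_smul Complex.I)⟩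

end Defect

end PHNLS

end

noncomputable section

namespace PHNLS

open Filter Topology ENNReal

variable {d : ℕ} {α ω : ℝ}

/-! ### Decay of solutions in `x` -/

section Weight

variable {u : Space d → ℂ} {G : Option (Fin d) → Space d → ℂ} {W : Space d → ℝ}

theorem memLp_smul_of_bounded {a : Space d → ℝ} {f : Space d → ℂ} {C : ℝ} (ha : Continuous a)
    (hC : ∀ z, |a z| ≤ C) (hf : MemLp f 2) : MemLp (fun z => a z • f z) 2 := by
  refine hf.of_le_mul (c := C) (ha.aestronglyMeasurable.smul hf.1)
    (Eventually.of_forall fun z => ?_)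
  rw [norm_smul]
  exact mul_le_mul_of_nonneg_right (hC z) (norm_nonneg _)

theorem normSq_smul_le_of_bounded {a : Space d → ℝ} {f : Space d → ℂ} {C : ℝ}
    (hC : ∀ z, |a z| ≤ C) (hf : MemLp f 2) :
    normSq (fun z => a z • f z) ≤ C ^ 2 * normSq f := by
  unfold normSq
  rw [← integral_const_mul]
  refine integral_mono_of_nonneg (Eventually.of_forall fun z => by positivity)
    ((integrable_normSq hf).const_mul _) (Eventually.of_forall fun z => ?_)
  simp only [norm_smul, mul_pow, Real.norm_eq_abs]
  gcongr
  exact hC z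

/-- The pointwise form of ∇u · ∇(W²u) = |∇(Wu)|² - |u ∇W|². -/
theorem inner_weight_identity (g w : ℂ) (a b : ℝ) :
    inner ℝ g (a • (a • g + b • w) + b • (a • w)) = ‖a • g + b • w‖ ^ 2 - ‖b • w‖ ^ 2 := by
  rw [@norm_add_sq_real ℂ]
  simp only [smul_add, inner_add_right, real_inner_smul_right, real_inner_smul_left, norm_smul,
    mul_pow, real_inner_self_eq_norm_sq, Real.norm_eq_abs, sq_abs]
  ring

/-- Testing the equation for `u` with `W² u`. -/
theorem WeakSolution.weight_identity (hs : WeakSolution α ω u G) (h : EnergyFun u G)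
    (hW : ContDiff ℝ (⊤ : ℕ∞) W) {C : ℝ} (hC : ∀ z, |W z| ≤ C)
    (hC' : ∀ k z, |fderiv ℝ W z (dir k)| ≤ C) :
    gradX (fun k z => W z • G k z + fderiv ℝ W z (dir k) • u z)
      + transverse ω (fun z => W z • u z) (fun k z => W z • G k z + fderiv ℝ W z (dir k) • u z)
      = (∑ k, normSq fun z => fderiv ℝ W z (dir k) • u z)
        + ∫ z, ‖u z‖ ^ α * ‖W z • u z‖ ^ 2 := by
  have h1 := h.mul_smooth hW hC hC'
  have h2 := h1.mul_smooth hW hC hC'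
  have key := hs _ _ h2
  have hDc : ∀ k, Continuous fun z => fderiv ℝ W z (dir k) := fun k =>
    (hW.continuous_fderiv (by simp)).clm_apply continuous_const
  have e1 : ∀ k, innerRe (G k) (fun z => W z • (W z • G k z + fderiv ℝ W z (dir k) • u z)
      + fderiv ℝ W z (dir k) • (W z • u z))
      = normSq (fun z => W z • G k z + fderiv ℝ W z (dir k) • u z)
        - normSq fun z => fderiv ℝ W z (dir k) • u z := by
    intro k
    unfold innerRe normSq
    rw [← integral_sub (integrable_normSq (h1.grad_memLp k))
      (integrable_normSq (memLp_smul_of_bounded (hDc k) (hC' k) h.memLp))]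
    congr 1 with z
    exact inner_weight_identity _ _ _ _
  have e2 : innerRe u (fun z => W z • W z • u z) = normSq fun z => W z • u z := by
    unfold innerRe normSq
    congr 1 with z
    rw [real_inner_smul_right, real_inner_smul_right, real_inner_self_eq_norm_sq, norm_smul,
      Real.norm_eq_abs, mul_pow, sq_abs]
    ring
  have e3 : innerRe (fun z => z.2 • u z) (fun z : Space d => z.2 • W z • W z • u z)
      = normSq fun z : Space d => z.2 • W z • u z := by
    unfold innerRe normSq
    congr 1 with z
    simp only [real_inner_smul_right, real_inner_smul_left, real_inner_self_eq_norm_sq, norm_smul,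
      Real.norm_eq_abs, mul_pow, sq_abs]
    ring
  have e4 : nonlin α u (fun z => W z • W z • u z) = ∫ z, ‖u z‖ ^ α * ‖W z • u z‖ ^ 2 := by
    unfold nonlin
    congr 1 with z
    rw [real_inner_smul_right, real_inner_smul_right, real_inner_self_eq_norm_sq, norm_smul,
      Real.norm_eq_abs, mul_pow, sq_abs]
    ring
  simp only [formX, formT, e1, e2, e3, e4, Finset.sum_sub_distrib] at key
  rw [← key]
  simp only [gradX, transverse, Fintype.sum_option]
  ring

/-- A weak solution satisfies weighted gradient bounds that do not depend on the size of
the weight. -/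
theorem Admissible.exists_weight_bound (ha : Admissible d α ω) (h : EnergyFun u G)
    (hs : WeakSolution α ω u G) :
    ∃ B : ℝ, ∀ (W : Space d → ℝ) (C : ℝ), ContDiff ℝ (⊤ : ℕ∞) W → (∀ z, |W z| ≤ C) →
      (∀ k z, |fderiv ℝ W z (dir k)| ≤ 1) → (∀ z, |W z| ≤ ‖z.1‖) →
      ∀ k, normSq (fun z => W z • G k z) ≤ B := by
  have hα := ha.α_pos
  have hp : 0 < α + 2 := by linarith
  have hω := ha.pos
  obtain ⟨S, hS, hS'⟩ := exists_powInt_rpow_le ha.two_le hα ha.upper one_pos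
  set K := (1 + S) * (1 + ω⁻¹) with hK
  have hK0 : 0 < K := by positivity
  have iu := ha.integrable_rpow h
  -- Outside a large cylinder u is so small in L^(α+2) that the nonlinear term there is at most half
  -- of the weighted energy E and can be absorbed.
  obtain ⟨R, hR⟩ := exists_setIntegral_compl_cylinder_lt iu
    (ε := (1 / (2 * K)) ^ ((α + 2) / α)) (by positivity)
  set N := powInt (α + 2) u with hN
  refine ⟨2 * (2 * ((d + 1) * normSq u + R ^ 2 * N)) + 2 * normSq u,
    fun W C hW hC hD hWx k => ?_⟩
  have hC1 : ∀ z, |W z| ≤ max C 1 := fun z => (hC z).trans (le_max_left _ _)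
  have hD1 : ∀ k z, |fderiv ℝ W z (dir k)| ≤ max C 1 := fun k z => (hD k z).trans (le_max_right _ _)
  have hDc : ∀ k, Continuous fun z => fderiv ℝ W z (dir k) := fun k =>
    (hW.continuous_fderiv (by simp)).clm_apply continuous_const
  have hE := h.mul_smooth hW hC1 hD1
  have key := hs.weight_identity h hW hC1 hD1
  set H : Option (Fin d) → Space d → ℂ := fun k z => W z • G k z + fderiv ℝ W z (dir k) • u z with hH
  set E := gradX H + transverse ω (fun z => W z • u z) H with hEdef
  have b1 : ∀ k, normSq (fun z => fderiv ℝ W z (dir k) • u z) ≤ normSq u := fun k => by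
    simpa using normSq_smul_le_of_bounded (hD k) h.memLp
  have b2 : ∑ k, normSq (fun z => fderiv ℝ W z (dir k) • u z) ≤ (d + 1) * normSq u := by
    refine (Finset.sum_le_sum fun k _ => b1 k).trans (le_of_eq ?_)
    simp
  set f : Space d → ℂ := (cylinder R)ᶜ.indicator u with hf
  have hmc : MeasurableSet ((cylinder R)ᶜ : Set (Space d)) := (measurableSet_cylinder R).compl
  have efn : (fun z => ‖f z‖ ^ (α + 2)) = (cylinder R)ᶜ.indicator fun z => ‖u z‖ ^ (α + 2) := by
    ext z
    by_cases hz : z ∈ ((cylinder R)ᶜ : Set (Space d))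
    · rw [hf, Set.indicator_of_mem hz, Set.indicator_of_mem hz]
    · rw [hf, Set.indicator_of_notMem hz, Set.indicator_of_notMem hz, norm_zero,
        Real.zero_rpow hp.ne']
  have hfi : Integrable fun z => ‖f z‖ ^ (α + 2) := by
    rw [efn]
    exact iu.indicator hmc
  have hfm : AEStronglyMeasurable f volume := h.memLp.1.indicator hmc
  have hfp : powInt (α + 2) f ^ (α / (α + 2)) ≤ 1 / (2 * K) := by
    have h1 : powInt (α + 2) f ≤ (1 / (2 * K)) ^ ((α + 2) / α) := by
      unfold powInt
      rw [efn, integral_indicator hmc]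
      exact hR.le
    have h2 := Real.rpow_le_rpow (powInt_nonneg _ _) h1 (show 0 ≤ α / (α + 2) by positivity)
    rwa [← Real.rpow_mul (by positivity), show (α + 2) / α * (α / (α + 2)) = 1 by field_simp,
      Real.rpow_one] at h2
  have iw := ha.integrable_rpow hE
  have iuw := integrable_rpow_mul_sq hα h.memLp.1 hE.memLp.1 iu iw
  have ifw := integrable_rpow_mul_sq hα hfm hE.memLp.1 hfi iw
  -- Inside the cylinder |W| ≤ |x| ≤ R. Only this and |∂_k W| ≤ 1 enter the final bound; the bound
  -- `C` of W merely makes W²u an admissible test function.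
  have b3 : ∫ z, ‖u z‖ ^ α * ‖W z • u z‖ ^ 2
      ≤ R ^ 2 * N + ∫ z, ‖f z‖ ^ α * ‖W z • u z‖ ^ 2 := by
    have e : R ^ 2 * N = ∫ z, R ^ 2 * ‖u z‖ ^ (α + 2) := by rw [integral_const_mul]; rfl
    rw [e, ← integral_add (iu.const_mul _) ifw]
    refine integral_mono iuw ((iu.const_mul _).add ifw) fun z => ?_
    simp only
    by_cases hz : z ∈ ((cylinder R)ᶜ : Set (Space d))
    · rw [hf, Set.indicator_of_mem hz]
      have : 0 ≤ R ^ 2 * ‖u z‖ ^ (α + 2) := by positivity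
      linarith
    · have hz' : ‖z.1‖ ≤ R := by
        by_contra hne
        exact hz hne
      have h1 : |W z| ≤ R := (hWx z).trans hz'
      have h2 : 0 ≤ ‖f z‖ ^ α * ‖W z • u z‖ ^ 2 := by positivity
      have h3 : ‖u z‖ ^ α * ‖W z • u z‖ ^ 2 ≤ R ^ 2 * ‖u z‖ ^ (α + 2) := by
        rw [Real.rpow_add' (norm_nonneg _) hp.ne', Real.rpow_two, norm_smul, mul_pow,
          Real.norm_eq_abs]
        calc ‖u z‖ ^ α * (|W z| ^ 2 * ‖u z‖ ^ 2) ≤ ‖u z‖ ^ α * (R ^ 2 * ‖u z‖ ^ 2) := by gcongr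
          _ = _ := by ring
      linarith
  have t0 := transverse_nonneg hω (fun z => W z • u z) H
  have g0 := gradX_nonneg H
  have b4 : powInt (α + 2) (fun z => W z • u z) ^ (2 / (α + 2)) ≤ K * E := by
    have h1 := hS' _ _ hE
    have h2 := normSq_le_h1Sq (fun z => W z • u z) H
    have h3 := (h1Sq_le_energySq (fun z => W z • u z) H).trans (energySq_le hω _ _)
    have h4 : h1Sq (fun z => W z • u z) H ≤ (1 + ω⁻¹) * E := by
      have : 0 ≤ ω⁻¹ * gradX H := by positivity
      rw [hEdef]
      linarith
    calc _ ≤ 1 * h1Sq (fun z => W z • u z) H + S * normSq (fun z => W z • u z) := h1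
      _ ≤ 1 * h1Sq (fun z => W z • u z) H + S * h1Sq (fun z => W z • u z) H := by gcongr
      _ = (1 + S) * h1Sq (fun z => W z • u z) H := by ring
      _ ≤ (1 + S) * ((1 + ω⁻¹) * E) := by gcongr
      _ = K * E := by rw [hK]; ring
  have b5 : ∫ z, ‖f z‖ ^ α * ‖W z • u z‖ ^ 2 ≤ 1 / 2 * E := by
    refine (integral_rpow_mul_sq_le hα hfm hE.memLp.1 hfi iw).trans ?_
    have hnn : 0 ≤ powInt (α + 2) (fun z => W z • u z) ^ (2 / (α + 2)) :=
      Real.rpow_nonneg (powInt_nonneg _ _) _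
    calc _ ≤ 1 / (2 * K) * (K * E) := mul_le_mul hfp b4 hnn (by positivity)
      _ = 1 / 2 * E := by field_simp
  have b6 : E ≤ 2 * ((d + 1) * normSq u + R ^ 2 * N) := by linarith
  have b7 : normSq (H k) ≤ E := by
    rcases k with _ | i
    · have := normSq_nonneg fun z : Space d => z.2 • W z • u z
      have := mul_nonneg hω.le (normSq_nonneg fun z => W z • u z)
      have : normSq (H none) ≤ transverse ω (fun z => W z • u z) H := by
        unfold transverse
        linarith
      linarith
    · have : normSq (H (some i)) ≤ gradX H :=
        Finset.single_le_sum (f := fun i => normSq (H (some i))) (fun _ _ => normSq_nonneg _)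
          (Finset.mem_univ i)
      linarith
  have e : (fun z => W z • G k z) = H k - fun z => fderiv ℝ W z (dir k) • u z := by
    ext z
    simp [hH]
  rw [e]
  refine (normSq_sub_le (hE.grad_memLp k)
    (memLp_smul_of_bounded (hDc k) (hD k) h.memLp)).trans ?_
  linarith [b1 k]

/-- Bounded approximations of a coordinate. -/
def saturate (ε s : ℝ) : ℝ := s / (1 + ε * s ^ 2)

theorem contDiff_saturate {ε : ℝ} (hε : 0 < ε) : ContDiff ℝ (⊤ : ℕ∞) (saturate ε) :=
  contDiff_id.div (contDiff_const.add (contDiff_const.mul (contDiff_id.pow 2)))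
    fun s => by positivity

theorem abs_saturate_le {ε : ℝ} (hε : 0 < ε) (s : ℝ) : |saturate ε s| ≤ |s| := by
  have h : 0 ≤ ε * s ^ 2 := by positivity
  rw [saturate, abs_div, abs_of_pos (by positivity : 0 < 1 + ε * s ^ 2)]
  exact div_le_self (abs_nonneg _) (by linarith)

theorem abs_saturate_le_const {ε : ℝ} (hε : 0 < ε) (s : ℝ) : |saturate ε s| ≤ 1 + ε⁻¹ := by
  have h : 0 ≤ ε * s ^ 2 := by positivity
  rw [saturate, abs_div, abs_of_pos (by positivity : 0 < 1 + ε * s ^ 2), div_le_iff₀ (by positivity)]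
  have h1 : |s| ≤ 1 + s ^ 2 := by
    rw [← sq_abs s]
    nlinarith [sq_nonneg (|s| - 1)]
  have h2 : (1 + ε⁻¹) * (1 + ε * s ^ 2) = 1 + s ^ 2 + ε⁻¹ + ε * s ^ 2 := by
    field_simp
    ring
  have : 0 < ε⁻¹ := by positivity
  linarith

theorem abs_deriv_saturate_le {ε : ℝ} (hε : 0 < ε) (s : ℝ) : |deriv (saturate ε) s| ≤ 1 := by
  have h : 0 ≤ ε * s ^ 2 := by positivity
  have hd : HasDerivAt (saturate ε) ((1 * (1 + ε * s ^ 2) - s * (ε * (2 * s))) / (1 + ε * s ^ 2) ^ 2)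
      s := by
    refine (hasDerivAt_id s).div ?_ (by positivity)
    have := ((hasDerivAt_pow 2 s).const_mul ε).const_add 1
    simpa using this
  rw [hd.deriv, abs_div, abs_of_pos (by positivity : 0 < (1 + ε * s ^ 2) ^ 2),
    div_le_one (by positivity), abs_le]
  constructor <;> nlinarith

/-- The gradient of a weak solution has finite first moments in `x`. -/
theorem Admissible.memLp_coord_smul_grad (ha : Admissible d α ω) (h : EnergyFun u G)
    (hs : WeakSolution α ω u G) (i : Fin d) (k : Option (Fin d)) :
    MemLp (fun z : Space d => z.1 i • G k z) 2 := by
  obtain ⟨B, hB⟩ := ha.exists_weight_bound h hs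
  have hcoord : ContDiff ℝ (⊤ : ℕ∞) fun z : Space d => z.1 i :=
    ((EuclideanSpace.proj i : EuclideanSpace ℝ (Fin d) →L[ℝ] ℝ).comp
      (ContinuousLinearMap.fst ℝ _ ℝ)).contDiff
  set ε : ℕ → ℝ := fun n => 1 / ((n : ℝ) + 1) with hε
  have hε0 : ∀ n, 0 < ε n := fun n => by positivity
  -- Bounded weights with slope at most 1 that converge pointwise to x_i; the uniform bound passes
  -- to the limit by Fatou's lemma.
  set W : ℕ → Space d → ℝ := fun n z => saturate (ε n) (z.1 i) with hW
  have hWs : ∀ n, ContDiff ℝ (⊤ : ℕ∞) (W n) := fun n => (contDiff_saturate (hε0 n)).comp hcoord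
  have hWb : ∀ n z, |W n z| ≤ 1 + (ε n)⁻¹ := fun n z => abs_saturate_le_const (hε0 n) _
  have hbd : ∀ n, normSq (fun z => W n z • G k z) ≤ B := by
    intro n
    refine hB (W n) _ (hWs n) (hWb n) (fun k z => ?_) (fun z => ?_) k
    · have hd1 : HasFDerivAt (fun z : Space d => z.1 i)
          ((EuclideanSpace.proj i : EuclideanSpace ℝ (Fin d) →L[ℝ] ℝ).comp
            (ContinuousLinearMap.fst ℝ _ ℝ)) z :=
        ((EuclideanSpace.proj i : EuclideanSpace ℝ (Fin d) →L[ℝ] ℝ).comp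
          (ContinuousLinearMap.fst ℝ _ ℝ)).hasFDerivAt
      have hd2 := (((contDiff_saturate (hε0 n)).differentiable (by simp)) (z.1 i)).hasDerivAt
      have hd3 := hd2.comp_hasFDerivAt z hd1
      have e : fderiv ℝ (W n) z (dir k) = deriv (saturate (ε n)) (z.1 i) * (dir k : Space d).1 i := by
        have : W n = saturate (ε n) ∘ fun z : Space d => z.1 i := rfl
        rw [this, hd3.fderiv]
        simp
      rw [e, abs_mul]
      have h2 : |(dir k : Space d).1 i| ≤ 1 := by
        rcases k with _ | j
        · simp [dir, dirY]
        · simp only [dir, dirX, PiLp.single_apply]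
          split_ifs <;> simp
      exact mul_le_one₀ (abs_deriv_saturate_le (hε0 n) _) (abs_nonneg _) h2
    · exact (abs_saturate_le (hε0 n) _).trans (PiLp.norm_apply_le z.1 i)
  have hmem : ∀ n, MemLp (fun z => W n z • G k z) 2 volume := fun n =>
    memLp_smul_of_bounded (hWs n).continuous (hWb n) (h.grad_memLp k)
  have hmeas : AEStronglyMeasurable (fun z : Space d => z.1 i • G k z) volume :=
    hcoord.continuous.aestronglyMeasurable.smul (h.grad_memLp k).1
  refine ⟨hmeas, ?_⟩
  have hlim : ∀ z : Space d, Tendsto (fun n => W n z • G k z) atTop (𝓝 (z.1 i • G k z)) := by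
    intro z
    refine Tendsto.smul_const ?_ _
    have h1 : Tendsto ε atTop (𝓝 0) := tendsto_one_div_add_atTop_nhds_zero_nat
    have h2 : Tendsto (fun n => z.1 i / (1 + ε n * (z.1 i) ^ 2)) atTop
        (𝓝 (z.1 i / (1 + 0 * (z.1 i) ^ 2))) :=
      tendsto_const_nhds.div (tendsto_const_nhds.add (h1.mul_const _)) (by simp)
    rw [zero_mul, add_zero, div_one] at h2
    exact h2
  have h3 := Lp.eLpNorm_lim_le_liminf_eLpNorm (p := 2) (fun n => (hmem n).1)
    (fun z : Space d => z.1 i • G k z) (Eventually.of_forall hlim)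
  have h4 : liminf (fun n => eLpNorm (fun z => W n z • G k z) 2 (volume : Measure (Space d))) atTop
      ≤ ENNReal.ofReal √B := by
    refine liminf_le_of_frequently_le' (Frequently.of_forall fun n => ?_)
    rw [eLpNorm_sq_eq (hmem n)]
    exact ENNReal.ofReal_le_ofReal (Real.sqrt_le_sqrt (hbd n))
  exact (h3.trans h4).trans_lt ENNReal.ofReal_lt_top

end Weight

end PHNLS

end

noncomputable section

namespace PHNLS

open Filter Topology ENNReal

variable {d : ℕ} {α ω : ℝ}

/-! ### Lipschitz continuity of dilations -/

/-- The dilation of a test function that is dual to `dilate (exp s)`. -/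
def dualDilate (ψ : Space d → ℝ) (s : ℝ) (z : Space d) : ℝ :=
  Real.exp (-s * (d / 2)) * ψ (Real.exp (-s) • z.1, z.2)

section DualDilate

variable {ψ : Space d → ℝ}

theorem toC_dualDilate (ψ : Space d → ℝ) (s : ℝ) :
    toC (dualDilate ψ s) = dilate (Real.exp (-s)) (toC ψ) := by
  ext z
  simp only [toC, dualDilate, dilate, Complex.ofReal_mul, Complex.real_smul, Real.exp_mul]

theorem IsTest.dualDilate (hψ : IsTest ψ) (s : ℝ) : IsTest (dualDilate ψ s) := by
  refine ⟨contDiff_const.mul (hψ.1.comp (dilateEquiv (Real.exp_pos (-s)).ne').contDiff), ?_⟩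
  exact (hψ.2.comp_homeomorph (dilateEquiv (Real.exp_pos (-s)).ne').toHomeomorph).mul_left
    (f := fun _ => Real.exp (-s * (d / 2)))

/-- The dilation is moved to the test function, which, unlike u, can be differentiated in the
parameter. -/
theorem integral_smul_dilate_exp (ψ : Space d → ℝ) (u : Space d → ℂ) (s : ℝ) :
    ∫ z, ψ z • dilate (Real.exp s) u z = ∫ z, dualDilate ψ s z • u z := by
  have h := integral_comp_dilate (d := d) (Real.exp_pos s) fun z => dualDilate ψ s z • u z
  have e : ∀ z : Space d, dualDilate ψ s (Real.exp s • z.1, z.2) • u (Real.exp s • z.1, z.2)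
      = (Real.exp (-s * (d / 2)) * (Real.exp s ^ ((d : ℝ) / 2))⁻¹)
        • (ψ z • dilate (Real.exp s) u z) := by
    intro z
    have hne : Real.exp s ^ ((d : ℝ) / 2) ≠ 0 := (Real.rpow_pos_of_pos (Real.exp_pos s) _).ne'
    simp only [dualDilate, dilate, smul_smul, ← Real.exp_add, neg_add_cancel, Real.exp_zero,
      one_smul]
    congr 1
    field_simp
  simp only [e] at h
  rw [integral_smul] at h
  have e2 : Real.exp (-s * (d / 2)) * (Real.exp s ^ ((d : ℝ) / 2))⁻¹ = (Real.exp s ^ d)⁻¹ := by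
    rw [← Real.exp_mul, ← Real.exp_neg, ← Real.exp_add, ← Real.exp_nat_mul, ← Real.exp_neg]
    congr 1
    ring
  rw [e2] at h
  exact smul_right_injective _ (inv_ne_zero (pow_pos (Real.exp_pos s) d).ne') h

theorem fderiv_dualDilate (hψ : IsTest ψ) (s : ℝ) (z v : Space d) :
    fderiv ℝ (dualDilate ψ s) z v
      = Real.exp (-s * (d / 2)) * fderiv ℝ ψ (Real.exp (-s) • z.1, z.2) (Real.exp (-s) • v.1, v.2) := by
  have h1 := (hψ.differentiable (dilateEquiv (Real.exp_pos (-s)).ne' z)).hasFDerivAt.comp z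
    (dilateEquiv (d := d) (Real.exp_pos (-s)).ne').hasFDerivAt
  have h2 := h1.const_mul (Real.exp (-s * (d / 2)))
  have e : dualDilate ψ s = fun z => Real.exp (-s * (d / 2))
    * (ψ ∘ (dilateEquiv (d := d) (Real.exp_pos (-s)).ne')) z := rfl
  rw [e, h2.fderiv]
  simp

theorem hasDerivAt_dualDilate (hψ : IsTest ψ) (s : ℝ) (z : Space d) :
    HasDerivAt (fun s => dualDilate ψ s z)
      (-(d / 2) * dualDilate ψ s z - fderiv ℝ (dualDilate ψ s) z (z.1, 0)) s := by
  have h1 : HasDerivAt (fun s : ℝ => Real.exp (-s)) (-Real.exp (-s)) s := by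
    simpa using (hasDerivAt_neg s).exp
  have h2 : HasDerivAt (fun s : ℝ => ((Real.exp (-s) • z.1, z.2) : Space d))
      ((-Real.exp (-s)) • z.1, 0) s := (h1.smul_const z.1).prodMk (hasDerivAt_const s z.2)
  have h3 := (hψ.differentiable (Real.exp (-s) • z.1, z.2)).hasFDerivAt.comp_hasDerivAt s h2
  have h4 : HasDerivAt (fun s : ℝ => Real.exp (-s * (d / 2)))
      (Real.exp (-s * (d / 2)) * (-1 * (d / 2))) s := by
    exact ((hasDerivAt_neg s).mul_const ((d : ℝ) / 2)).exp
  refine (h4.mul h3).congr_deriv ?_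
  rw [fderiv_dualDilate hψ, dualDilate]
  have : ((-Real.exp (-s)) • z.1, (0 : ℝ)) = (-1 : ℝ) • ((Real.exp (-s) • z.1, 0) : Space d) := by
    simp
  rw [this, map_smul, smul_eq_mul]
  simp only [Function.comp_apply]
  ring

theorem contDiff_coordX (i : Fin d) : ContDiff ℝ (⊤ : ℕ∞) fun z : Space d => z.1 i :=
  ((EuclideanSpace.proj i : EuclideanSpace ℝ (Fin d) →L[ℝ] ℝ).comp
    (ContinuousLinearMap.fst ℝ _ ℝ)).contDiff

theorem fderiv_coordX (i : Fin d) (z v : Space d) :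
    fderiv ℝ (fun z : Space d => z.1 i) z v = v.1 i := by
  have := ((EuclideanSpace.proj i : EuclideanSpace ℝ (Fin d) →L[ℝ] ℝ).comp
    (ContinuousLinearMap.fst ℝ _ ℝ)).hasFDerivAt (x := z)
  exact congrArg (fun L => L v) this.fderiv

/-- Divergence form x·∇ψ = div(xψ) - dψ of the generator. After integration by parts u enters only
through itself and the moments x_i ∂_i u. -/
theorem fderiv_apply_fst (hψ : IsTest ψ) (z : Space d) :
    fderiv ℝ ψ z (z.1, 0)
      = (∑ i : Fin d, fderiv ℝ (fun z => ψ z * z.1 i) z (dirX i)) - d * ψ z := by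
  have e1 : ∀ i : Fin d, fderiv ℝ (fun z => ψ z * z.1 i) z (dirX i)
      = ψ z + z.1 i * fderiv ℝ ψ z (dirX i) := by
    intro i
    rw [fderiv_fun_mul hψ.differentiable.differentiableAt
      ((contDiff_coordX i).differentiable (by simp)).differentiableAt]
    simp [fderiv_coordX, dirX]
  have e2 : ((z.1, 0) : Space d) = ∑ i : Fin d, z.1 i • dirX i := by
    have := sum_coord_smul_dir ((z.1, 0) : Space d)
    rw [Fintype.sum_option] at this
    simpa [coord, dir] using this.symm
  rw [e2, map_sum]
  simp only [e1, Finset.sum_add_distrib, map_smul, smul_eq_mul]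
  simp

end DualDilate

/-- Dilations move a function with finite first moments of the gradient by at most a multiple
of the logarithm of the factor. -/
theorem EnergyFun.exists_normSq_dilate_sub_le {u : Space d → ℂ} {G : Option (Fin d) → Space d → ℂ}
    (h : EnergyFun u G) (hx : ∀ i : Fin d, MemLp (fun z : Space d => z.1 i • G (some i) z) 2) :
    ∃ C : ℝ, 0 ≤ C ∧ ∀ t : ℝ, |t| ≤ 1 →
      normSq (PHNLS.dilate (Real.exp t) u - u) ≤ C * t ^ 2 := by
  set S : ℝ := d / 2 * √(normSq u) + ∑ i : Fin d, √(normSq fun z : Space d => z.1 i • G (some i) z)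
    with hS
  have hS0 : 0 ≤ S := by
    have := Finset.sum_nonneg fun i (_ : i ∈ Finset.univ) =>
      Real.sqrt_nonneg (normSq fun z : Space d => z.1 i • G (some i) z)
    have := Real.sqrt_nonneg (normSq u)
    positivity
  refine ⟨(4 * S) ^ 2, by positivity, fun t ht => ?_⟩
  have hmem := memLp_dilate h.memLp (Real.exp_pos t)
  have key := normSq_le_of_test (hmem.sub h.memLp) (K := 2 * S * |t|) (by positivity) fun ψ hψ => ?_
  · refine key.trans (le_of_eq ?_)
    rw [← sq_abs t]
    ring
  have e1 : ∫ z, ψ z • ((PHNLS.dilate (Real.exp t) u - u) z)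
      = (∫ z, dualDilate ψ t z • u z) - ∫ z, dualDilate ψ 0 z • u z := by
    simp only [Pi.sub_apply, smul_sub]
    rw [integral_sub (integrable_smul_of_test hψ.1.continuous hψ.2 hmem)
      (integrable_smul_of_test hψ.1.continuous hψ.2 h.memLp), integral_smul_dilate_exp]
    simp [dualDilate]
  set K : Set (Space d) := (fun q : ℝ × Space d => ((Real.exp q.1 • q.2.1, q.2.2) : Space d)) ''
    (Set.Icc (-2 : ℝ) 2 ×ˢ tsupport ψ) with hKdef
  have hK : IsCompact K := (isCompact_Icc.prod hψ.2).image (by fun_prop)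
  have hout : ∀ s ∈ Set.Icc (-2 : ℝ) 2, ∀ z ∉ K,
      ((Real.exp (-s) • z.1, z.2) : Space d) ∉ tsupport ψ := by
    intro s hs z hz hmem
    refine hz ⟨(s, (Real.exp (-s) • z.1, z.2)), ⟨hs, hmem⟩, ?_⟩
    simp [smul_smul, ← Real.exp_add]
  have := norm_integral_sub_le_of_deriv h.memLp (Ψ := dualDilate ψ)
    (Ψ' := fun s z => -(d / 2) * dualDilate ψ s z - fderiv ℝ (dualDilate ψ s) z (z.1, 0))
    (fun s z => hasDerivAt_dualDilate hψ s z) (fun s => (hψ.dualDilate s).1.continuous) ?_ hK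
    (fun s hs z hz => ?_) (B := 2 * S * √(normSq (toC ψ))) (fun s _ => ?_) (t := t) (abs_le.1 ht)
  · rw [e1]
    refine this.trans (le_of_eq ?_)
    ring
  · have c1 : Continuous fun q : ℝ × Space d => ((Real.exp (-q.1) • q.2.1, q.2.2) : Space d) := by
      fun_prop
    have c2 : Continuous fun q : ℝ × Space d => fderiv ℝ ψ (Real.exp (-q.1) • q.2.1, q.2.2)
        (Real.exp (-q.1) • q.2.1, 0) :=
      ((hψ.1.continuous_fderiv (by simp)).comp c1).clm_apply (by fun_prop)
    have c3 : Continuous fun q : ℝ × Space d => ψ (Real.exp (-q.1) • q.2.1, q.2.2) :=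
      hψ.1.continuous.comp c1
    have c4 : Continuous fun q : ℝ × Space d => Real.exp (-q.1 * (d / 2)) := by fun_prop
    simp only [Function.uncurry_def, fderiv_dualDilate hψ, dualDilate]
    exact (continuous_const.mul (c4.mul c3)).sub (c4.mul c2)
  · have hz' := hout s hs z hz
    have z1 : ψ (Real.exp (-s) • z.1, z.2) = 0 := image_eq_zero_of_notMem_tsupport hz'
    have z2 : fderiv ℝ ψ (Real.exp (-s) • z.1, z.2) = 0 :=
      image_eq_zero_of_notMem_tsupport fun hm => hz' (tsupport_fderiv_subset ℝ hm)
    simp [dualDilate, fderiv_dualDilate hψ, z1, z2]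
  · have hT := hψ.dualDilate s
    have hTi : ∀ i : Fin d, IsTest fun z => dualDilate ψ s z * z.1 i := fun i =>
      hT.mul_contDiff (contDiff_coordX i)
    have hn : normSq (toC (dualDilate ψ s)) = normSq (toC ψ) := by
      rw [toC_dualDilate, normSq_dilate (Real.exp_pos _)]
    have i1 : Integrable fun z => ((d : ℝ) / 2) • dualDilate ψ s z • u z :=
      (integrable_smul_of_test hT.1.continuous hT.2 h.memLp).smul ((d : ℝ) / 2)
    have i2 : ∀ i : Fin d, Integrable fun z =>
        fderiv ℝ (fun z => dualDilate ψ s z * z.1 i) z (dirX i) • u z := fun i =>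
      integrable_smul_of_test ((hTi i).fderiv_continuous _) ((hTi i).fderiv_hasCompactSupport _)
        h.memLp
    -- The divergence form contributes +d, which turns the coefficient -d/2 into d/2.
    have e2 : ∫ z, (-(d / 2) * dualDilate ψ s z - fderiv ℝ (dualDilate ψ s) z (z.1, 0)) • u z
        = ((d : ℝ) / 2) • (∫ z, dualDilate ψ s z • u z)
          + ∑ i : Fin d, ∫ z, dualDilate ψ s z • (z.1 i • G (some i) z) := by
      have e3 : ∀ z, (-(d / 2) * dualDilate ψ s z - fderiv ℝ (dualDilate ψ s) z (z.1, 0)) • u z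
          = ((d : ℝ) / 2) • dualDilate ψ s z • u z
            - ∑ i : Fin d, fderiv ℝ (fun z => dualDilate ψ s z * z.1 i) z (dirX i) • u z := by
        intro z
        rw [fderiv_apply_fst hT, ← Finset.sum_smul, smul_smul, ← sub_smul]
        congr 1
        ring
      simp only [e3]
      rw [integral_sub i1 (integrable_finsetSum _ fun i _ => i2 i), integral_smul,
        integral_finsetSum _ fun i _ => i2 i, sub_eq_add_neg, ← Finset.sum_neg_distrib]
      congr 1
      refine Finset.sum_congr rfl fun i _ => ?_
      have := h.weak (some i) _ (hTi i)
      simp only [dir] at this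
      rw [this, neg_neg]
      simp only [mul_smul]
    rw [e2]
    have b1 := norm_integral_smul_le hT.1.continuous hT.2 h.memLp
    rw [hn] at b1
    have b2 : ∀ i : Fin d, ‖∫ z, dualDilate ψ s z • (z.1 i • G (some i) z)‖
        ≤ 2 * √(normSq (toC ψ)) * √(normSq fun z : Space d => z.1 i • G (some i) z) := by
      intro i
      have := norm_integral_smul_le hT.1.continuous hT.2 (hx i)
      rwa [hn] at this
    refine (norm_add_le _ _).trans ?_
    rw [norm_smul, Real.norm_of_nonneg (by positivity)]
    have b3 := (norm_sum_le Finset.univ fun i : Fin d =>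
      ∫ z, dualDilate ψ s z • (z.1 i • G (some i) z)).trans (Finset.sum_le_sum fun i _ => b2 i)
    rw [← Finset.mul_sum] at b3
    have b4 := mul_le_mul_of_nonneg_left b1 (show (0 : ℝ) ≤ d / 2 by positivity)
    rw [hS]
    linarith

end PHNLS

end

noncomputable section

namespace PHNLS

open Filter Topology ENNReal

variable {d : ℕ} {α ω : ℝ}

/-! ### The Pohozaev identity -/

/-- A real-variable form of the Pohozaev argument: the equation tested with the increment of the
dilation flow at the parameters `t` and `-t`. -/
theorem eq_of_dilation_expansion {A F κ C : ℝ} (hA : 0 ≤ A) (hF : 0 ≤ F) {g δ D : ℝ → ℝ}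
    (heq : ∀ t, |t| ≤ 1 → (Real.exp t - 1) * g t - δ t = (Real.exp (κ * t) - 1) * F - D t)
    (hg : ∀ t, g (-t) = g t) (hδ : ∀ t, δ (-t) = δ t) (hD : ∀ t, |t| ≤ 1 → 0 ≤ D t)
    (hgA : ∀ t, g t ≤ A) (hAg : ∀ t, A - g t ≤ δ t)
    (hDδ : ∀ t, |t| ≤ 1 → D t ≤ δ t / 2 + C * t ^ 2) : A = κ * F := by
  -- In the sum of the identities at t and -t the first-order terms cancel. The two remainders
  -- together cost only one δ out of the two on the left, so δ itself is quadratic.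
  have hC : ∀ t, |t| ≤ 1 → δ t ≤ (2 * A + 2 * C) * t ^ 2 := by
    intro t ht
    have ht' : |-t| ≤ 1 := by rwa [abs_neg]
    have h1 := heq t ht
    have h2 := heq (-t) ht'
    rw [hg, hδ] at h2
    have h3 := hDδ t ht
    have h4 := hDδ (-t) ht'
    rw [hδ, neg_sq] at h4
    have h5 := (abs_le.1 (Real.abs_exp_sub_one_sub_id_le ht)).2
    have h6 := (abs_le.1 (Real.abs_exp_sub_one_sub_id_le ht')).2
    rw [neg_sq] at h6
    have h7 : 0 ≤ Real.exp t + Real.exp (-t) - 2 := by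
      linarith [Real.add_one_le_exp t, Real.add_one_le_exp (-t)]
    have h8 : 0 ≤ Real.exp (κ * t) + Real.exp (κ * -t) - 2 := by
      have := Real.add_one_le_exp (κ * t)
      have := Real.add_one_le_exp (κ * -t)
      linarith
    have h9 : (Real.exp t + Real.exp (-t) - 2) * g t ≤ 2 * t ^ 2 * A := by
      calc (Real.exp t + Real.exp (-t) - 2) * g t ≤ (Real.exp t + Real.exp (-t) - 2) * A :=
            mul_le_mul_of_nonneg_left (hgA t) h7
        _ ≤ 2 * t ^ 2 * A := mul_le_mul_of_nonneg_right (by linarith) hA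
    have h10 := mul_nonneg h8 hF
    nlinarith
  set C' := 2 * A + 2 * C with hC'
  -- Now A - g, δ and D are all O(t²), so the derivative A - κF of this function at 0 vanishes.
  have key : ∀ t : ℝ, |t| ≤ 1 →
      |((Real.exp t - 1) * A - (Real.exp (κ * t) - 1) * F)
        - ((Real.exp 0 - 1) * A - (Real.exp (κ * 0) - 1) * F) - t * 0|
      ≤ (2 * C' + C' + (C' / 2 + C)) * t ^ 2 := by
    intro t ht
    have h1 := heq t ht
    have h2 := hC t ht
    have h3 := hDδ t ht
    have h4 := hD t ht
    have h5 := hAg t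
    have h6 := hgA t
    have h7 := (Real.abs_exp_sub_one_le ht).trans (mul_le_mul_of_nonneg_left ht zero_le_two)
    have h8 : |(Real.exp t - 1) * (A - g t)| ≤ 2 * (C' * t ^ 2) := by
      rw [abs_mul, abs_of_nonneg (by linarith : 0 ≤ A - g t)]
      exact mul_le_mul (by linarith) (by linarith) (by linarith) zero_le_two
    have e : ((Real.exp t - 1) * A - (Real.exp (κ * t) - 1) * F)
        - ((Real.exp 0 - 1) * A - (Real.exp (κ * 0) - 1) * F) - t * 0
        = (Real.exp t - 1) * (A - g t) + (δ t - D t) := by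
      simp only [mul_zero, Real.exp_zero, sub_self, zero_mul]
      linarith
    rw [e]
    obtain ⟨h9, h10⟩ := abs_le.1 h8
    rw [abs_le]
    constructor <;> nlinarith
  have d1 := hasDerivAt_of_quadratic_bound
    (f := fun t => (Real.exp t - 1) * A - (Real.exp (κ * t) - 1) * F) key
  have d2 : HasDerivAt (fun t => (Real.exp t - 1) * A - (Real.exp (κ * t) - 1) * F)
      (Real.exp 0 * A - Real.exp (κ * 0) * (κ * 1) * F) 0 :=
    (((Real.hasDerivAt_exp 0).sub_const 1).mul_const A).sub
      (((((hasDerivAt_id (0 : ℝ)).const_mul κ).exp).sub_const 1).mul_const F)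
  have := d1.unique d2
  simp only [mul_zero, Real.exp_zero, one_mul, mul_one] at this
  linarith

section Pohozaev

variable {u : Space d → ℂ} {G : Option (Fin d) → Space d → ℂ}

/-- Dilations form a unitary group on L², so correlations are even in t. This symmetry cancels the
first-order terms in `eq_of_dilation_expansion`. -/
theorem innerRe_dilate_exp_neg (f : Space d → ℂ) (t : ℝ) :
    innerRe f (dilate (Real.exp (-t)) f) = innerRe f (dilate (Real.exp t) f) := by
  rw [← innerRe_dilate (Real.exp_pos t) f (dilate (Real.exp (-t)) f),
    dilate_dilate (Real.exp_pos _) (Real.exp_pos _), ← Real.exp_add, neg_add_cancel, Real.exp_zero,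
    dilate_one, innerRe_comm]

theorem normSq_dilate_sub {f : Space d → ℂ} (hf : MemLp f 2) (t : ℝ) :
    normSq (dilate (Real.exp t) f - f)
      = 2 * (normSq f - innerRe f (dilate (Real.exp t) f)) := by
  rw [normSq_sub (memLp_dilate hf (Real.exp_pos t)) hf, normSq_dilate (Real.exp_pos t),
    innerRe_comm]
  ring

/-- The correlation of the gradient in `x` with its dilation. -/
def corrX (G : Option (Fin d) → Space d → ℂ) (t : ℝ) : ℝ :=
  ∑ i : Fin d, innerRe (G (some i)) (dilate (Real.exp t) (G (some i)))

/-- The correlation of the transverse part with its dilation. -/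
def corrT (ω : ℝ) (u : Space d → ℂ) (G : Option (Fin d) → Space d → ℂ) (t : ℝ) : ℝ :=
  innerRe (G none) (dilate (Real.exp t) (G none))
    + innerRe (fun z => z.2 • u z) (dilate (Real.exp t) fun z => z.2 • u z)
    + ω * innerRe u (dilate (Real.exp t) u)

theorem EnergyFun.gradX_sub_corrX (h : EnergyFun u G) (t : ℝ) :
    gradX G - corrX G t
      = 1 / 2 * ∑ i : Fin d, normSq (PHNLS.dilate (Real.exp t) (G (some i)) - G (some i)) := by
  rw [gradX, corrX, ← Finset.sum_sub_distrib, Finset.mul_sum]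
  refine Finset.sum_congr rfl fun i _ => ?_
  rw [normSq_dilate_sub (h.grad_memLp _)]
  ring

theorem EnergyFun.transverse_sub_corrT (h : EnergyFun u G) (t : ℝ) :
    transverse ω u G - corrT ω u G t
      = 1 / 2 * normSq (PHNLS.dilate (Real.exp t) (G none) - G none)
        + 1 / 2 * normSq (PHNLS.dilate (Real.exp t) (fun z => z.2 • u z) - fun z => z.2 • u z)
        + ω / 2 * normSq (PHNLS.dilate (Real.exp t) u - u) := by
  rw [transverse, corrT, normSq_dilate_sub (h.grad_memLp _), normSq_dilate_sub h.weight_memLp,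
    normSq_dilate_sub h.memLp]
  ring

/-- The x-gradient of a dilate carries an extra factor e^t. It produces the first-order term; all
the rest is a loss of correlation. -/
theorem EnergyFun.defect_dilate_sub (h : EnergyFun u G) (t : ℝ) :
    formX G (dilateGrad (Real.exp t) G - G)
      + formT ω u G (PHNLS.dilate (Real.exp t) u - u) (dilateGrad (Real.exp t) G - G)
      = (Real.exp t - 1) * corrX G t
        - (gradX G - corrX G t + (transverse ω u G - corrT ω u G t)) := by
  have hd := h.dilate (Real.exp_pos t)
  have e1 : formX G (dilateGrad (Real.exp t) G - G) = Real.exp t * corrX G t - gradX G := by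
    rw [formX, corrX, gradX, Finset.mul_sum, ← Finset.sum_sub_distrib]
    refine Finset.sum_congr rfl fun i _ => ?_
    rw [Pi.sub_apply, innerRe_sub_right (hd.grad_memLp _) (h.grad_memLp _) (h.grad_memLp _),
      innerRe_self, dilateGrad, innerRe_smul_right]
  have e2 : formT ω u G (PHNLS.dilate (Real.exp t) u - u) (dilateGrad (Real.exp t) G - G)
      = corrT ω u G t - transverse ω u G := by
    have e : (fun z : Space d => z.2 • (PHNLS.dilate (Real.exp t) u - u) z)
        = PHNLS.dilate (Real.exp t) (fun z => z.2 • u z) - fun z => z.2 • u z := by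
      rw [dilate_weight]
      ext z
      simp [mul_sub]
    rw [formT, e, Pi.sub_apply, innerRe_sub_right (hd.grad_memLp _) (h.grad_memLp _)
      (h.grad_memLp _), innerRe_sub_right (memLp_dilate h.weight_memLp (Real.exp_pos t))
      h.weight_memLp h.weight_memLp, innerRe_sub_right hd.memLp h.memLp h.memLp, innerRe_self,
      innerRe_self, innerRe_self, transverse, corrT, dilateGrad]
    ring
  rw [e1, e2]
  ring

/-- In the x components the extra factor e^t costs O(t²), and what remains is measured by the loss
of correlation, which is half a squared distance. -/
theorem EnergyFun.h1Sq_dilate_sub_le (hω : 0 < ω) (h : EnergyFun u G) {t : ℝ} (ht : |t| ≤ 1) :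
    h1Sq (PHNLS.dilate (Real.exp t) u - u) (dilateGrad (Real.exp t) G - G)
      ≤ normSq (PHNLS.dilate (Real.exp t) u - u) + 8 * t ^ 2 * gradX G
        + 4 * (gradX G - corrX G t + (transverse ω u G - corrT ω u G t)) := by
  have hl := Real.exp_pos t
  have b1 : ∀ i : Fin d, normSq ((dilateGrad (Real.exp t) G - G) (some i))
      ≤ 8 * t ^ 2 * normSq (G (some i))
        + 2 * normSq (PHNLS.dilate (Real.exp t) (G (some i)) - G (some i)) := by
    intro i
    have hm := h.grad_memLp (some i)
    have e : (dilateGrad (Real.exp t) G - G) (some i)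
        = (Real.exp t - 1) • PHNLS.dilate (Real.exp t) (G (some i))
          + (PHNLS.dilate (Real.exp t) (G (some i)) - G (some i)) := by
      rw [Pi.sub_apply, dilateGrad, sub_smul, one_smul]
      abel
    rw [e]
    refine (normSq_add_le ((memLp_dilate hm hl).const_smul _)
      ((memLp_dilate hm hl).sub hm)).trans ?_
    rw [normSq_smul, normSq_dilate hl]
    have h1 : (Real.exp t - 1) ^ 2 ≤ 4 * t ^ 2 := by
      rw [← sq_abs, ← sq_abs t]
      calc |Real.exp t - 1| ^ 2 ≤ (2 * |t|) ^ 2 := by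
            gcongr
            exact Real.abs_exp_sub_one_le ht
        _ = _ := by ring
    have := mul_le_mul_of_nonneg_right h1 (normSq_nonneg (G (some i)))
    linarith
  have b2 := Finset.sum_le_sum fun i (_ : i ∈ Finset.univ) => b1 i
  rw [Finset.sum_add_distrib, ← Finset.mul_sum, ← Finset.mul_sum] at b2
  have e1 := h.gradX_sub_corrX t
  have e2 := h.transverse_sub_corrT (ω := ω) t
  have n1 := normSq_nonneg (PHNLS.dilate (Real.exp t) (G none) - G none)
  have n2 := normSq_nonneg (PHNLS.dilate (Real.exp t) (fun z => z.2 • u z) - fun z => z.2 • u z)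
  have n3 := mul_nonneg hω.le (normSq_nonneg (PHNLS.dilate (Real.exp t) u - u))
  rw [h1Sq, Fintype.sum_option]
  have e3 : (dilateGrad (Real.exp t) G - G) none = PHNLS.dilate (Real.exp t) (G none) - G none := rfl
  have e4 : gradX G = ∑ i : Fin d, normSq (G (some i)) := rfl
  rw [e3]
  rw [← e4] at b2
  linarith

/-- Every weak solution satisfies the semivirial identity `Q = 0`. -/
theorem Admissible.virialFun_eq_zero (ha : Admissible d α ω) (h : EnergyFun u G)
    (hs : WeakSolution α ω u G) : virialFun α u G = 0 := by
  have hα := ha.α_pos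
  have hω := ha.pos
  have hp : 0 < α + 2 := by linarith
  have hdp := ha.d_pos
  obtain ⟨L, hL0, hL⟩ := h.exists_normSq_dilate_sub_le fun i =>
    ha.memLp_coord_smul_grad h hs i (some i)
  have iu := ha.integrable_rpow h
  have hN0 := powInt_nonneg (α + 2) u
  set N := powInt (α + 2) u with hN
  set κ := α * d / 2 with hκ
  have hκ0 : 0 < κ := by positivity
  set K := (α + 2) * (N ^ (α / (α + 2)) + (Real.exp κ * N) ^ (α / (α + 2))) + 1 with hK
  have hK0 : 0 < K := by positivity
  -- The value 1/(8K) turns the term 4δ of the H¹ bound into δ/2, as the absorption requires.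
  obtain ⟨S, hS, hS'⟩ := exists_powInt_rpow_le ha.two_le hα ha.upper (ε := 1 / (8 * K))
    (by positivity)
  set D : ℝ → ℝ := fun t => powInt (α + 2) (dilate (Real.exp t) u) / (α + 2) - N / (α + 2)
    - nonlin α u (dilate (Real.exp t) u - u) with hD
  have hNt : ∀ t, powInt (α + 2) (dilate (Real.exp t) u) = Real.exp (κ * t) * N := by
    intro t
    rw [powInt_add_two_dilate (Real.exp_pos t), ← Real.exp_mul, mul_comm t]
  have htay : ∀ t, 0 ≤ D t ∧ D t ≤ (α + 2) * ((∫ z, ‖u z‖ ^ α * ‖(dilate (Real.exp t) u - u) z‖ ^ 2)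
      + ∫ z, ‖dilate (Real.exp t) u z‖ ^ α * ‖(dilate (Real.exp t) u - u) z‖ ^ 2) := by
    intro t
    have hd := h.dilate (Real.exp_pos t)
    exact powInt_taylor hα h.memLp.1 hd.memLp.1 iu (ha.integrable_rpow hd)
      (ha.integrable_rpow (hd.sub h))
  have hA := gradX_nonneg G
  have hDle : ∀ t, |t| ≤ 1 → D t ≤ K * powInt (α + 2) (dilate (Real.exp t) u - u) ^ (2 / (α + 2)) := by
    intro t ht
    have hd := h.dilate (Real.exp_pos t)
    have id := ha.integrable_rpow hd
    have hv := hd.sub h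
    have iv := ha.integrable_rpow hv
    refine (htay t).2.trans ?_
    have h1 := integral_rpow_mul_sq_le hα h.memLp.1 hv.memLp.1 iu iv
    have h2 := integral_rpow_mul_sq_le hα hd.memLp.1 hv.memLp.1 id iv
    have h3 : powInt (α + 2) (dilate (Real.exp t) u) ^ (α / (α + 2))
        ≤ (Real.exp κ * N) ^ (α / (α + 2)) := by
      rw [hNt]
      have : κ * t ≤ κ := by nlinarith [(abs_le.1 ht).2]
      gcongr
    set P := powInt (α + 2) (dilate (Real.exp t) u - u) ^ (2 / (α + 2)) with hP
    have hP0 : 0 ≤ P := Real.rpow_nonneg (powInt_nonneg _ _) _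
    have h4 := mul_le_mul_of_nonneg_right h3 hP0
    calc _ ≤ (α + 2) * (N ^ (α / (α + 2)) * P + (Real.exp κ * N) ^ (α / (α + 2)) * P) := by
          refine mul_le_mul_of_nonneg_left ?_ hp.le
          linarith
      _ ≤ K * P := by
          rw [hK]
          linarith
  have key := eq_of_dilation_expansion (A := gradX G) (F := N / (α + 2)) (κ := κ)
    (C := 1 / 8 * (L + 8 * gradX G) + K * S * L) hA (by positivity) (g := corrX G)
    (δ := fun t => gradX G - corrX G t + (transverse ω u G - corrT ω u G t)) (D := D)
    (fun t _ => ?_) (fun t => ?_) (fun t => ?_) (fun t _ => (htay t).1) (fun t => ?_) (fun t => ?_)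
    (fun t ht => ?_)
  · rw [virialFun, key, hκ]
    field_simp
    ring
  · have hd := h.dilate (Real.exp_pos t)
    rw [← h.defect_dilate_sub, hs _ _ (hd.sub h)]
    simp only [hD, hNt]
    ring
  · simp only [corrX, innerRe_dilate_exp_neg]
  · simp only [corrX, corrT, innerRe_dilate_exp_neg]
  · have := h.gradX_sub_corrX t
    have := Finset.sum_nonneg fun i (_ : i ∈ Finset.univ) =>
      normSq_nonneg (dilate (Real.exp t) (G (some i)) - G (some i))
    linarith
  · have := h.transverse_sub_corrT (ω := ω) t
    have := normSq_nonneg (dilate (Real.exp t) (G none) - G none)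
    have := normSq_nonneg (dilate (Real.exp t) (fun z => z.2 • u z) - fun z => z.2 • u z)
    have := mul_nonneg hω.le (normSq_nonneg (dilate (Real.exp t) u - u))
    linarith
  · have hd := h.dilate (Real.exp_pos t)
    have h1 := hDle t ht
    have h2 := hS' _ _ (hd.sub h)
    have h3 := h.h1Sq_dilate_sub_le hω ht
    have h4 := hL t ht
    set δ := gradX G - corrX G t + (transverse ω u G - corrT ω u G t) with hδ
    calc D t ≤ K * powInt (α + 2) (dilate (Real.exp t) u - u) ^ (2 / (α + 2)) := h1
      _ ≤ K * (1 / (8 * K) * h1Sq (dilate (Real.exp t) u - u) (dilateGrad (Real.exp t) G - G)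
          + S * normSq (dilate (Real.exp t) u - u)) := by gcongr
      _ ≤ K * (1 / (8 * K) * (L * t ^ 2 + 8 * t ^ 2 * gradX G + 4 * δ) + S * (L * t ^ 2)) := by
          gcongr
          linarith
      _ = δ / 2 + (1 / 8 * (L + 8 * gradX G) + K * S * L) * t ^ 2 := by
          field_simp
          ring

end Pohozaev

end PHNLS

end

noncomputable section

namespace PHNLS

open Filter Topology ENNReal

variable {d : ℕ} {α ω : ℝ}

/-! ### Comparison of the two infima -/

theorem normSq_pos_iff {φ : L2 d} : 0 < normSq φ ↔ φ ≠ 0 := by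
  rw [← norm_Lp_sq]
  constructor
  · rintro h rfl
    simp at h
  · intro h
    have := norm_pos_iff.2 h
    positivity

theorem EnergyFun.toLp_mem_constraintSet {u : Space d → ℂ} {G : Option (Fin d) → Space d → ℂ}
    (h : EnergyFun u G) (hu : 0 < normSq u) (hQ : virialFun α u G = 0) :
    h.memLp.toLp ∈ constraintSet d α := by
  refine ⟨h.toLp_mem_Sigma, normSq_pos_iff.1 ?_, (h.semivirial_toLp α).trans hQ⟩
  rwa [normSq_congr h.memLp.coeFn_toLp]

/-- The semivirial identity in terms of classes; it yields m_ω ≤ m_GS. -/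
theorem Admissible.solutionSet_subset (ha : Admissible d α ω) :
    solutionSet d α ω ⊆ constraintSet d α := by
  intro φ hφ
  refine ⟨hφ.1, hφ.2.1, ?_⟩
  rw [semivirial_eq]
  exact ha.virialFun_eq_zero (energyFun_of_mem_Sigma hφ.1) (ha.weakSolution_of_mem_solutionSet hφ)

theorem Admissible.action_nonneg (ha : Admissible d α ω) {φ : L2 d} (hφ : φ ∈ constraintSet d α) :
    0 ≤ action α ω φ := by
  have h1 := hφ.2.2
  rw [semivirial_eq] at h1
  have h2 := ha.quadFun_eq φ (fun k => weakDeriv (dir k) φ)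
  have h3 := ha.quadFun_nonneg φ (fun k => weakDeriv (dir k) φ)
  have h4 : virialFun α φ (fun k => weakDeriv (dir k) φ) = 0 := h1
  rw [h4, mul_zero, sub_zero] at h2
  rw [action_eq]
  rw [h2] at h3
  exact h3

/-- If the constraint set is nonempty, the infimum is attained at a solution. -/
theorem Admissible.exists_solution (ha : Admissible d α ω) (hne : (constraintSet d α).Nonempty) :
    ∃ φ ∈ solutionSet d α ω, ∀ ψ ∈ constraintSet d α, action α ω φ ≤ action α ω ψ := by
  set A : Set ℝ := action α ω '' constraintSet d α with hA
  have hAne : A.Nonempty := hne.image _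
  have hbdd : BddBelow A := ⟨0, by
    rintro _ ⟨φ, hφ, rfl⟩
    exact ha.action_nonneg hφ⟩
  have hm : ∀ (u : Space d → ℂ) (G : Option (Fin d) → Space d → ℂ), EnergyFun u G →
      0 < normSq u → virialFun α u G = 0 → sInf A ≤ actionFun α ω u G := fun u G h hu hQ =>
    csInf_le hbdd ⟨_, h.toLp_mem_constraintSet hu hQ, h.action_toLp α ω⟩
  obtain ⟨x, -, hx, hxA⟩ := exists_seq_tendsto_sInf hAne hbdd
  choose φ hφ hφx using hxA
  obtain ⟨u, G, h, hu, hQ, hS⟩ := ha.exists_minimizer hm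
    (fun n => energyFun_of_mem_Sigma (hφ n).1) (fun n => normSq_pos_iff.2 (hφ n).2.1)
    (fun n => by
      have := (hφ n).2.2
      rwa [semivirial_eq] at this)
    (hx.congr fun n => by rw [← hφx n, action_eq]; rfl)
  have hsol : WeakSolution α ω u G := ha.weakSolution_of_minimizer
    (fun w W hw hw0 hwQ => hS.trans_le (hm w W hw hw0 hwQ)) h hu hQ
  have hc := h.toLp_mem_constraintSet hu hQ
  refine ⟨h.memLp.toLp, ⟨hc.1, hc.2.1, ha.solvesElliptic_toLp h hsol⟩, fun ψ hψ => ?_⟩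
  rw [h.action_toLp]
  exact hS.trans_le (csInf_le hbdd ⟨ψ, hψ, rfl⟩)

theorem Admissible.mOmega_eq_mGS (ha : Admissible d α ω) : mOmega d α ω = mGS d α ω := by
  -- The second bound is needed only when some ψ satisfies the constraint, so the nonemptiness
  -- assumed in `Admissible.exists_solution` is free and no example has to be constructed.
  refine le_antisymm (biInf_mono ha.solutionSet_subset) (le_iInf₂ fun ψ hψ => ?_)
  obtain ⟨φ, hφ, hle⟩ := ha.exists_solution ⟨ψ, hψ⟩
  exact (iInf₂_le φ hφ).trans (EReal.coe_le_coe_iff.2 (hle ψ hψ))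

end PHNLS

end

theorem lemma6p2 (d : ℕ) (hd : 2 ≤ d) (α : ℝ) (hα₁ : 4 / (d : ℝ) < α)
    (hα₂ : α < 4 / ((d : ℝ) - 1)) (ω : ℝ) (hω : 0 < ω) :
    PHNLS.mOmega d α ω = PHNLS.mGS d α ω ∧ PHNLS.PPlus d α ω = PHNLS.KPlus d α ω := by
  have h := (PHNLS.Admissible.mk hd hα₁ hα₂ hω).mOmega_eq_mGS
  refine ⟨h, ?_⟩
  unfold PHNLS.PPlus PHNLS.KPlus
  rw [h]
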